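/- Let $d\ge 1$, $\ell\ge 1$. Let $\mathcal T$ be a conforming simplicial mesh in $\mathbb R^d$ (a finite set of nondegenerate closed $d$-simplices, any two of which intersect in the possibly empty simplex spanned by their common vertices), consisting of at least two elements and meshing a domain $\Omega$: $\Omega$ is the interior of $\bigcup_{K\in\mathcal T}K$ and is connected. Write $S=\{v\in C^0(\Omega): v|_K\in\mathbb P_\ell(K)\ \forall K\in\mathcal T\}$, where $\mathbb P_\ell$ denotes polynomials of total degree at most $\ell$ and the values of $v$ on all of $K$ are those of the polynomial; let $\mathcal N$ be the set of Lagrange nodes of $S$ (points having barycentric coordinates in $\{0,\frac1\ell,\dots,1\}$ with respect to some element) and $\mathcal E$ the set of interior faces, i.e. of the $(d-1)$-dimensional faces of elements that are not contained in $\partial\Omega$. For $E\in\mathcal E$ let $\omega_E$ be the union of the (two) elements having $E$ as a face, and for $\omega\in\{\Omega\}\cup\{\omega_E\}_{E\in\mathcal E}$ let $S|_\omega=\{v|_\omega: v\in S\}$. Assume that $\mathcal T$ is face-connected: whenever $K,K'\in\mathcal T$ share a node $z\in\mathcal N$, there are pairwise different elements $K=K_1,\dots,K_n=K'$ such that each $K_j\cap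 K_{j+1}$ is an interior face containing $z$. Let $h_K$ be the diameter of $K$, $\rho_K$ the maximum diameter of a ball inscribed in $K$, $|K|$ its volume, and $$\bar n=\max_{z\in\mathcal N}\#\{K\in\mathcal T: z\in K\},\qquad \mu_{\mathcal T}=\max_{K\cap K'\neq\emptyset}\frac{|K|^{1/2}}{|K'|^{1/2}},\qquad \sigma_{\mathcal T}=\max_{K\cap K'\ne\emptyset}\frac{h_{K'}}{\rho_K},$$ the last two maxima being over $K,K'\in\mathcal T$. For $\varepsilon>0$ put $|||w|||_\omega=\big(\|w\|_{L^2(\omega)}^2+\varepsilon\|\nabla w\|_{L^2(\omega)}^2\big)^{1/2}$. Consider the inequalities $$\inf_{v\in S}|||u-v|||_\Omega\ \le\ C\Big(\sum_{E\in\mathcal E}\ \inf_{P\in S|_{\omega_E}}|||u-P|||_{\omega_E}^2\Big)^{1/2}\ \le\ C(d+1)\inf_{v\in S}|||u-v|||_\Omega .\qquad(*)$$ 1. There is a constant $C>0$, bounded in terms of $\ell$, $d$, $\bar n$, $\mu_{\mathcal T}$ and $\sigma_{\mathcal T}$ only, such that $(*)$ holds for every $\varepsilon>0$ and every $u\in H^1(\Omega)$.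 That is: for all upper bounds on $\bar n$, $\mu_{\mathcal T}$, $\sigma_{\mathcal T}$ there is one $C>0$, depending only on these bounds and on $\ell,d$, that is valid for all such meshes $\mathcal T$, all $\varepsilon>0$ and all $u\in H^1(\Omega)$. 2. If $\varepsilon$ is small relative to $\min_{K\in\mathcal T}\rho_K^2$, the dependence on the shape parameter disappears: for every $\kappa$ there is a constant $C>0$, bounded in terms of $\ell$, $d$, $\bar n$, $\mu_{\mathcal T}$ and $\kappa$ only, such that $(*)$ holds for every $\varepsilon$ with $0<\varepsilon\le\kappa\min_{K\in\mathcal T}\rho_K^2$ and every $u\in H^1(\Omega)$. -/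

import Mathlib

open MeasureTheory Set
open scoped ContDiff

noncomputable section

/-! ## The Sobolev space `H¹(Ω)` -/

/-- `g` is a weak gradient of `u` on the set `Ω ⊆ ℝᵈ`:
`∫_Ω u ∇φ = - ∫_Ω φ g` for all test functions `φ ∈ C_c^∞(Ω)`. -/
def HasWeakGradient {d : ℕ} (Ω : Set (EuclideanSpace ℝ (Fin d)))
    (u : EuclideanSpace ℝ (Fin d) → ℝ)
    (g : EuclideanSpace ℝ (Fin d) → EuclideanSpace ℝ (Fin d)) : Prop :=
  LocallyIntegrableOn u Ω ∧ LocallyIntegrableOn g Ω ∧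
    ∀ φ : EuclideanSpace ℝ (Fin d) → ℝ, ContDiff ℝ ∞ φ → HasCompactSupport φ → tsupport φ ⊆ Ω →
      ∫ x in Ω, u x • gradient φ x = - ∫ x in Ω, φ x • g x

/-- Weak gradients on an open set are unique almost everywhere. -/
theorem HasWeakGradient.ae_eq {d : ℕ} {Ω : Set (EuclideanSpace ℝ (Fin d))} (hΩ : IsOpen Ω)
    {u : EuclideanSpace ℝ (Fin d) → ℝ}
    {g₁ g₂ : EuclideanSpace ℝ (Fin d) → EuclideanSpace ℝ (Fin d)}
    (h₁ : HasWeakGradient Ω u g₁) (h₂ : HasWeakGradient Ω u g₂) :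
    ∀ᵐ x, x ∈ Ω → g₁ x = g₂ x := by
  have key : ∀ (φ : EuclideanSpace ℝ (Fin d) → ℝ)
      (g : EuclideanSpace ℝ (Fin d) → EuclideanSpace ℝ (Fin d)), tsupport φ ⊆ Ω →
      ∫ x in Ω, φ x • g x = ∫ x, φ x • g x := fun φ g hs =>
    setIntegral_eq_integral_of_forall_compl_eq_zero fun x hx => by
      rw [image_eq_zero_of_notMem_tsupport fun h => hx (hs h), zero_smul]
  have hint : ∀ (φ : EuclideanSpace ℝ (Fin d) → ℝ)
      (g : EuclideanSpace ℝ (Fin d) → EuclideanSpace ℝ (Fin d)), ContDiff ℝ ∞ φ →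
      HasCompactSupport φ → tsupport φ ⊆ Ω → LocallyIntegrableOn g Ω →
      Integrable (fun x => φ x • g x) := fun φ g hφ hc hs hg => by
    refine (integrableOn_iff_integrable_of_support_subset (s := tsupport φ) ?_).1
      ((hg.integrableOn_compact_subset hs hc.isCompact).continuousOn_smul
        hφ.continuous.continuousOn hc.isCompact)
    exact (Function.support_smul_subset_left φ g).trans (subset_tsupport φ)
  have h0 := hΩ.ae_eq_zero_of_integral_contDiff_smul_eq_zero (h₁.2.1.sub h₂.2.1)
    fun φ hφ hc hs => by
      simp only [Pi.sub_apply, smul_sub]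
      rw [integral_sub (hint φ g₁ hφ hc hs h₁.2.1) (hint φ g₂ hφ hc hs h₂.2.1),
        ← key φ g₁ hs, ← key φ g₂ hs, sub_eq_zero]
      exact neg_injective ((h₁.2.2 φ hφ hc hs).symm.trans (h₂.2.2 φ hφ hc hs))
  filter_upwards [h0] with x hx hxΩ
  exact sub_eq_zero.1 (hx hxΩ)

open Classical in
/-- The weak gradient of `u` on `Ω` (unique up to null sets; `0` if there is none). -/
def weakGradient {d : ℕ} (Ω : Set (EuclideanSpace ℝ (Fin d)))
    (u : EuclideanSpace ℝ (Fin d) → ℝ) : EuclideanSpace ℝ (Fin d) → EuclideanSpace ℝ (Fin d) :=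
  if h : ∃ g, HasWeakGradient Ω u g then h.choose else 0

/-- `u ∈ H¹(Ω)`: `u ∈ L²(Ω)` has a weak gradient in `L²(Ω)`. -/
def MemH1 {d : ℕ} (Ω : Set (EuclideanSpace ℝ (Fin d)))
    (u : EuclideanSpace ℝ (Fin d) → ℝ) : Prop :=
  MemLp u 2 (volume.restrict Ω) ∧
    ∃ g, HasWeakGradient Ω u g ∧ MemLp g 2 (volume.restrict Ω)

/-- The reaction-diffusion norm `(‖w‖² + ε ‖∇w‖²)^{1/2}` over a subset `D` of (the closure of) `Ω`,
for a function `w ∈ H¹(Ω)`. -/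
def rdNorm {d : ℕ} (Ω : Set (EuclideanSpace ℝ (Fin d))) (ε : ℝ)
    (D : Set (EuclideanSpace ℝ (Fin d))) (w : EuclideanSpace ℝ (Fin d) → ℝ) : ℝ :=
  Real.sqrt ((∫ x in D, (w x) ^ 2) + ε * ∫ x in D, ‖weakGradient Ω w x‖ ^ 2)

/-! ## Conforming simplicial meshes -/

/-- A conforming simplicial mesh in `ℝᵈ`: a finite set of nondegenerate `d`-simplices, each given by
its set of `d + 1` vertices, such that the intersection of two elements is the simplex (possibly
empty) spanned by their common vertices. -/
structure SimplicialMesh (d : ℕ) where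
  elements : Finset (Finset (EuclideanSpace ℝ (Fin d)))
  card_eq : ∀ K ∈ elements, K.card = d + 1
  affineIndependent : ∀ K ∈ elements,
    AffineIndependent ℝ (fun v : K => (v : EuclideanSpace ℝ (Fin d)))
  conforming : ∀ K ∈ elements, ∀ K' ∈ elements,
    convexHull ℝ (K : Set (EuclideanSpace ℝ (Fin d))) ∩ convexHull ℝ (K' : Set _) =
      convexHull ℝ ((K : Set _) ∩ (K' : Set _))

/-- The closed simplex with the given vertices. -/
def simplexHull {d : ℕ} (K : Finset (EuclideanSpace ℝ (Fin d))) :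
    Set (EuclideanSpace ℝ (Fin d)) :=
  convexHull ℝ (K : Set (EuclideanSpace ℝ (Fin d)))

/-- `h_K`, the diameter of a simplex. -/
def simplexDiam {d : ℕ} (K : Finset (EuclideanSpace ℝ (Fin d))) : ℝ :=
  Metric.diam (simplexHull K)

/-- `ρ_K`, the maximum diameter of a ball inscribed in a simplex. -/
def inscribedDiam {d : ℕ} (K : Finset (EuclideanSpace ℝ (Fin d))) : ℝ :=
  sSup {δ : ℝ | ∃ x r, 0 ≤ r ∧ Metric.closedBall x r ⊆ simplexHull K ∧ δ = 2 * r}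

/-- `|K|`, the `d`-dimensional Lebesgue measure of a simplex. -/
def simplexVol {d : ℕ} (K : Finset (EuclideanSpace ℝ (Fin d))) : ℝ :=
  volume.real (simplexHull K)

namespace SimplicialMesh

/-- The meshed open set `Ω`, the interior of the union of all (closed) elements. -/
def domain {d : ℕ} (T : SimplicialMesh d) : Set (EuclideanSpace ℝ (Fin d)) :=
  interior (⋃ K ∈ T.elements, simplexHull K)

open Classical in
/-- The set of all faces, i.e. of the `(d-1)`-dimensional faces of the elements (given by their
sets of `d` vertices). -/
def faces {d : ℕ} (T : SimplicialMesh d) : Finset (Finset (EuclideanSpace ℝ (Fin d))) :=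
  T.elements.biUnion fun K => K.powersetCard d

open Classical in
/-- The interior (interelement) faces: those not contained in the boundary `∂Ω`. -/
def interiorFaces {d : ℕ} (T : SimplicialMesh d) :
    Finset (Finset (EuclideanSpace ℝ (Fin d))) :=
  T.faces.filter fun F => ¬ simplexHull F ⊆ frontier T.domain

/-- `ω_F`, the union of the elements having `F` as a face. -/
def pair {d : ℕ} (T : SimplicialMesh d) (F : Finset (EuclideanSpace ℝ (Fin d))) :
    Set (EuclideanSpace ℝ (Fin d)) :=
  ⋃ K ∈ T.elements, ⋃ _ : F ⊆ K, simplexHull K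

/-- The finite element space `S^{ℓ,0}`: functions that are continuous on `Ω` and coincide on each
element with a polynomial of (total) degree at most `ℓ`. -/
def feSpace {d : ℕ} (T : SimplicialMesh d) (ℓ : ℕ) : Set (EuclideanSpace ℝ (Fin d) → ℝ) :=
  {v | ContinuousOn v T.domain ∧ ∀ K ∈ T.elements, ∃ p : MvPolynomial (Fin d) ℝ,
    p.totalDegree ≤ ℓ ∧ ∀ x ∈ simplexHull K, v x = MvPolynomial.eval (fun i => x i) p}

/-- The (Lagrange) nodes of `S^{ℓ,0}`: the points that have barycentric coordinates in
`{0, 1/ℓ, …, 1}` with respect to some element. -/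
def nodes {d : ℕ} (T : SimplicialMesh d) (ℓ : ℕ) : Set (EuclideanSpace ℝ (Fin d)) :=
  {z | ∃ K ∈ T.elements, ∃ α : EuclideanSpace ℝ (Fin d) → ℕ,
    ∑ v ∈ K, α v = ℓ ∧ z = ∑ v ∈ K, ((α v : ℝ) / (ℓ : ℝ)) • v}

/-- Face-connectedness: any two elements sharing a node `z` are joined by a finite sequence of
pairwise different elements such that consecutive ones intersect in an interelement face
containing `z`. -/
def FaceConnected {d : ℕ} (T : SimplicialMesh d) (ℓ : ℕ) : Prop :=
  ∀ z ∈ T.nodes ℓ, ∀ K ∈ T.elements, ∀ K' ∈ T.elements, z ∈ simplexHull K → z ∈ simplexHull K' →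
    ∃ (n : ℕ) (path : Fin (n + 1) → Finset (EuclideanSpace ℝ (Fin d))),
      (∀ j, path j ∈ T.elements) ∧ Function.Injective path ∧
      path 0 = K ∧ path (Fin.last n) = K' ∧
      ∀ j : Fin n, ∃ F ∈ T.interiorFaces, z ∈ simplexHull F ∧
        simplexHull (path j.castSucc) ∩ simplexHull (path j.succ) = simplexHull F

/-- `n̄`, the maximal number of elements containing a common node. -/
def nBar {d : ℕ} (T : SimplicialMesh d) (ℓ : ℕ) : ℕ :=
  sSup {m : ℕ | ∃ z ∈ T.nodes ℓ, m = {K | K ∈ T.elements ∧ z ∈ simplexHull K}.ncard}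

/-- `μ_T`, the maximum of `|K|^{1/2} / |K'|^{1/2}` over all elements `K` and `K'` touching each
other. -/
def mu {d : ℕ} (T : SimplicialMesh d) : ℝ :=
  sSup {r : ℝ | ∃ K ∈ T.elements, ∃ K' ∈ T.elements, (simplexHull K ∩ simplexHull K').Nonempty ∧
    r = Real.sqrt (simplexVol K) / Real.sqrt (simplexVol K')}

/-- The shape parameter `σ_T`, the maximum of `h_{K'} / ρ_K` over all elements `K` and `K'` touching
each other. -/
def shape {d : ℕ} (T : SimplicialMesh d) : ℝ :=
  sSup {r : ℝ | ∃ K ∈ T.elements, ∃ K' ∈ T.elements, (simplexHull K ∩ simplexHull K').Nonempty ∧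
    r = simplexDiam K' / inscribedDiam K}

/-- The best error `inf_P |||u - P|||_D` over the restrictions `P = v|_D`, `v ∈ S^{ℓ,0}`
(the norm over `D` depends on `v` only through `v|_D`). -/
def bestError {d : ℕ} (T : SimplicialMesh d) (ℓ : ℕ) (ε : ℝ)
    (D : Set (EuclideanSpace ℝ (Fin d))) (u : EuclideanSpace ℝ (Fin d) → ℝ) : ℝ :=
  ⨅ v : T.feSpace ℓ, rdNorm T.domain ε D (u - (v : EuclideanSpace ℝ (Fin d) → ℝ))

/-- The `ℓ²`-sum of the local best errors on the pairs associated with interior faces. -/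
def pairError {d : ℕ} (T : SimplicialMesh d) (ℓ : ℕ) (ε : ℝ)
    (u : EuclideanSpace ℝ (Fin d) → ℝ) : ℝ :=
  Real.sqrt (∑ F ∈ T.interiorFaces, (T.bestError ℓ ε (T.pair F) u) ^ 2)

end SimplicialMesh

end

/-! ## Barycentric coordinates on simplices -/

/-! The bound of the local errors by the global one is a counting argument: one global `v` is
restricted to all pairs, and an element lies in at most `d + 1` of them (`pairError_le`).

For the converse, fix any P_F ∈ S for each interior face F. Each element K gets a polynomial Q_K
built from one P_F with F ⊆ K, and v ∈ S is defined by giving each Lagrange node z the value Q_K'(z)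
for one element K' containing z. On K, v - Q_K is the combination of Lagrange polynomials with
coefficients Q_K'(z) - Q_K(z), and such a polynomial has squared norm at most a constant times |K|(1
+ ε/ρ_K²). Face-connectedness joins K' to K by at most n̄ elements around z, so each coefficient
telescopes into jumps across faces (`sq_node_sub_le`). At z ∈ F the function P_F has a single value,
so a jump splits into two differences, each living on one element. Thus `bestError_sq_le` reduces
the claim to two local facts: Q_K approximates u on K, and the jumps weighted by |K|(1 + ε/ρ_K²) are
controlled by the pair errors.

For the weight |K| this follows from the inverse estimate `sq_poly_le`, whose constant does not see
the shape of K because polynomials are uniformly Lipschitz in barycentric coordinates. If ε ≤ κ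
ρ_K², nothing else is needed and Q_K is simply P_F on K (`exists_localization_of_small`).

For general ε the weight |K| ε/ρ_K² asks for a jump bound of order h times gradient errors, and
gradients do not see constants. Hence Q_K = P_F + m_K(u - P_F), where m_K is a smooth weighted mean
over a ball inside K. Two polynomials corrected in this way differ by a polynomial of weighted mean
zero, to which a Poincaré inequality applies (`sq_corrected_sub_le`). What remains is m_K₁(w) -
m_K₂(w) with w = u - P_F for elements sharing F. It is bounded by h times the gradient of w by
moving and scaling the averaging ball from K₁ to K₂: the derivative of the mean along the motion is
a mean of velocity times weak gradient (`exists_average_bound`). The motion passes from K₁ to K₂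
inside a ball around the barycenter of F (`exists_face_ball`), so no trace theorem is used. -/

/-- Euclidean space of dimension `d`. -/
abbrev Euc (d : ℕ) : Type := EuclideanSpace ℝ (Fin d)

/-- `K` is the vertex set of a nondegenerate `d`-simplex. -/
structure IsSimplex {d : ℕ} (K : Finset (Euc d)) : Prop where
  card_eq : K.card = d + 1
  affineIndependent : AffineIndependent ℝ (fun v : K => (v : Euc d))

namespace IsSimplex

variable {d : ℕ} {K : Finset (Euc d)}

/-- The vertices of a simplex as an affine basis. -/
noncomputable def basis (hK : IsSimplex K) : AffineBasis K ℝ (Euc d) where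
  toFun := fun v => v
  ind' := hK.affineIndependent
  tot' := by
    rw [hK.affineIndependent.affineSpan_eq_top_iff_card_eq_finrank_add_one]
    simp [hK.card_eq]

@[simp] theorem basis_apply (hK : IsSimplex K) (v : K) : hK.basis v = v := rfl

end IsSimplex

open Classical in
/-- The barycentric coordinate of a simplex belonging to the point `v`; it is `0` if `v` is not a
vertex. -/
noncomputable def bary {d : ℕ} (K : Finset (Euc d)) (v : Euc d) : Euc d →ᵃ[ℝ] ℝ :=
  if h : IsSimplex K ∧ v ∈ K then h.1.basis.coord ⟨v, h.2⟩ else 0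

namespace IsSimplex

variable {d : ℕ} {K K' : Finset (Euc d)} {v w x y : Euc d}

theorem bary_of_mem (hK : IsSimplex K) (hv : v ∈ K) : bary K v = hK.basis.coord ⟨v, hv⟩ :=
  dif_pos ⟨hK, hv⟩

theorem bary_of_notMem (hv : v ∉ K) : bary K v = 0 := dif_neg fun h => hv h.2

theorem bary_apply_self (hK : IsSimplex K) (hv : v ∈ K) : bary K v v = 1 := by
  rw [hK.bary_of_mem hv]; exact hK.basis.coord_apply_eq ⟨v, hv⟩

theorem bary_apply_ne (hK : IsSimplex K) (hw : w ∈ K) (h : v ≠ w) : bary K v w = 0 := by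
  by_cases hv : v ∈ K
  · rw [hK.bary_of_mem hv]
    exact hK.basis.coord_apply_ne (i := ⟨v, hv⟩) (j := ⟨w, hw⟩) (by simpa using h)
  · simp [bary_of_notMem hv]

theorem sum_bary (hK : IsSimplex K) (x : Euc d) : ∑ v ∈ K, bary K v x = 1 := by
  rw [← hK.basis.sum_coord_apply_eq_one x, ← Finset.sum_coe_sort]
  exact Finset.sum_congr rfl fun v _ => by rw [hK.bary_of_mem v.2]

theorem sum_bary_smul (hK : IsSimplex K) (x : Euc d) : ∑ v ∈ K, bary K v x • v = x := by
  conv_rhs => rw [← hK.basis.linear_combination_coord_eq_self x]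
  rw [← Finset.sum_coe_sort]
  exact Finset.sum_congr rfl fun v _ => by rw [hK.bary_of_mem v.2]; rfl

/-- An affine function evaluated at an affine combination. -/
theorem map_affine_combination {f : Euc d →ᵃ[ℝ] ℝ} {s : Finset (Euc d)} {c : Euc d → ℝ}
    (hc : ∑ v ∈ s, c v = 1) : f (∑ v ∈ s, c v • v) = ∑ v ∈ s, c v * f v := by
  have h : ∀ x, f x = f.linear x + f 0 := fun x => by
    have := f.map_vadd 0 x
    simpa using this
  rw [h, map_sum]
  simp only [map_smul, smul_eq_mul]
  conv_rhs => enter [2, v]; rw [h v, mul_add]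
  rw [Finset.sum_add_distrib, ← Finset.sum_mul, hc, one_mul]

theorem affine_eq_sum (hK : IsSimplex K) (f : Euc d →ᵃ[ℝ] ℝ) (x : Euc d) :
    f x = ∑ v ∈ K, bary K v x * f v := by
  conv_lhs => rw [← hK.sum_bary_smul x]
  exact map_affine_combination (hK.sum_bary x)

theorem bary_combination (hK : IsSimplex K) {s : Finset (Euc d)} (hs : s ⊆ K) {c : Euc d → ℝ}
    (hc : ∑ v ∈ s, c v = 1) (v : Euc d) [Decidable (v ∈ s)] :
    bary K v (∑ v ∈ s, c v • v) = if v ∈ s then c v else 0 := by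
  rw [map_affine_combination hc]
  split_ifs with hv
  · rw [Finset.sum_eq_single_of_mem v hv fun w hw hwv => by
      rw [hK.bary_apply_ne (hs hw) hwv.symm, mul_zero], hK.bary_apply_self (hs hv), mul_one]
  · refine Finset.sum_eq_zero fun w hw => ?_
    rw [hK.bary_apply_ne (hs hw) (by rintro rfl; exact hv hw), mul_zero]

theorem mem_simplexHull_iff (hK : IsSimplex K) : x ∈ simplexHull K ↔ ∀ v ∈ K, 0 ≤ bary K v x := by
  have hr : Set.range hK.basis = (K : Set (Euc d)) := by
    ext y; simp
  rw [simplexHull, ← hr, hK.basis.convexHull_eq_nonneg_coord]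
  simp only [mem_ofPred_eq, Subtype.forall]
  exact forall₂_congr fun v hv => by rw [hK.bary_of_mem hv]

theorem interior_simplexHull (hK : IsSimplex K) :
    interior (simplexHull K) = {x | ∀ v ∈ K, 0 < bary K v x} := by
  have hr : Set.range hK.basis = (K : Set (Euc d)) := by
    ext y; simp
  rw [simplexHull, ← hr, hK.basis.interior_convexHull]
  ext x
  simp only [mem_ofPred_eq, Subtype.forall]
  exact forall₂_congr fun v hv => by rw [hK.bary_of_mem hv]

theorem bary_nonneg (hK : IsSimplex K) (hx : x ∈ simplexHull K) (v : Euc d) : 0 ≤ bary K v x := by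
  by_cases hv : v ∈ K
  · exact hK.mem_simplexHull_iff.1 hx v hv
  · simp [bary_of_notMem hv]

theorem bary_le_one (hK : IsSimplex K) (hx : x ∈ simplexHull K) (v : Euc d) : bary K v x ≤ 1 := by
  by_cases hv : v ∈ K
  · rw [← hK.sum_bary x]
    exact Finset.single_le_sum (f := fun v => bary K v x) (fun w _ => hK.bary_nonneg hx w) hv
  · simp [bary_of_notMem hv]

theorem mem_hull_of_subset (hK : IsSimplex K) {F : Finset (Euc d)} (hF : F ⊆ K) :
    x ∈ simplexHull F ↔ x ∈ simplexHull K ∧ ∀ v ∈ K, v ∉ F → bary K v x = 0 := by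
  classical
  constructor
  · intro hx
    refine ⟨convexHull_mono (by exact_mod_cast hF) hx, fun v _ hv => ?_⟩
    rw [simplexHull, Finset.convexHull_eq, mem_ofPred_eq] at hx
    obtain ⟨c, -, hc, rfl⟩ := hx
    rw [Finset.centerMass_eq_of_sum_1 _ _ hc]
    simp only [id]
    rw [hK.bary_combination hF hc, if_neg hv]
  · rintro ⟨hx, h0⟩
    have h1 := hK.sum_bary x
    have h2 := hK.sum_bary_smul x
    rw [← Finset.sum_subset hF fun v hv hv' => h0 v hv hv'] at h1
    rw [← Finset.sum_subset hF fun v hv hv' => by rw [h0 v hv hv', zero_smul]] at h2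
    rw [← h2]
    exact (convex_convexHull ℝ _).sum_mem (fun v _ => hK.bary_nonneg hx v) h1
      fun v hv => subset_convexHull ℝ _ hv

/-- Barycentric coordinates agree on the simplex spanned by common vertices. -/
theorem bary_eq_of_mem_common (hK : IsSimplex K) (hK' : IsSimplex K')
    (hx : x ∈ convexHull ℝ ((K : Set (Euc d)) ∩ K')) (v : Euc d) : bary K v x = bary K' v x := by
  classical
  rw [← Finset.coe_inter, Finset.convexHull_eq, mem_ofPred_eq] at hx
  obtain ⟨c, -, hc, rfl⟩ := hx
  rw [Finset.centerMass_eq_of_sum_1 _ _ hc]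
  simp only [id]
  rw [hK.bary_combination Finset.inter_subset_left hc,
    hK'.bary_combination Finset.inter_subset_right hc]

theorem isCompact_simplexHull (K : Finset (Euc d)) : IsCompact (simplexHull K) :=
  K.finite_toSet.isCompact_convexHull (𝕜 := ℝ)

theorem isClosed_simplexHull (K : Finset (Euc d)) : IsClosed (simplexHull K) :=
  (isCompact_simplexHull K).isClosed

theorem convex_simplexHull (K : Finset (Euc d)) : Convex ℝ (simplexHull K) :=
  convex_convexHull ℝ _

theorem measurableSet_simplexHull (K : Finset (Euc d)) : MeasurableSet (simplexHull K) :=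
  (isClosed_simplexHull K).measurableSet

theorem volume_simplexHull_lt_top (K : Finset (Euc d)) : volume (simplexHull K) < ⊤ :=
  (isCompact_simplexHull K).measure_lt_top

theorem interior_nonempty (hK : IsSimplex K) : (interior (simplexHull K)).Nonempty := by
  classical
  have hp : (0 : ℝ) < (d : ℝ) + 1 := by positivity
  have hc : ∑ _v ∈ K, (1 / ((d : ℝ) + 1)) = 1 := by
    rw [Finset.sum_const, hK.card_eq, nsmul_eq_mul]; push_cast; field_simp
  refine ⟨∑ v ∈ K, (1 / ((d : ℝ) + 1)) • v, ?_⟩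
  rw [hK.interior_simplexHull]
  intro v hv
  rw [hK.bary_combination subset_rfl hc, if_pos hv]
  positivity

theorem simplexVol_pos (hK : IsSimplex K) : 0 < simplexVol K := by
  refine ENNReal.toReal_pos (ne_of_gt ?_) (volume_simplexHull_lt_top K).ne
  exact (isOpen_interior.measure_pos volume hK.interior_nonempty).trans_le
    (measure_mono interior_subset)

theorem volume_frontier (K : Finset (Euc d)) : volume (frontier (simplexHull K)) = 0 :=
  (convex_simplexHull K).addHaar_frontier volume

theorem closure_interior (hK : IsSimplex K) :
    closure (interior (simplexHull K)) = simplexHull K := by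
  rw [(convex_simplexHull K).closure_interior_eq_closure_of_nonempty_interior hK.interior_nonempty,
    (isClosed_simplexHull K).closure_eq]

theorem ae_interior (K : Finset (Euc d)) :
    (interior (simplexHull K) : Set (Euc d)) =ᵐ[volume] simplexHull K :=
  interior_ae_eq_of_null_frontier (volume_frontier K)

/-! ### Size of a simplex -/

/-- A closed ball has diameter twice its radius only in positive dimension, which is where `1 ≤ d`
enters. -/
theorem bddAbove_inscribed (hd : 1 ≤ d) (K : Finset (Euc d)) :
    ∀ δ ∈ {δ : ℝ | ∃ x r, 0 ≤ r ∧ Metric.closedBall x r ⊆ simplexHull K ∧ δ = 2 * r},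
      δ ≤ simplexDiam K := by
  rintro δ ⟨x, r, hr, hx, rfl⟩
  have : Nonempty (Fin d) := ⟨⟨0, hd⟩⟩
  have := Metric.diam_mono hx (isCompact_simplexHull K).isBounded
  rwa [Metric.diam_closedBall_eq x hr] at this

theorem le_inscribedDiam (hd : 1 ≤ d) {r : ℝ} (hr : 0 ≤ r)
    (h : Metric.closedBall x r ⊆ simplexHull K) : 2 * r ≤ inscribedDiam K :=
  le_csSup ⟨_, bddAbove_inscribed hd K⟩ ⟨x, r, hr, h, rfl⟩

theorem inscribedDiam_pos (hK : IsSimplex K) (hd : 1 ≤ d) : 0 < inscribedDiam K := by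
  obtain ⟨x, hx⟩ := hK.interior_nonempty
  obtain ⟨r, hr, h⟩ := Metric.nhds_basis_closedBall.mem_iff.1 (mem_interior_iff_mem_nhds.1 hx)
  have := le_inscribedDiam hd hr.le h
  linarith

theorem inscribedDiam_le_diam (hK : IsSimplex K) (hd : 1 ≤ d) :
    inscribedDiam K ≤ simplexDiam K := by
  obtain ⟨x, hx⟩ := hK.interior_nonempty
  refine csSup_le ⟨0, x, 0, le_rfl, ?_, by simp⟩ (bddAbove_inscribed hd K)
  simpa using interior_subset hx

theorem simplexDiam_pos (hK : IsSimplex K) (hd : 1 ≤ d) : 0 < simplexDiam K :=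
  (hK.inscribedDiam_pos hd).trans_le (hK.inscribedDiam_le_diam hd)

/-- It is not needed that the supremum defining ρ_K is attained: every radius below ρ_K / 2 occurs,
and ρ_K / 4 is such a radius. -/
theorem exists_inscribed (hK : IsSimplex K) (hd : 1 ≤ d) :
    ∃ x, Metric.closedBall x (inscribedDiam K / 4) ⊆ simplexHull K := by
  obtain ⟨z, hz⟩ := hK.interior_nonempty
  have hpos := hK.inscribedDiam_pos hd
  obtain ⟨δ, ⟨x, r, hr, h, rfl⟩, hlt⟩ := exists_lt_of_lt_csSup
    (s := {δ : ℝ | ∃ x r, 0 ≤ r ∧ Metric.closedBall x r ⊆ simplexHull K ∧ δ = 2 * r})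
    ⟨0, z, 0, le_rfl, by simpa using interior_subset hz, by simp⟩
    (show inscribedDiam K / 2 < inscribedDiam K by linarith)
  exact ⟨x, (Metric.closedBall_subset_closedBall (by linarith)).trans h⟩

theorem dist_le_diam (hx : x ∈ simplexHull K) (hy : y ∈ simplexHull K) :
    dist x y ≤ simplexDiam K :=
  Metric.dist_le_diam_of_mem (isCompact_simplexHull K).isBounded hx hy

theorem bary_sub (K : Finset (Euc d)) (v x y : Euc d) :
    bary K v x - bary K v y = (bary K v).linear (x - y) := by
  simpa using ((bary K v).linearMap_vsub x y).symm

/-- Barycentric coordinates are Lipschitz with constant `1 / ρ_K`. -/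
theorem abs_bary_sub_le (hK : IsSimplex K) (hd : 1 ≤ d) (v x y : Euc d) :
    |bary K v x - bary K v y| ≤ dist x y / inscribedDiam K := by
  have hpos := hK.inscribedDiam_pos hd
  rw [le_div_iff₀ hpos]
  rcases eq_or_ne x y with rfl | hxy
  · simp
  have hn : 0 < dist x y := dist_pos.2 hxy
  by_cases h0 : bary K v x - bary K v y = 0
  · rw [h0]; simp
  have ha : 0 < |bary K v x - bary K v y| := abs_pos.2 h0
  rw [mul_comm, ← le_div_iff₀ ha]
  obtain ⟨z, hz⟩ := hK.interior_nonempty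
  refine csSup_le ⟨0, z, 0, le_rfl, by simpa using interior_subset hz, by simp⟩ ?_
  rintro δ ⟨c, r, hr, hc, rfl⟩
  rw [le_div_iff₀ ha]
  -- These are the endpoints of the diameter of an inscribed ball in the direction of `x - y`.
  -- Between them the coordinate changes by at most one, and linearity transfers this to `x` and
  -- `y`.
  have hmem : ∀ s : ℝ, |s| = 1 → c + (s * r / dist x y) • (x - y) ∈ simplexHull K := by
    intro s hs
    apply hc
    rw [Metric.mem_closedBall, dist_eq_norm, add_sub_cancel_left, norm_smul, ← dist_eq_norm,
      Real.norm_eq_abs, abs_div, abs_mul, hs, abs_of_pos hn, abs_of_nonneg hr]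
    field_simp; exact le_rfl
  have e : bary K v (c + (1 * r / dist x y) • (x - y)) -
      bary K v (c + (-1 * r / dist x y) • (x - y)) =
      2 * r / dist x y * (bary K v x - bary K v y) := by
    rw [bary_sub, bary_sub, add_sub_add_left_eq_sub, ← sub_smul, map_smul, smul_eq_mul]
    ring
  have h1 := hK.bary_nonneg (hmem 1 (by simp)) v
  have h2 := hK.bary_le_one (hmem 1 (by simp)) v
  have h3 := hK.bary_nonneg (hmem (-1) (by simp)) v
  have h4 := hK.bary_le_one (hmem (-1) (by simp)) v
  have h5 : |2 * r / dist x y * (bary K v x - bary K v y)| ≤ 1 := by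
    rw [← e, abs_le]; constructor <;> linarith
  rw [abs_mul, abs_of_nonneg (by positivity)] at h5
  have := mul_le_mul_of_nonneg_left h5 hn.le
  calc 2 * r * |bary K v x - bary K v y|
      = dist x y * (2 * r / dist x y * |bary K v x - bary K v y|) := by field_simp
    _ ≤ dist x y := by linarith

theorem simplexVol_le (hK : IsSimplex K) (hd : 1 ≤ d) :
    simplexVol K ≤ simplexDiam K ^ d * volume.real (Metric.closedBall (0 : Euc d) 1) := by
  obtain ⟨x, hx⟩ := hK.interior_nonempty
  have hx := interior_subset hx
  have hsub : simplexHull K ⊆ Metric.closedBall x (simplexDiam K) := fun y hy =>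
    Metric.mem_closedBall.2 (dist_le_diam hy hx)
  refine (measureReal_mono hsub Metric.isBounded_closedBall.measure_lt_top.ne).trans_eq ?_
  rw [measureReal_def, Measure.addHaar_closedBall' _ _ (hK.simplexDiam_pos hd).le]
  rw [ENNReal.toReal_mul, ENNReal.toReal_ofReal (by have := hK.simplexDiam_pos hd; positivity),
    finrank_euclideanSpace_fin]
  rfl

end IsSimplex

/-! ## Lagrange polynomials on simplices -/

section PolynomialFunctions

variable {d : ℕ}

/-- `f` is a polynomial function of total degree at most `k`. -/
def IsPolyFun (k : ℕ) (f : Euc d → ℝ) : Prop :=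
  ∃ p : MvPolynomial (Fin d) ℝ, p.totalDegree ≤ k ∧
    ∀ x : Euc d, f x = MvPolynomial.eval (fun i => x i) p

namespace IsPolyFun

variable {k m : ℕ} {f g : Euc d → ℝ}

theorem const (c : ℝ) : IsPolyFun k (fun _ : Euc d => c) :=
  ⟨MvPolynomial.C c, by simp, by simp⟩

theorem coord (i : Fin d) : IsPolyFun 1 (fun x : Euc d => x i) :=
  ⟨MvPolynomial.X i, by simp, by simp⟩

theorem add (hf : IsPolyFun k f) (hg : IsPolyFun k g) : IsPolyFun k (fun x => f x + g x) := by
  obtain ⟨p, hp, hfp⟩ := hf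
  obtain ⟨q, hq, hgq⟩ := hg
  exact ⟨p + q, (MvPolynomial.totalDegree_add p q).trans (max_le hp hq), fun x => by
    simp [hfp, hgq]⟩

theorem mul (hf : IsPolyFun k f) (hg : IsPolyFun m g) : IsPolyFun (k + m) (fun x => f x * g x) := by
  obtain ⟨p, hp, hfp⟩ := hf
  obtain ⟨q, hq, hgq⟩ := hg
  exact ⟨p * q, (MvPolynomial.totalDegree_mul p q).trans (add_le_add hp hq), fun x => by
    simp [hfp, hgq]⟩

theorem const_mul (c : ℝ) (hf : IsPolyFun k f) : IsPolyFun k (fun x => c * f x) := by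
  simpa using (const (k := 0) c).mul hf

theorem sub (hf : IsPolyFun k f) (hg : IsPolyFun k g) : IsPolyFun k (fun x => f x - g x) := by
  simpa [sub_eq_add_neg] using hf.add (hg.const_mul (-1))

theorem sum {ι : Type*} {s : Finset ι} {f : ι → Euc d → ℝ} (h : ∀ i ∈ s, IsPolyFun k (f i)) :
    IsPolyFun k (fun x => ∑ i ∈ s, f i x) := by
  classical
  induction s using Finset.induction_on with
  | empty => simpa using const 0
  | insert a s ha ih =>
    simp only [Finset.sum_insert ha]
    exact (h a (by simp)).add (ih fun i hi => h i (by simp [hi]))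

theorem prod {ι : Type*} {s : Finset ι} {f : ι → Euc d → ℝ} {k : ι → ℕ}
    (h : ∀ i ∈ s, IsPolyFun (k i) (f i)) : IsPolyFun (∑ i ∈ s, k i) (fun x => ∏ i ∈ s, f i x) := by
  classical
  induction s using Finset.induction_on with
  | empty => simpa using const 1
  | insert a s ha ih =>
    simp only [Finset.prod_insert ha, Finset.sum_insert ha]
    exact (h a (by simp)).mul (ih fun i hi => h i (by simp [hi]))

theorem affine (f : Euc d →ᵃ[ℝ] ℝ) : IsPolyFun 1 f := by
  have h : ∀ x : Euc d, f x = (∑ i, f.linear (EuclideanSpace.single i 1) * x i) + f 0 := by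
    intro x
    have h1 : f x = f.linear x + f 0 := by simpa using f.map_vadd 0 x
    have h2 : x = ∑ i, x i • EuclideanSpace.single i (1 : ℝ) := by
      ext j; simp [Finset.sum_apply, Pi.single_apply]
    rw [h1]
    conv_lhs => rw [h2, map_sum]
    simp [mul_comm]
  rw [show (f : Euc d → ℝ) = fun x => _ from funext h]
  exact (sum fun i _ => (coord i).const_mul _).add (const _)

end IsPolyFun

end PolynomialFunctions

/-! ### Lagrange interpolation on the lattice of multi-indices by products of binomial polynomials.
-/

section Lattice

/-- The polynomial `x (x - 1) ⋯ (x - k + 1) / k!`. -/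
noncomputable def binomFun (k : ℕ) (x : ℝ) : ℝ := ∏ j ∈ Finset.range k, (x - j) / (j + 1)

theorem binomFun_zero (x : ℝ) : binomFun 0 x = 1 := by simp [binomFun]

theorem binomFun_succ (k : ℕ) (x : ℝ) :
    (x - k) * binomFun k x = (k + 1) * binomFun (k + 1) x := by
  have : (k : ℝ) + 1 ≠ 0 := by positivity
  rw [binomFun, binomFun, Finset.prod_range_succ]; field_simp

theorem binomFun_self (k : ℕ) : binomFun k k = 1 := by
  have hne : ∏ j ∈ Finset.range k, ((j : ℝ) + 1) ≠ 0 :=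
    Finset.prod_ne_zero_iff.2 fun j _ => by positivity
  rw [binomFun, Finset.prod_div_distrib, div_eq_one_iff_eq hne,
    ← Finset.prod_range_reflect fun j => (j : ℝ) + 1]
  refine Finset.prod_congr rfl fun j hj => ?_
  have hj := Finset.mem_range.1 hj
  rw [show k - 1 - j = k - (j + 1) by omega, Nat.cast_sub (by omega)]
  push_cast; ring

theorem binomFun_of_lt {n k : ℕ} (h : n < k) : binomFun k n = 0 :=
  Finset.prod_eq_zero (Finset.mem_range.2 h) (by simp)

theorem abs_prod_le_pow {ι : Type*} {s : Finset ι} {a : ι → ℝ} {M : ℝ}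
    (ha : ∀ i ∈ s, |a i| ≤ M) : |∏ i ∈ s, a i| ≤ M ^ s.card := by
  rw [Finset.abs_prod]
  exact (Finset.prod_le_prod (fun i _ => abs_nonneg _) ha).trans_eq (by simp)

/-- The factors are exchanged one at a time; `1 ≤ M` absorbs the factor that is missing in each
term. -/
theorem abs_prod_sub_prod_le {ι : Type*} {s : Finset ι} {a b : ι → ℝ} {M δ : ℝ} (hM : 1 ≤ M)
    (ha : ∀ i ∈ s, |a i| ≤ M) (hb : ∀ i ∈ s, |b i| ≤ M) (hab : ∀ i ∈ s, |a i - b i| ≤ δ) :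
    |∏ i ∈ s, a i - ∏ i ∈ s, b i| ≤ M ^ s.card * (s.card * δ) := by
  classical
  induction s using Finset.induction_on with
  | empty => simp
  | insert i s hi ih =>
    have hδ : 0 ≤ δ := (abs_nonneg _).trans (hab i (by simp))
    have ih := ih (fun j hj => ha j (by simp [hj])) (fun j hj => hb j (by simp [hj]))
      (fun j hj => hab j (by simp [hj]))
    rw [Finset.prod_insert hi, Finset.prod_insert hi, Finset.card_insert_of_notMem hi,
      show a i * ∏ j ∈ s, a j - b i * ∏ j ∈ s, b j =
        a i * (∏ j ∈ s, a j - ∏ j ∈ s, b j) + (a i - b i) * ∏ j ∈ s, b j by ring]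
    have h1 : |∏ j ∈ s, b j| ≤ M ^ s.card := abs_prod_le_pow fun j hj => hb j (by simp [hj])
    have h2 := hab i (by simp)
    have h3 := ha i (by simp)
    have hp : 0 ≤ M ^ s.card := by positivity
    calc _ ≤ |a i| * |∏ j ∈ s, a j - ∏ j ∈ s, b j| + |a i - b i| * |∏ j ∈ s, b j| := by
          rw [← abs_mul, ← abs_mul]; exact abs_add_le _ _
      _ ≤ M * (M ^ s.card * (s.card * δ)) + δ * M ^ s.card := by gcongr
      _ ≤ M * (M ^ s.card * (s.card * δ)) + M * (δ * M ^ s.card) := by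
          have : 0 ≤ δ * M ^ s.card := by positivity
          nlinarith
      _ = M ^ (s.card + 1) * ((s.card + 1 : ℕ) * δ) := by push_cast; ring

theorem abs_binom_factor_le {ℓ j : ℕ} {x : ℝ} (hj : j < ℓ) (hx : 0 ≤ x) (hx' : x ≤ ℓ) :
    |(x - j) / (j + 1)| ≤ ℓ := by
  have hj' : (j : ℝ) ≤ ℓ := by exact_mod_cast hj.le
  have hj0 : (0 : ℝ) ≤ j := by positivity
  rw [abs_div, div_le_iff₀ (by positivity), abs_of_pos (show (0 : ℝ) < j + 1 by positivity), abs_le]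
  constructor <;> nlinarith

theorem abs_binomFun_le {ℓ k : ℕ} {x : ℝ} (hℓ : 1 ≤ ℓ) (hk : k ≤ ℓ) (hx : 0 ≤ x) (hx' : x ≤ ℓ) :
    |binomFun k x| ≤ (ℓ : ℝ) ^ ℓ := by
  refine (abs_prod_le_pow (M := ℓ) fun j hj =>
    abs_binom_factor_le ((Finset.mem_range.1 hj).trans_le hk) hx hx').trans ?_
  rw [Finset.card_range]
  exact pow_le_pow_right₀ (by exact_mod_cast hℓ) hk

theorem abs_binomFun_sub_le {ℓ k : ℕ} {x y : ℝ} (hℓ : 1 ≤ ℓ) (hk : k ≤ ℓ) (hx : 0 ≤ x)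
    (hx' : x ≤ ℓ) (hy : 0 ≤ y) (hy' : y ≤ ℓ) :
    |binomFun k x - binomFun k y| ≤ (ℓ : ℝ) ^ ℓ * (ℓ * |x - y|) := by
  have hℓ' : (1 : ℝ) ≤ ℓ := by exact_mod_cast hℓ
  refine (abs_prod_sub_prod_le (M := ℓ) (δ := |x - y|) hℓ'
    (fun j hj => abs_binom_factor_le ((Finset.mem_range.1 hj).trans_le hk) hx hx')
    (fun j hj => abs_binom_factor_le ((Finset.mem_range.1 hj).trans_le hk) hy hy')
    (fun j _ => ?_)).trans ?_
  · rw [← sub_div, sub_sub_sub_cancel_right, abs_div]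
    refine div_le_self (abs_nonneg _) ?_
    rw [abs_of_pos (by positivity)]
    linarith [show (0 : ℝ) ≤ j by positivity]
  · rw [Finset.card_range]
    have : (k : ℝ) ≤ ℓ := by exact_mod_cast hk
    gcongr

/-- Products of binomial polynomials. -/
noncomputable def binomProd {ι : Type*} (s : Finset ι) (α : ι →₀ ℕ) (t : ι → ℝ) : ℝ :=
  ∏ i ∈ s, binomFun (α i) (t i)

variable {ι X : Type*} [DecidableEq ι] {s : Finset ι} {t : X → ι → ℝ} {ℓ : ℕ}

/-- This recursion is used twice: read for a single `i` it absorbs multiplication by a coordinate,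
and summed over `i` it raises the degree of the index. -/
theorem sub_mul_binomProd {i : ι} (hi : i ∈ s) (α : ι →₀ ℕ) (t : ι → ℝ) :
    (t i - α i) * binomProd s α t = (α i + 1) * binomProd s (α + Finsupp.single i 1) t := by
  rw [binomProd, binomProd, ← Finset.mul_prod_erase s _ hi, ← Finset.mul_prod_erase s _ hi,
    ← mul_assoc, binomFun_succ, mul_assoc]
  have : ∏ x ∈ s.erase i, binomFun ((α + Finsupp.single i 1 : ι →₀ ℕ) x) (t x) =
      ∏ x ∈ s.erase i, binomFun (α x) (t x) :=
    Finset.prod_congr rfl fun j hj => by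
      rw [Finsupp.add_apply, Finsupp.single_eq_of_ne (Finset.ne_of_mem_erase hj), add_zero]
  rw [this]
  simp

theorem add_single_mem_finsuppAntidiag {i : ι} (hi : i ∈ s) {α : ι →₀ ℕ} {m : ℕ}
    (hα : α ∈ s.finsuppAntidiag m) : α + Finsupp.single i 1 ∈ s.finsuppAntidiag (m + 1) := by
  rw [Finset.mem_finsuppAntidiag] at hα ⊢
  refine ⟨?_, Finsupp.support_add.trans (Finset.union_subset hα.2
    (Finsupp.support_single_subset.trans (by simpa using hi)))⟩
  have := hα.1
  simp only [Finsupp.coe_add, Pi.add_apply, Finset.sum_add_distrib]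
  rw [this, Finset.sum_eq_single_of_mem i hi fun j _ hj => Finsupp.single_eq_of_ne hj]
  simp

/-- The span of the products of binomial polynomials of degree at most `m`. -/
def binomSpan (s : Finset ι) (t : X → ι → ℝ) (m : ℕ) : Submodule ℝ (X → ℝ) :=
  Submodule.span ℝ {f | ∃ k ≤ m, ∃ α ∈ s.finsuppAntidiag k, f = fun x => binomProd s α (t x)}

theorem binomSpan_mono {m n : ℕ} (h : m ≤ n) : binomSpan s t m ≤ binomSpan s t n :=
  Submodule.span_mono fun _ ⟨k, hk, hα⟩ => ⟨k, hk.trans h, hα⟩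

theorem one_mem_binomSpan : (fun _ => 1) ∈ binomSpan s t 0 :=
  Submodule.subset_span ⟨0, le_rfl, 0, by simp, by simp [binomProd, binomFun_zero]⟩

theorem coord_mul_mem_binomSpan {i : ι} (hi : i ∈ s) {m : ℕ} {f : X → ℝ}
    (hf : f ∈ binomSpan s t m) : (fun x => t x i * f x) ∈ binomSpan s t (m + 1) := by
  induction hf using Submodule.span_induction with
  | mem f hf =>
    obtain ⟨k, hk, α, hα, rfl⟩ := hf
    have : (fun x => t x i * binomProd s α (t x)) =
        ((α i : ℝ) + 1) • (fun x => binomProd s (α + Finsupp.single i 1) (t x)) +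
          (α i : ℝ) • fun x => binomProd s α (t x) := by
      ext x
      simp only [Pi.add_apply, Pi.smul_apply, smul_eq_mul]
      rw [← sub_mul_binomProd hi]; ring
    rw [this]
    exact add_mem
      (Submodule.smul_mem _ _ (Submodule.subset_span
        ⟨k + 1, by omega, _, add_single_mem_finsuppAntidiag hi hα, rfl⟩))
      (Submodule.smul_mem _ _ (Submodule.subset_span ⟨k, by omega, _, hα, rfl⟩))
  | zero =>
    simp only [Pi.zero_apply, mul_zero]
    exact (binomSpan s t (m + 1)).zero_mem
  | add f g _ _ hf hg =>
    simp only [Pi.add_apply, mul_add]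
    exact add_mem hf hg
  | smul c f _ hf =>
    have := Submodule.smul_mem _ c hf
    convert this using 1
    ext x; simp; ring

/-- For an index of sum m < ℓ the factors `t i - α i` sum to ℓ - m ≠ 0, so summing the recursion
over `i` expresses the product through indices of sum m + 1. Descending induction ends at ℓ. -/
theorem binomProd_mem_span_of_le (ht : ∀ x, ∑ i ∈ s, t x i = ℓ) {m : ℕ} (hm : m ≤ ℓ) :
    ∀ α ∈ s.finsuppAntidiag m, (fun x => binomProd s α (t x)) ∈
      Submodule.span ℝ {f | ∃ α ∈ s.finsuppAntidiag ℓ, f = fun x => binomProd s α (t x)} := by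
  induction hm using Nat.decreasingInduction with
  | self => exact fun α hα => Submodule.subset_span ⟨α, hα, rfl⟩
  | of_succ m hm ih =>
    intro α hα
    have hne : (ℓ : ℝ) - m ≠ 0 := sub_ne_zero.2 (by exact_mod_cast hm.ne')
    have : (fun x => binomProd s α (t x)) = ((ℓ : ℝ) - m)⁻¹ • ∑ i ∈ s, ((α i : ℝ) + 1) •
        fun x => binomProd s (α + Finsupp.single i 1) (t x) := by
      ext x
      simp only [Pi.smul_apply, Finset.sum_apply, smul_eq_mul]
      rw [eq_inv_mul_iff_mul_eq₀ hne,
        ← Finset.sum_congr rfl fun i hi => sub_mul_binomProd hi α (t x),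
        ← Finset.sum_mul, Finset.sum_sub_distrib, ht, ← Nat.cast_sum,
        (Finset.mem_finsuppAntidiag.1 hα).1]
    rw [this]
    exact Submodule.smul_mem _ _ (Submodule.sum_mem _ fun i hi =>
      Submodule.smul_mem _ _ (ih _ (add_single_mem_finsuppAntidiag hi hα)))

theorem binomSpan_le (ht : ∀ x, ∑ i ∈ s, t x i = ℓ) : binomSpan s t ℓ ≤
    Submodule.span ℝ {f | ∃ α ∈ s.finsuppAntidiag ℓ, f = fun x => binomProd s α (t x)} := by
  refine Submodule.span_le.2 ?_
  rintro f ⟨k, hk, α, hα, rfl⟩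
  exact binomProd_mem_span_of_le ht hk α hα

/-- Two different indices with equal sums satisfy β i < α i for some i, and there the binomial
factor vanishes. -/
theorem binomProd_lattice {α β : ι →₀ ℕ} (hα : α ∈ s.finsuppAntidiag ℓ)
    (hβ : β ∈ s.finsuppAntidiag ℓ) : binomProd s α (fun i => β i) = if α = β then 1 else 0 := by
  rw [Finset.mem_finsuppAntidiag] at hα hβ
  split_ifs with h
  · subst h
    exact Finset.prod_eq_one fun i _ => binomFun_self _
  · obtain ⟨i, hi, hlt⟩ : ∃ i ∈ s, β i < α i := by
      by_contra! hle
      refine h ?_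
      have := (Finset.sum_eq_sum_iff_of_le hle).1 (hα.1.trans hβ.1.symm)
      ext i
      by_cases hi : i ∈ s
      · exact this i hi
      · rw [Finsupp.notMem_support_iff.1 fun h => hi (hα.2 h),
          Finsupp.notMem_support_iff.1 fun h => hi (hβ.2 h)]
    exact Finset.prod_eq_zero hi (binomFun_of_lt hlt)

/-- Lagrange interpolation formula for functions in the span of the binomial products. -/
theorem eq_sum_binomProd (ht : ∀ x, ∑ i ∈ s, t x i = ℓ) {z : (ι →₀ ℕ) → X}
    (hz : ∀ α ∈ s.finsuppAntidiag ℓ, ∀ i ∈ s, t (z α) i = α i) {f : X → ℝ}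
    (hf : f ∈ binomSpan s t ℓ) (x : X) :
    f x = ∑ α ∈ s.finsuppAntidiag ℓ, f (z α) * binomProd s α (t x) := by
  replace hf := binomSpan_le ht hf
  induction hf using Submodule.span_induction with
  | mem f hf =>
    obtain ⟨β, hβ, rfl⟩ := hf
    rw [Finset.sum_eq_single_of_mem β hβ]
    · have : binomProd s β (t (z β)) = 1 := by
        rw [← if_pos (c := β = β) (t := (1 : ℝ)) (e := 0) rfl, ← binomProd_lattice hβ hβ]
        exact Finset.prod_congr rfl fun i hi => by rw [hz β hβ i hi]
      simp only [this, one_mul]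
    · intro α hα hne
      have : binomProd s β (t (z α)) = 0 := by
        rw [← if_neg (c := β = α) (t := (1 : ℝ)) (e := 0) hne.symm, ← binomProd_lattice hβ hα]
        exact Finset.prod_congr rfl fun i hi => by rw [hz α hα i hi]
      simp only [this, zero_mul]
  | zero => simp
  | add f g _ _ hf hg => simp only [Pi.add_apply, add_mul, Finset.sum_add_distrib, ← hf, ← hg]
  | smul c f _ hf => simp only [Pi.smul_apply, smul_eq_mul, mul_assoc, ← Finset.mul_sum, ← hf]

end Lattice

/-! ### Gradients of polynomial functions. -/

section PolynomialDerivatives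

variable {d : ℕ}

theorem MvPolynomial.totalDegree_pderiv_le {σ R : Type*} [CommSemiring R] (i : σ)
    (p : MvPolynomial σ R) : (MvPolynomial.pderiv i p).totalDegree ≤ p.totalDegree := by
  classical
  conv_lhs => rw [p.as_sum, map_sum]
  refine MvPolynomial.totalDegree_finsetSum_le fun m hm => ?_
  rw [MvPolynomial.pderiv_monomial]
  refine (MvPolynomial.totalDegree_monomial_le _ _).trans ?_
  refine le_trans ?_ (MvPolynomial.le_totalDegree hm)
  have h : m - Finsupp.single i 1 ≤ m := tsub_le_self
  exact Finsupp.degree_mono h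

theorem hasFDerivAt_eval (p : MvPolynomial (Fin d) ℝ) (x : Euc d) :
    HasFDerivAt (fun x : Euc d => MvPolynomial.eval (fun i => x i) p)
      (∑ i, MvPolynomial.eval (fun i => x i) (MvPolynomial.pderiv i p) •
        (EuclideanSpace.proj i : Euc d →L[ℝ] ℝ)) x := by
  induction p using MvPolynomial.induction_on with
  | C a => simpa using hasFDerivAt_const a x
  | add p q hp hq =>
    simp only [map_add, add_smul, Finset.sum_add_distrib]
    exact hp.add hq
  | mul_X p j hp =>
    have hj : HasFDerivAt (fun x : Euc d => x j) (EuclideanSpace.proj j : Euc d →L[ℝ] ℝ) x :=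
      (EuclideanSpace.proj j : Euc d →L[ℝ] ℝ).hasFDerivAt
    simp only [map_mul, MvPolynomial.eval_X]
    convert! hp.mul hj using 1
    simp only [Derivation.leibniz, MvPolynomial.pderiv_X, smul_eq_mul, map_add, map_mul,
      MvPolynomial.eval_X, add_smul, Finset.sum_add_distrib, Finset.smul_sum, smul_smul]
    congr 1
    rw [Finset.sum_eq_single j]
    · simp
    · intro i _ hij
      simp [hij.symm]
    · simp

namespace IsPolyFun

variable {k : ℕ} {f : Euc d → ℝ}

theorem hasGradientAt_apply (hf : IsPolyFun k f) :
    ∃ G : Fin d → Euc d → ℝ, (∀ i, IsPolyFun k (G i)) ∧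
      ∀ x, HasGradientAt f (WithLp.toLp 2 fun i => G i x) x := by
  obtain ⟨p, hp, hfp⟩ := hf
  refine ⟨fun i x => MvPolynomial.eval (fun j => x j) (MvPolynomial.pderiv i p), fun i =>
    ⟨_, (MvPolynomial.totalDegree_pderiv_le i p).trans hp, fun _ => rfl⟩, fun x => ?_⟩
  rw [hasGradientAt_iff_hasFDerivAt, show f = _ from funext hfp]
  convert! hasFDerivAt_eval p x using 1
  ext y
  simp [PiLp.inner_apply, mul_comm]

theorem differentiable (hf : IsPolyFun k f) : Differentiable ℝ f := fun x => by
  obtain ⟨G, -, h⟩ := hf.hasGradientAt_apply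
  exact (h x).differentiableAt

theorem gradient_apply (hf : IsPolyFun k f) (i : Fin d) : IsPolyFun k fun x => gradient f x i := by
  obtain ⟨G, hG, h⟩ := hf.hasGradientAt_apply
  convert hG i using 2 with x
  rw [(h x).gradient]

theorem continuous (hf : IsPolyFun k f) : Continuous f := hf.differentiable.continuous

theorem continuous_gradient (hf : IsPolyFun k f) : Continuous (gradient f) := by
  refine (PiLp.continuous_toLp 2 _).comp (continuous_pi fun i => (hf.gradient_apply i).continuous)
    |>.congr fun x => ?_
  rfl

theorem hasGradientAt (hf : IsPolyFun k f) (x : Euc d) : HasGradientAt f (gradient f x) x :=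
  (hf.differentiable x).hasGradientAt

end IsPolyFun

end PolynomialDerivatives

/-! ### Lagrange basis of a simplex, inverse estimates and a Poincaré inequality for polynomials. -/

section SimplexLagrange

variable {d ℓ : ℕ} {K : Finset (Euc d)} {α : Euc d →₀ ℕ}

/-- The Lagrange node with barycentric coordinates `α / ℓ`. -/
noncomputable def latticePoint (ℓ : ℕ) (α : Euc d →₀ ℕ) : Euc d :=
  ∑ v ∈ α.support, ((α v : ℝ) / ℓ) • v

/-- The Lagrange basis polynomial on `K` belonging to the node `latticePoint ℓ α`
(it vanishes on `K` if `α` is not supported on the vertices of `K`). -/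
noncomputable def lagrangeFun (ℓ : ℕ) (K : Finset (Euc d)) (α : Euc d →₀ ℕ) (x : Euc d) : ℝ :=
  binomProd α.support α fun v => ℓ * bary K v x

open Classical in
/-- The indices of the Lagrange nodes of degree `ℓ` of a simplex. -/
noncomputable def latticeIndices (ℓ : ℕ) (K : Finset (Euc d)) : Finset (Euc d →₀ ℕ) :=
  K.finsuppAntidiag ℓ

theorem mem_latticeIndices : α ∈ latticeIndices ℓ K ↔ ∑ v ∈ K, α v = ℓ ∧ α.support ⊆ K := by
  classical
  rw [latticeIndices, Finset.mem_finsuppAntidiag]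

theorem latticePoint_eq (h : α.support ⊆ K) :
    latticePoint ℓ α = ∑ v ∈ K, ((α v : ℝ) / ℓ) • v :=
  Finset.sum_subset h fun v _ hv => by simp [Finsupp.notMem_support_iff.1 hv]

/-- Multiplying over the support of `α` only makes the basis function depend on nothing but the
vertices that define its node, which is what makes it match across elements; the other vertices
contribute the factor one. -/
theorem lagrangeFun_eq (h : α.support ⊆ K) (x : Euc d) :
    lagrangeFun ℓ K α x = binomProd K α fun v => ℓ * bary K v x :=
  Finset.prod_subset h fun v _ hv => by rw [Finsupp.notMem_support_iff.1 hv, binomFun_zero]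

/-- A vertex of the support outside `K` has coordinate zero by convention, and the binomial
polynomial of positive degree vanishes at zero. -/
theorem lagrangeFun_eq_zero (h : ¬ α.support ⊆ K) (x : Euc d) : lagrangeFun ℓ K α x = 0 := by
  obtain ⟨v, hv, hvK⟩ := Finset.not_subset.1 h
  refine Finset.prod_eq_zero hv ?_
  change binomFun (α v) (ℓ * bary K v x) = 0
  rw [IsSimplex.bary_of_notMem hvK]
  simpa using binomFun_of_lt (Nat.pos_of_ne_zero (Finsupp.mem_support_iff.1 hv))

/-- The number of Lagrange nodes of a simplex. -/
def latticeCard (d ℓ : ℕ) : ℕ := (d + 1).multichoose ℓ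

namespace IsSimplex

theorem card_latticeIndices (hK : IsSimplex K) :
    (latticeIndices ℓ K).card = latticeCard d ℓ := by
  classical
  rw [latticeIndices, Finset.card_finsuppAntidiag_nat_eq_multichoose, hK.card_eq, latticeCard]

theorem sum_lattice_weights (hℓ : 1 ≤ ℓ) (hα : α ∈ latticeIndices ℓ K) :
    ∑ v ∈ K, (α v : ℝ) / ℓ = 1 := by
  rw [← Finset.sum_div, ← Nat.cast_sum, (mem_latticeIndices.1 hα).1, div_self]
  exact_mod_cast (by omega : ℓ ≠ 0)

theorem bary_latticePoint (hK : IsSimplex K) (hℓ : 1 ≤ ℓ) (hα : α ∈ latticeIndices ℓ K)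
    {v : Euc d} (hv : v ∈ K) : bary K v (latticePoint ℓ α) = α v / ℓ := by
  classical
  rw [latticePoint_eq (mem_latticeIndices.1 hα).2,
    hK.bary_combination subset_rfl (sum_lattice_weights hℓ hα), if_pos hv]

theorem latticePoint_mem (hℓ : 1 ≤ ℓ) (hα : α ∈ latticeIndices ℓ K) :
    latticePoint ℓ α ∈ simplexHull K := by
  rw [latticePoint_eq (mem_latticeIndices.1 hα).2]
  exact (convex_simplexHull K).sum_mem (fun v _ => by positivity) (sum_lattice_weights hℓ hα)
    fun v hv => subset_convexHull ℝ _ hv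

theorem sum_scaled_bary (hK : IsSimplex K) (x : Euc d) : ∑ v ∈ K, (ℓ : ℝ) * bary K v x = ℓ := by
  rw [← Finset.mul_sum, hK.sum_bary, mul_one]

/-- Polynomial functions are in the span of the Lagrange polynomials. -/
theorem mem_binomSpan [DecidableEq (Euc d)] (hK : IsSimplex K) (hℓ : 1 ≤ ℓ) {p : Euc d → ℝ}
    (hp : IsPolyFun ℓ p) :
    p ∈ binomSpan K (fun (x : Euc d) (v : Euc d) => (ℓ : ℝ) * bary K v x) ℓ := by
  have hℓ0 : (ℓ : ℝ) ≠ 0 := by exact_mod_cast (by omega : ℓ ≠ 0)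
  set t := fun (x : Euc d) (v : Euc d) => (ℓ : ℝ) * bary K v x with ht
  have hmul : ∀ (i : Fin d) (m : ℕ) (f : Euc d → ℝ), f ∈ binomSpan K t m →
      (fun x => x i * f x) ∈ binomSpan K t (m + 1) := by
    intro i m f hf
    have : (fun x => x i * f x) = ∑ v ∈ K, ((ℓ : ℝ)⁻¹ * v i) • fun x => t x v * f x := by
      ext x
      simp only [Finset.sum_apply, Pi.smul_apply, smul_eq_mul, ht]
      have hx : x i = ∑ v ∈ K, bary K v x * v i := by
        have := congrArg (fun z : Euc d => z i) (hK.sum_bary_smul x)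
        simpa using this.symm
      rw [hx, Finset.sum_mul]
      refine Finset.sum_congr rfl fun v _ => ?_
      field_simp
    rw [this]
    exact Submodule.sum_mem _ fun v hv => Submodule.smul_mem _ _ (coord_mul_mem_binomSpan hv hf)
  have hpow : ∀ (i : Fin d) (n m : ℕ) (f : Euc d → ℝ), f ∈ binomSpan K t m →
      (fun x => x i ^ n * f x) ∈ binomSpan K t (m + n) := by
    intro i n
    induction n with
    | zero => intro m f hf; simpa using hf
    | succ n ih =>
      intro m f hf
      have := hmul i _ _ (ih m f hf)
      simpa only [pow_succ', mul_assoc, ← add_assoc] using this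
  have hmon : ∀ (s : Finset (Fin d)) (e : Fin d →₀ ℕ),
      (fun x : Euc d => ∏ i ∈ s, x i ^ e i) ∈ binomSpan K t (∑ i ∈ s, e i) := by
    intro s e
    induction s using Finset.induction_on with
    | empty => simpa using one_mem_binomSpan
    | insert i s hi ih =>
      simp only [Finset.prod_insert hi, Finset.sum_insert hi]
      rw [add_comm]
      exact hpow i _ _ _ ih
  obtain ⟨q, hq, hpq⟩ := hp
  have : p = ∑ e ∈ q.support, q.coeff e • fun x : Euc d => ∏ i ∈ e.support, x i ^ e i := by
    ext x
    rw [hpq, MvPolynomial.eval_eq]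
    simp only [Finset.sum_apply, Pi.smul_apply, smul_eq_mul]
  rw [this]
  refine Submodule.sum_mem _ fun e he => Submodule.smul_mem _ _ ?_
  exact binomSpan_mono ((MvPolynomial.le_totalDegree he).trans hq) (hmon e.support e)

/-- Lagrange interpolation on a simplex reproduces polynomials. -/
theorem eq_sum_lagrangeFun (hK : IsSimplex K) (hℓ : 1 ≤ ℓ) {p : Euc d → ℝ} (hp : IsPolyFun ℓ p)
    (x : Euc d) : p x = ∑ α ∈ latticeIndices ℓ K, p (latticePoint ℓ α) * lagrangeFun ℓ K α x := by
  classical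
  have hℓ0 : (ℓ : ℝ) ≠ 0 := by exact_mod_cast (by omega : ℓ ≠ 0)
  rw [eq_sum_binomProd (z := latticePoint ℓ) (fun x => hK.sum_scaled_bary x) (fun α hα v hv => ?_)
    (hK.mem_binomSpan hℓ hp) x]
  · rw [latticeIndices]
    refine Finset.sum_congr rfl fun α hα => ?_
    rw [lagrangeFun_eq (Finset.mem_finsuppAntidiag.1 hα).2]
  · rw [hK.bary_latticePoint hℓ (by rw [latticeIndices]; exact hα) hv]
    field_simp

theorem isPolyFun_lagrangeFun (hα : α ∈ latticeIndices ℓ K) :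
    IsPolyFun ℓ (lagrangeFun ℓ K α) := by
  have h : ∀ v, IsPolyFun (α v) fun x => binomFun (α v) (ℓ * bary K v x) := by
    intro v
    have := IsPolyFun.prod (s := Finset.range (α v)) (k := fun _ => 1)
      (f := fun j x => ((ℓ : ℝ) * bary K v x - j) / (j + 1)) fun j _ => by
        have := (((IsPolyFun.affine (bary K v)).const_mul ℓ).sub (.const j)).const_mul
          (((j : ℝ) + 1)⁻¹)
        simpa only [div_eq_inv_mul] using this
    simpa [binomFun] using this
  have h2 := IsPolyFun.prod (s := K) (k := α) fun v _ => h v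
  rw [(mem_latticeIndices.1 hα).1] at h2
  rwa [show lagrangeFun ℓ K α = _ from funext (lagrangeFun_eq (mem_latticeIndices.1 hα).2)]

/-- A bound for the Lagrange polynomials of degree `ℓ`. -/
noncomputable def lagrangeBound (d ℓ : ℕ) : ℝ := ((ℓ : ℝ) ^ ℓ) ^ (d + 1)

/-- A bound for the Lipschitz constants of the Lagrange polynomials of degree `ℓ` as functions of
the barycentric coordinates. -/
noncomputable def lagrangeLip (d ℓ : ℕ) : ℝ :=
  ((ℓ : ℝ) ^ ℓ) ^ (d + 1) * (((d + 1 : ℕ) : ℝ) * ((ℓ : ℝ) ^ ℓ * (ℓ * ℓ)))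

variable {x y : Euc d}

theorem le_of_mem_latticeIndices (hα : α ∈ latticeIndices ℓ K) {v : Euc d} (hv : v ∈ K) :
    α v ≤ ℓ := by
  rw [← (mem_latticeIndices.1 hα).1]
  exact Finset.single_le_sum (fun _ _ => Nat.zero_le _) hv

theorem scaled_bary_nonneg (hK : IsSimplex K) (hx : x ∈ simplexHull K) (v : Euc d) :
    0 ≤ (ℓ : ℝ) * bary K v x := mul_nonneg (by positivity) (hK.bary_nonneg hx v)

theorem scaled_bary_le (hK : IsSimplex K) (hx : x ∈ simplexHull K) (v : Euc d) :
    (ℓ : ℝ) * bary K v x ≤ ℓ := mul_le_of_le_one_right (by positivity) (hK.bary_le_one hx v)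

theorem abs_lagrangeFun_le (hK : IsSimplex K) (hℓ : 1 ≤ ℓ) (hα : α ∈ latticeIndices ℓ K)
    (hx : x ∈ simplexHull K) : |lagrangeFun ℓ K α x| ≤ lagrangeBound d ℓ := by
  rw [lagrangeFun_eq (mem_latticeIndices.1 hα).2, lagrangeBound, ← hK.card_eq]
  exact abs_prod_le_pow fun v hv => abs_binomFun_le hℓ (le_of_mem_latticeIndices hα hv)
    (hK.scaled_bary_nonneg hx v) (hK.scaled_bary_le hx v)

theorem abs_lagrangeFun_sub_le (hK : IsSimplex K) (hℓ : 1 ≤ ℓ) (hα : α ∈ latticeIndices ℓ K)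
    (hx : x ∈ simplexHull K) (hy : y ∈ simplexHull K) {δ : ℝ}
    (hδ : ∀ v, |bary K v x - bary K v y| ≤ δ) :
    |lagrangeFun ℓ K α x - lagrangeFun ℓ K α y| ≤ lagrangeLip d ℓ * δ := by
  have hs := (mem_latticeIndices.1 hα).2
  rw [lagrangeFun_eq hs, lagrangeFun_eq hs]
  refine (abs_prod_sub_prod_le (M := (ℓ : ℝ) ^ ℓ) (δ := (ℓ : ℝ) ^ ℓ * (ℓ * (ℓ * δ)))
    (one_le_pow₀ (by exact_mod_cast hℓ))
    (fun v hv => abs_binomFun_le hℓ (le_of_mem_latticeIndices hα hv)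
      (hK.scaled_bary_nonneg hx v) (hK.scaled_bary_le hx v))
    (fun v hv => abs_binomFun_le hℓ (le_of_mem_latticeIndices hα hv)
      (hK.scaled_bary_nonneg hy v) (hK.scaled_bary_le hy v)) fun v hv => ?_).trans_eq ?_
  · refine (abs_binomFun_sub_le hℓ (le_of_mem_latticeIndices hα hv)
      (hK.scaled_bary_nonneg hx v) (hK.scaled_bary_le hx v)
      (hK.scaled_bary_nonneg hy v) (hK.scaled_bary_le hy v)).trans ?_
    rw [← mul_sub, abs_mul, abs_of_nonneg (show (0 : ℝ) ≤ ℓ by positivity)]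
    gcongr
    exact hδ v
  · rw [hK.card_eq, lagrangeLip]; ring

/-- A bound for the Lipschitz constants of polynomials of degree `ℓ` that are bounded by `1`, as
functions of the barycentric coordinates. -/
noncomputable def polyLip (d ℓ : ℕ) : ℝ := latticeCard d ℓ * lagrangeLip d ℓ

theorem polyLip_nonneg (d ℓ : ℕ) : 0 ≤ polyLip d ℓ := by
  unfold polyLip lagrangeLip; positivity

/-- Measuring distances in barycentric coordinates makes the Lipschitz constant independent of the
shape of `K`. It comes from the Lagrange expansion, whose coefficients are values of `p` on the
simplex and hence bounded by `M`. -/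
theorem abs_poly_sub_le (hK : IsSimplex K) (hℓ : 1 ≤ ℓ) {p : Euc d → ℝ} (hp : IsPolyFun ℓ p)
    {M : ℝ} (hM : ∀ x ∈ simplexHull K, |p x| ≤ M)
    (hx : x ∈ simplexHull K) (hy : y ∈ simplexHull K) {δ : ℝ}
    (hδ : ∀ v, |bary K v x - bary K v y| ≤ δ) : |p x - p y| ≤ polyLip d ℓ * M * δ := by
  rw [hK.eq_sum_lagrangeFun hℓ hp x, hK.eq_sum_lagrangeFun hℓ hp y, ← Finset.sum_sub_distrib]
  refine (Finset.abs_sum_le_sum_abs _ _).trans ?_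
  have hM0 : 0 ≤ M := (abs_nonneg _).trans (hM x hx)
  refine (Finset.sum_le_card_nsmul _ _ (M * (lagrangeLip d ℓ * δ)) fun α hα => ?_).trans_eq ?_
  · rw [← mul_sub, abs_mul]
    gcongr
    · exact hM _ (latticePoint_mem hℓ hα)
    · exact hK.abs_lagrangeFun_sub_le hℓ hα hx hy hδ
  · rw [hK.card_latticeIndices, polyLip, nsmul_eq_mul]; ring

/-- The constant in the inverse estimate between the maximum norm and the `L²`-norm. -/
noncomputable def invConst (d ℓ : ℕ) : ℝ := 4 * (2 * (polyLip d ℓ + 1)) ^ d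

theorem invConst_pos (d ℓ : ℕ) : 0 < invConst d ℓ := by
  have := polyLip_nonneg d ℓ
  unfold invConst; positivity

/-- Polynomials on a simplex are bounded by their scaled `L²`-norm, with a constant not depending
on the shape of the simplex. -/
theorem sq_poly_le (hK : IsSimplex K) (hℓ : 1 ≤ ℓ) {p : Euc d → ℝ} (hp : IsPolyFun ℓ p)
    (hx : x ∈ simplexHull K) :
    p x ^ 2 ≤ invConst d ℓ / simplexVol K * ∫ y in simplexHull K, p y ^ 2 := by
  obtain ⟨z, hz, hmax⟩ := (isCompact_simplexHull K).exists_isMaxOn ⟨x, hx⟩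
    hp.continuous.abs.continuousOn
  have hmax : ∀ y ∈ simplexHull K, |p y| ≤ |p z| := hmax
  have hL := polyLip_nonneg d ℓ
  -- Contracting the simplex towards the maximum point `z` by the factor `t` moves every barycentric
  -- coordinate by at most `t`, and `t` is chosen so that `p` then changes by at most half of its
  -- maximum. So |p| ≥ |p z| / 2 on a copy of the simplex with the fraction t^d of its volume, which
  -- gives the constant 4 t^(-d).
  set t : ℝ := (2 * (polyLip d ℓ + 1))⁻¹ with ht
  have ht0 : 0 < t := by positivity
  have ht1 : t ≤ 1 := inv_le_one_of_one_le₀ (by linarith)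
  have htL : polyLip d ℓ * t ≤ 1 / 2 := by
    rw [ht, ← div_eq_mul_inv, div_le_iff₀ (by positivity)]; linarith
  set S := AffineMap.homothety z t '' simplexHull K with hS
  have hSK : S ⊆ simplexHull K := by
    rintro _ ⟨y, hy, rfl⟩
    rw [AffineMap.homothety_eq_lineMap]
    exact (convex_simplexHull K).lineMap_mem hz hy ⟨ht0.le, ht1⟩
  have hlow : ∀ y ∈ S, p z ^ 2 / 4 ≤ p y ^ 2 := by
    rintro _ ⟨y, hy, rfl⟩
    have hmem := hSK ⟨y, hy, rfl⟩
    have hb : ∀ v, |bary K v (AffineMap.homothety z t y) - bary K v z| ≤ t := by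
      intro v
      rw [AffineMap.homothety_eq_lineMap, AffineMap.apply_lineMap, AffineMap.lineMap_apply_module,
        smul_eq_mul, smul_eq_mul, show (1 - t) * bary K v z + t * bary K v y - bary K v z =
          t * (bary K v y - bary K v z) by ring, abs_mul, abs_of_pos ht0]
      refine mul_le_of_le_one_right ht0.le (abs_le.2 ⟨?_, ?_⟩) <;>
      linarith [hK.bary_nonneg hy v, hK.bary_nonneg hz v, hK.bary_le_one hy v, hK.bary_le_one hz v]
    have h1 := hK.abs_poly_sub_le hℓ hp hmax hmem hz hb
    have h2 : polyLip d ℓ * |p z| * t ≤ |p z| / 2 := by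
      nlinarith [abs_nonneg (p z)]
    have h3 : |p z| / 2 ≤ |p (AffineMap.homothety z t y)| := by
      have := abs_sub_abs_le_abs_sub (p z) (p (AffineMap.homothety z t y))
      rw [abs_sub_comm] at this
      linarith
    have := mul_self_le_mul_self (by positivity) h3
    rw [← sq, ← sq, sq_abs, div_pow, sq_abs] at this
    linarith
  have hint : IntegrableOn (fun y => p y ^ 2) (simplexHull K) :=
    (hp.continuous.pow 2).continuousOn.integrableOn_compact (isCompact_simplexHull K)
  have hvol : volume.real S = t ^ d * simplexVol K := by
    rw [hS, measureReal_def, Measure.addHaar_image_homothety, ENNReal.toReal_mul,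
      finrank_euclideanSpace_fin, ENNReal.toReal_ofReal (abs_nonneg _),
      abs_of_pos (by positivity)]
    rfl
  have hSm : MeasurableSet S :=
    ((isCompact_simplexHull K).image (AffineMap.homothety_continuous z t)).measurableSet
  have hfin : volume S ≠ ⊤ := ((measure_mono hSK).trans_lt (volume_simplexHull_lt_top K)).ne
  have h1 : p z ^ 2 / 4 * (t ^ d * simplexVol K) ≤ ∫ y in simplexHull K, p y ^ 2 := by
    calc p z ^ 2 / 4 * (t ^ d * simplexVol K) = ∫ _y in S, p z ^ 2 / 4 := by
          rw [setIntegral_const, hvol, smul_eq_mul, mul_comm]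
      _ ≤ ∫ y in S, p y ^ 2 := by
          refine setIntegral_mono_on ?_ (hint.mono_set hSK) hSm hlow
          exact integrableOn_const hfin
      _ ≤ ∫ y in simplexHull K, p y ^ 2 :=
          setIntegral_mono_set hint (.of_forall fun y => sq_nonneg _) (.of_forall hSK)
  have h2 : p x ^ 2 ≤ p z ^ 2 := sq_le_sq.2 (hmax x hx)
  refine h2.trans ?_
  have hv := hK.simplexVol_pos
  rw [div_mul_eq_mul_div, le_div_iff₀ hv, invConst]
  have ht' : 2 * (polyLip d ℓ + 1) = t⁻¹ := by rw [ht, inv_inv]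
  rw [ht', inv_pow]
  have htd : 0 < t ^ d := by positivity
  calc p z ^ 2 * simplexVol K = 4 * (t ^ d)⁻¹ * (p z ^ 2 / 4 * (t ^ d * simplexVol K)) := by
        field_simp
    _ ≤ _ := by gcongr

theorem norm_gradient (p : Euc d → ℝ) (x : Euc d) : ‖gradient p x‖ = ‖fderiv ℝ p x‖ := by
  rw [gradient, LinearIsometryEquiv.norm_map]

/-- Markov inequality on a simplex. -/
theorem norm_gradient_poly_le (hK : IsSimplex K) (hd : 1 ≤ d) (hℓ : 1 ≤ ℓ) {p : Euc d → ℝ}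
    (hp : IsPolyFun ℓ p) {M : ℝ} (hM : ∀ x ∈ simplexHull K, |p x| ≤ M) (hx : x ∈ simplexHull K) :
    ‖gradient p x‖ ≤ polyLip d ℓ * M / inscribedDiam K := by
  have hM0 : 0 ≤ M := (abs_nonneg _).trans (hM x hx)
  have hρ := hK.inscribedDiam_pos hd
  have hL := polyLip_nonneg d ℓ
  have hC : 0 ≤ polyLip d ℓ * M / inscribedDiam K := by positivity
  have hlip : LipschitzOnWith ⟨_, hC⟩ p (simplexHull K) := by
    refine LipschitzOnWith.of_dist_le_mul fun a ha b hb => ?_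
    rw [Real.dist_eq]
    refine (hK.abs_poly_sub_le hℓ hp hM ha hb fun v => hK.abs_bary_sub_le hd v a b).trans_eq ?_
    change _ = polyLip d ℓ * M / inscribedDiam K * dist a b
    ring
  have hint : ∀ y ∈ interior (simplexHull K), ‖gradient p y‖ ≤ polyLip d ℓ * M / inscribedDiam K :=
    fun y hy => by
      rw [norm_gradient]
      exact (hp.differentiable y).hasFDerivAt.le_of_lipschitzOn (mem_interior_iff_mem_nhds.1 hy)
        hlip
  -- The Lipschitz bound controls the gradient at interior points only; continuity extends it to the
  -- boundary.
  rw [← hK.closure_interior] at hx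
  exact closure_minimal (t := {y | ‖gradient p y‖ ≤ polyLip d ℓ * M / inscribedDiam K}) hint
    (isClosed_le hp.continuous_gradient.norm continuous_const) hx

theorem norm_gradient_lagrangeFun_le (hK : IsSimplex K) (hd : 1 ≤ d) (hℓ : 1 ≤ ℓ)
    (hα : α ∈ latticeIndices ℓ K) (hx : x ∈ simplexHull K) :
    ‖gradient (lagrangeFun ℓ K α) x‖ ≤
      polyLip d ℓ * lagrangeBound d ℓ / inscribedDiam K :=
  hK.norm_gradient_poly_le hd hℓ (isPolyFun_lagrangeFun hα)
    (fun _ hx => hK.abs_lagrangeFun_le hℓ hα hx) hx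

theorem sq_norm_gradient_poly_le (hK : IsSimplex K) (hℓ : 1 ≤ ℓ) {p : Euc d → ℝ}
    (hp : IsPolyFun ℓ p) (hx : x ∈ simplexHull K) :
    ‖gradient p x‖ ^ 2 ≤ invConst d ℓ / simplexVol K * ∫ y in simplexHull K, ‖gradient p y‖ ^ 2 := by
  simp only [EuclideanSpace.real_norm_sq_eq]
  rw [integral_finsetSum]
  · rw [Finset.mul_sum]
    exact Finset.sum_le_sum fun i _ => hK.sq_poly_le hℓ (hp.gradient_apply i) hx
  · exact fun i _ => ((hp.gradient_apply i).continuous.pow 2).continuousOn.integrableOn_compact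
      (isCompact_simplexHull K)

/-- A polynomial is bounded by its gradient if a weighted mean of it vanishes. -/
theorem sq_poly_le_gradient (hK : IsSimplex K) (hℓ : 1 ≤ ℓ) {p η : Euc d → ℝ} (hp : IsPolyFun ℓ p)
    (hη : ∀ y ∈ simplexHull K, 0 ≤ η y) (hηi : IntegrableOn η (simplexHull K))
    (hη1 : ∫ y in simplexHull K, η y = 1) (h0 : ∫ y in simplexHull K, η y * p y = 0)
    (hx : x ∈ simplexHull K) :
    p x ^ 2 ≤ simplexDiam K ^ 2 * (invConst d ℓ / simplexVol K) *
      ∫ y in simplexHull K, ‖gradient p y‖ ^ 2 := by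
  set G := invConst d ℓ / simplexVol K * ∫ y in simplexHull K, ‖gradient p y‖ ^ 2 with hG
  have hv := hK.simplexVol_pos
  have hI : 0 ≤ G := (sq_nonneg _).trans (hK.sq_norm_gradient_poly_le hℓ hp hx)
  have hh : 0 ≤ simplexDiam K := Metric.diam_nonneg
  set B := simplexDiam K * Real.sqrt G with hB
  have hosc : ∀ y ∈ simplexHull K, |p x - p y| ≤ B := by
    intro y hy
    have := (convex_simplexHull K).norm_image_sub_le_of_norm_fderiv_le (C := Real.sqrt G)
      (fun z _ => hp.differentiable z) (fun z hz => ?_) hy hx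
    · rw [Real.norm_eq_abs, ← dist_eq_norm] at this
      refine this.trans ?_
      rw [hB, mul_comm]
      gcongr
      exact dist_le_diam hx hy
    · rw [← norm_gradient]
      exact Real.le_sqrt_of_sq_le (hK.sq_norm_gradient_poly_le hℓ hp hz)
  have hpi : IntegrableOn (fun y => η y * p y) (simplexHull K) :=
    hηi.mul_continuousOn hp.continuous.continuousOn (isCompact_simplexHull K)
  have hpx : IntegrableOn (fun y => η y * p x) (simplexHull K) := Integrable.mul_const hηi (p x)
  -- As η has mass one and the η-mean of `p` vanishes, `p x` is itself a mean of differences, each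
  -- at most the diameter times the maximal gradient.
  have e : p x = ∫ y in simplexHull K, η y * (p x - p y) := by
    simp only [mul_sub]
    rw [integral_sub hpx hpi, h0, integral_mul_const, hη1]; ring
  have hle : |p x| ≤ B := by
    have hn : ‖∫ y in simplexHull K, η y * (p x - p y)‖ ≤ ∫ y in simplexHull K, η y * B := by
      refine norm_integral_le_of_norm_le (Integrable.mul_const hηi B) ?_
      rw [ae_restrict_iff' (measurableSet_simplexHull K)]
      refine .of_forall fun y hy => ?_
      rw [Real.norm_eq_abs, abs_mul, abs_of_nonneg (hη y hy)]
      exact mul_le_mul_of_nonneg_left (hosc y hy) (hη y hy)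
    rwa [integral_mul_const, hη1, one_mul, ← e, Real.norm_eq_abs] at hn
  calc p x ^ 2 ≤ B ^ 2 := sq_le_sq.2 (hle.trans (le_abs_self B))
    _ = simplexDiam K ^ 2 * G := by rw [hB, mul_pow, Real.sq_sqrt hI]
    _ = _ := by rw [hG]; ring

end IsSimplex

end SimplexLagrange

/-! ## Weak gradients of finite element functions -/

section TestFunctions

variable {d : ℕ} {Ω : Set (Euc d)}

theorem integrableOn_test_smul {F : Type*} [NormedAddCommGroup F] [NormedSpace ℝ F]
    {φ : Euc d → ℝ} {g : Euc d → F} (hg : LocallyIntegrableOn g Ω) (hφ : Continuous φ)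
    (hc : HasCompactSupport φ) (hs : tsupport φ ⊆ Ω) : IntegrableOn (fun x => φ x • g x) Ω := by
  refine Integrable.integrableOn ?_
  refine (integrableOn_iff_integrable_of_support_subset (s := tsupport φ) ?_).1
    ((hg.integrableOn_compact_subset hs hc.isCompact).continuousOn_smul hφ.continuousOn
      hc.isCompact)
  exact (Function.support_smul_subset_left φ g).trans (subset_tsupport φ)

theorem integrableOn_smul_test {F : Type*} [NormedAddCommGroup F] [NormedSpace ℝ F]
    {φ : Euc d → F} {u : Euc d → ℝ} (hu : LocallyIntegrableOn u Ω) (hφ : Continuous φ)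
    (hc : HasCompactSupport φ) (hs : tsupport φ ⊆ Ω) : IntegrableOn (fun x => u x • φ x) Ω := by
  refine Integrable.integrableOn ?_
  refine (integrableOn_iff_integrable_of_support_subset (s := tsupport φ) ?_).1
    ((hu.integrableOn_compact_subset hs hc.isCompact).smul_continuousOn hφ.continuousOn
      hc.isCompact)
  exact (Function.support_smul_subset_right u φ).trans (subset_tsupport φ)

theorem continuous_gradient_of_contDiff {φ : Euc d → ℝ} (hφ : ContDiff ℝ ∞ φ) :
    Continuous (gradient φ) :=
  (InnerProductSpace.toDual ℝ (Euc d)).symm.continuous.comp (hφ.continuous_fderiv (by simp))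

theorem tsupport_gradient_subset (φ : Euc d → ℝ) : tsupport (gradient φ) ⊆ tsupport φ := by
  refine (closure_mono fun x hx => ?_).trans (tsupport_fderiv_subset ℝ (f := φ))
  intro h
  apply hx
  rw [gradient, h, map_zero]

end TestFunctions

/-! ### Finite element functions are Lipschitz along segments and weakly differentiable. -/

namespace SimplicialMesh

variable {d ℓ : ℕ} (T : SimplicialMesh d) {K : Finset (Euc d)}

theorem isSimplex (hK : K ∈ T.elements) : IsSimplex K := ⟨T.card_eq K hK, T.affineIndependent K hK⟩

/-- The union of the (closed) elements of a mesh. -/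
def support : Set (Euc d) := ⋃ K ∈ T.elements, simplexHull K

variable {T}

theorem mem_support {x : Euc d} : x ∈ T.support ↔ ∃ K ∈ T.elements, x ∈ simplexHull K := by
  simp [support]

theorem hull_subset_support (hK : K ∈ T.elements) : simplexHull K ⊆ T.support := fun _ hx =>
  mem_support.2 ⟨K, hK, hx⟩

theorem domain_subset_support : T.domain ⊆ T.support := interior_subset

theorem isOpen_domain : IsOpen T.domain := isOpen_interior

theorem interior_hull_subset_domain (hK : K ∈ T.elements) :
    interior (simplexHull K) ⊆ T.domain :=
  interior_mono (hull_subset_support hK)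

theorem isCompact_support : IsCompact T.support :=
  T.elements.isCompact_biUnion fun K _ => IsSimplex.isCompact_simplexHull K

theorem ae_mem_interior : ∀ᵐ x : Euc d, ∀ K ∈ T.elements,
    x ∈ simplexHull K → x ∈ interior (simplexHull K) := by
  rw [Filter.eventually_all_finset]
  intro K _
  filter_upwards [(IsSimplex.ae_interior K).mem_iff] with x hx using hx.2

theorem domain_ae_eq_support : (T.domain : Set (Euc d)) =ᵐ[volume] T.support := by
  filter_upwards [T.ae_mem_interior] with x hx
  refine propext ⟨fun h => domain_subset_support h, fun h => ?_⟩
  obtain ⟨K, hK, hxK⟩ := mem_support.1 h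
  exact interior_hull_subset_domain hK (hx K hK hxK)

theorem hull_ae_le_domain (hK : K ∈ T.elements) :
    (simplexHull K : Set (Euc d)) ≤ᵐ[volume] T.domain := by
  filter_upwards [T.ae_mem_interior] with x hx hxK
  exact interior_hull_subset_domain hK (hx K hK hxK)

theorem volume_domain_lt_top : volume T.domain < ⊤ :=
  (measure_mono domain_subset_support).trans_lt isCompact_support.measure_lt_top

theorem isFiniteMeasure_restrict_domain : IsFiniteMeasure (volume.restrict T.domain) :=
  ⟨by rw [Measure.restrict_apply_univ]; exact volume_domain_lt_top⟩

theorem mem_feSpace_iff {v : Euc d → ℝ} : v ∈ T.feSpace ℓ ↔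
    ∀ K ∈ T.elements, ∃ p, IsPolyFun ℓ p ∧ EqOn v p (simplexHull K) := by
  constructor
  · rintro ⟨-, h⟩ K hK
    obtain ⟨p, hp, hv⟩ := h K hK
    exact ⟨_, ⟨p, hp, fun _ => rfl⟩, hv⟩
  · intro h
    refine ⟨?_, fun K hK => ?_⟩
    · have : ContinuousOn v T.support := by
        have e : T.support = ⋃ K : T.elements, simplexHull (K : Finset (Euc d)) := by
          ext x; simp [mem_support]
        rw [e]
        refine (locallyFinite_of_finite _).continuousOn_iUnion
          (fun K => IsSimplex.isClosed_simplexHull K.1) fun K => ?_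
        obtain ⟨p, hp, hv⟩ := h K.1 K.2
        exact hp.continuous.continuousOn.congr hv
      exact this.mono domain_subset_support
    · obtain ⟨f, ⟨p, hp, hf⟩, hv⟩ := h K hK
      exact ⟨p, hp, fun x hx => (hv hx).trans (hf x)⟩

theorem continuousOn_support {v : Euc d → ℝ} (hv : v ∈ T.feSpace ℓ) :
    ContinuousOn v T.support := by
  have e : T.support = ⋃ K : T.elements, simplexHull (K : Finset (Euc d)) := by
    ext x; simp [mem_support]
  rw [e]
  refine (locallyFinite_of_finite _).continuousOn_iUnion
    (fun K => IsSimplex.isClosed_simplexHull K.1) fun K => ?_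
  obtain ⟨p, hp, hv⟩ := mem_feSpace_iff.1 hv K.1 K.2
  exact hp.continuous.continuousOn.congr hv

/-- On line segments in the support, finite element functions are Lipschitz. -/
theorem exists_lipschitz_segment {v : Euc d → ℝ} (hv : v ∈ T.feSpace ℓ) :
    ∃ L : ℝ, 0 ≤ L ∧ ∀ x y, segment ℝ x y ⊆ T.support → |v y - v x| ≤ L * dist x y := by
  classical
  have h1 : ∀ K ∈ T.elements, ∃ L : ℝ, 0 ≤ L ∧ ∀ x ∈ simplexHull K, ∀ y ∈ simplexHull K,
      |v y - v x| ≤ L * dist x y := by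
    intro K hK
    obtain ⟨p, hp, hvp⟩ := mem_feSpace_iff.1 hv K hK
    obtain ⟨L, hL⟩ := (IsSimplex.isCompact_simplexHull K).exists_bound_of_continuousOn
      hp.continuous_gradient.continuousOn
    refine ⟨|L|, abs_nonneg L, fun x hx y hy => ?_⟩
    rw [hvp hx, hvp hy, ← Real.norm_eq_abs, dist_comm, dist_eq_norm]
    exact (IsSimplex.convex_simplexHull K).norm_image_sub_le_of_norm_fderiv_le
      (fun z _ => hp.differentiable z)
      (fun z hz => by rw [← IsSimplex.norm_gradient]; exact (hL z hz).trans (le_abs_self L)) hx hy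
  choose! L hL0 hL using h1
  refine ⟨∑ K ∈ T.elements, L K, Finset.sum_nonneg hL0, fun x y hxy => ?_⟩
  set M := ∑ K ∈ T.elements, L K with hM
  have hLM : ∀ K ∈ T.elements, L K ≤ M := fun K hK => Finset.single_le_sum hL0 hK
  set γ : ℝ → Euc d := ⇑(AffineMap.lineMap x y : ℝ →ᵃ[ℝ] Euc d) with hγ
  have hγc : Continuous γ := AffineMap.lineMap_continuous
  have hmaps : MapsTo γ (Icc 0 1) T.support := fun t ht =>
    hxy (segment_eq_image_lineMap ℝ x y ▸ mem_image_of_mem _ ht)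
  have hcont : ContinuousOn (fun t => v (γ t)) (Icc 0 1) :=
    (continuousOn_support hv).comp hγc.continuousOn hmaps
  -- One of the finitely many closed elements contains γ z for parameters z arbitrarily close to t
  -- from the right, and by closedness also γ t. So the slope bound of that element applies along a
  -- sequence, and the crossings of the segment need not be ordered.
  have hslope : ∀ t ∈ Ico (0 : ℝ) 1, ∃ᶠ z in nhdsWithin t (Ioi t), ∃ K ∈ T.elements,
      γ z ∈ simplexHull K ∧ γ t ∈ simplexHull K ∧ z ∈ Ioi t := by
    intro t ht
    by_contra hcon
    rw [Filter.not_frequently] at hcon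
    have hK : ∃ K ∈ T.elements, ∃ᶠ z in nhdsWithin t (Ioi t), γ z ∈ simplexHull K := by
      by_contra! hno
      have : ∀ᶠ z in nhdsWithin t (Ioi t), ∀ K ∈ T.elements, γ z ∉ simplexHull K :=
        (Filter.eventually_all_finset _).2 hno
      have h2 : ∀ᶠ z in nhdsWithin t (Ioi t), z ∈ Ioc t 1 := Ioc_mem_nhdsGT ht.2
      obtain ⟨z, hz, hz'⟩ := (this.and h2).exists
      obtain ⟨K, hK, hzK⟩ := mem_support.1 (hmaps ⟨ht.1.trans hz'.1.le, hz'.2⟩)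
      exact hz K hK hzK
    obtain ⟨K, hK, hf⟩ := hK
    have htK : γ t ∈ simplexHull K := by
      have hcl : IsClosed (γ ⁻¹' simplexHull K) :=
        (IsSimplex.isClosed_simplexHull K).preimage hγc
      exact hcl.mem_of_frequently_of_tendsto hf
        (Filter.tendsto_id.mono_right nhdsWithin_le_nhds)
    obtain ⟨z, hz, hzc, hzt⟩ := (hf.and_eventually (hcon.and self_mem_nhdsWithin)).exists
    exact hzc ⟨K, hK, hz, htK, hzt⟩
  -- The mean value inequality is one-sided; the signs s = 1 and s = -1 give both bounds.
  have key : ∀ s : ℝ, |s| = 1 → s * (v y - v x) ≤ M * dist x y := by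
    intro s hs
    have := image_le_of_liminf_slope_right_le_deriv_boundary
      (f := fun t => s * (v (γ t) - v x)) (a := 0) (b := 1) (B := fun t => M * dist x y * t)
      (B' := fun _ => M * dist x y)
      ((hcont.sub continuousOn_const).const_smul s) (by simp [hγ])
      (by fun_prop) (fun t _ => by simpa using ((hasDerivAt_id t).const_mul
        (M * dist x y)).hasDerivWithinAt) (fun t ht r hr => ?_)
      (right_mem_Icc.2 zero_le_one)
    · simpa [hγ] using this
    · refine (hslope t ht).mono ?_
      rintro z ⟨K, hK, hz, htK, hzt⟩
      have hzt : t < z := hzt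
      refine lt_of_le_of_lt ?_ hr
      rw [slope_def_field, div_le_iff₀ (sub_pos.2 hzt), ← mul_sub, sub_sub_sub_cancel_right]
      calc s * (v (γ z) - v (γ t)) ≤ |s * (v (γ z) - v (γ t))| := le_abs_self _
        _ = |v (γ z) - v (γ t)| := by rw [abs_mul, hs, one_mul]
        _ ≤ L K * dist (γ t) (γ z) := hL K hK _ htK _ hz
        _ = L K * (dist x y * (z - t)) := by
            rw [hγ, dist_lineMap_lineMap, dist_comm t z, Real.dist_eq,
              abs_of_pos (sub_pos.2 hzt)]; ring
        _ ≤ M * (dist x y * (z - t)) := by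
            have := sub_pos.2 hzt
            have := hLM K hK
            gcongr
        _ = M * dist x y * (z - t) := by ring
  rw [abs_le]
  constructor
  · linarith [key (-1) (by simp)]
  · linarith [key 1 (by simp)]

/-- The product of a finite element function and a test function is Lipschitz. -/
theorem exists_lipschitzWith_mul {v φ : Euc d → ℝ} (hv : v ∈ T.feSpace ℓ) (hφ : ContDiff ℝ ∞ φ)
    (hc : HasCompactSupport φ) (hs : tsupport φ ⊆ T.domain) :
    ∃ C, LipschitzWith C fun x => v x * φ x := by
  obtain ⟨L, hL0, hL⟩ := exists_lipschitz_segment hv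
  obtain ⟨M, hM⟩ := isCompact_support.exists_bound_of_continuousOn (continuousOn_support hv)
  obtain ⟨Lφ, hLφ⟩ := hφ.lipschitzWith_of_hasCompactSupport hc (by simp)
  obtain ⟨Mφ, hMφ⟩ := hc.exists_bound_of_continuous hφ.continuous
  obtain ⟨δ, hδ, hthick⟩ := hc.isCompact.exists_thickening_subset_open T.isOpen_domain hs
  have hMφ0 : 0 ≤ Mφ := (norm_nonneg _).trans (hMφ 0)
  have hne : ∀ x, x ∉ tsupport φ → φ x = 0 := fun x hx => image_eq_zero_of_notMem_tsupport hx
  -- The first two terms serve points closer than δ, whose segment stays in Ω so that the product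
  -- rule applies; the last serves points at distance at least δ, where the supremum of the product
  -- suffices.
  set C : ℝ := |M| * Lφ + Mφ * L + 2 * |M| * Mφ / δ with hC
  have hC0 : 0 ≤ C := by positivity
  have hvM : ∀ x ∈ T.support, |v x| ≤ |M| := fun x hx => (hM x hx).trans (le_abs_self M)
  have hprod : ∀ x, |v x * φ x| ≤ |M| * Mφ := by
    intro x
    by_cases hx : x ∈ tsupport φ
    · rw [abs_mul]
      exact mul_le_mul (hvM x (domain_subset_support (hs hx))) (hMφ x) (abs_nonneg _) (abs_nonneg _)
    · rw [hne x hx]; simp; positivity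
  have main : ∀ x y, x ∈ tsupport φ → |v y * φ y - v x * φ x| ≤ C * dist x y := by
    intro x y hx
    rcases lt_or_ge (dist x y) δ with h | h
    · have hball : Metric.ball x δ ⊆ T.support :=
        ((Metric.ball_subset_thickening hx δ).trans hthick).trans domain_subset_support
      have hseg : segment ℝ x y ⊆ T.support :=
        ((convex_ball x δ).segment_subset (Metric.mem_ball_self hδ)
          (by rwa [Metric.mem_ball'])).trans hball
      have h1 : |φ y - φ x| ≤ Lφ * dist x y := by
        have := hLφ.dist_le_mul y x
        rwa [Real.dist_eq, dist_comm] at this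
      have h2 := hL x y hseg
      have h3 := hvM x (hseg (left_mem_segment ℝ x y))
      have h4 : |φ y| ≤ Mφ := hMφ y
      calc |v y * φ y - v x * φ x| = |v x * (φ y - φ x) + φ y * (v y - v x)| := by ring_nf
        _ ≤ |v x| * |φ y - φ x| + |φ y| * |v y - v x| := by
            rw [← abs_mul, ← abs_mul]; exact abs_add_le _ _
        _ ≤ |M| * (Lφ * dist x y) + Mφ * (L * dist x y) := by gcongr
        _ = (|M| * Lφ + Mφ * L) * dist x y := by ring
        _ ≤ C * dist x y := by
            have : 0 ≤ 2 * |M| * Mφ / δ := by positivity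
            gcongr; rw [hC]; linarith
    · have h1 := hprod x
      have h2 := hprod y
      calc |v y * φ y - v x * φ x| ≤ |v y * φ y| + |v x * φ x| := abs_sub _ _
        _ ≤ 2 * |M| * Mφ / δ * δ := by rw [div_mul_cancel₀ _ hδ.ne']; linarith
        _ ≤ C * dist x y := by
            have : 0 ≤ |M| * Lφ + Mφ * L := by positivity
            gcongr
            rw [hC]; linarith
  refine ⟨⟨C, hC0⟩, LipschitzWith.of_dist_le_mul fun x y => ?_⟩
  rw [Real.dist_eq]
  change _ ≤ C * dist x y
  by_cases hx : x ∈ tsupport φ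
  · rw [abs_sub_comm]; exact main x y hx
  · by_cases hy : y ∈ tsupport φ
    · rw [dist_comm]; exact main y x hy
    · rw [hne x hx, hne y hy]; simp; positivity

theorem hasGradientAt_of_interior {v p : Euc d → ℝ} (hp : IsPolyFun ℓ p)
    (hvp : EqOn v p (simplexHull K)) {x : Euc d} (hx : x ∈ interior (simplexHull K)) :
    HasGradientAt v (gradient p x) x := by
  have : v =ᶠ[nhds x] p := hvp.eventuallyEq_of_mem (mem_interior_iff_mem_nhds.1 hx)
  exact (hp.hasGradientAt x).congr_of_eventuallyEq this

theorem measurable_gradient (v : Euc d → ℝ) : Measurable (gradient v) :=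
  (InnerProductSpace.toDual ℝ (Euc d)).symm.continuous.measurable.comp (measurable_fderiv ℝ v)

theorem exists_gradient_bound {v : Euc d → ℝ} (hv : v ∈ T.feSpace ℓ) :
    ∃ M : ℝ, ∀ᵐ x ∂(volume.restrict T.domain), ‖gradient v x‖ ≤ M := by
  have h1 : ∀ K ∈ T.elements, ∃ M : ℝ, 0 ≤ M ∧ ∀ x ∈ interior (simplexHull K),
      ‖gradient v x‖ ≤ M := by
    intro K hK
    obtain ⟨p, hp, hvp⟩ := mem_feSpace_iff.1 hv K hK
    obtain ⟨M, hM⟩ := (IsSimplex.isCompact_simplexHull K).exists_bound_of_continuousOn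
      hp.continuous_gradient.continuousOn
    refine ⟨|M|, abs_nonneg M, fun x hx => ?_⟩
    rw [(hasGradientAt_of_interior hp hvp hx).gradient]
    exact (hM x (interior_subset hx)).trans (le_abs_self M)
  choose! M hM0 hM using h1
  refine ⟨∑ K ∈ T.elements, M K, ?_⟩
  rw [ae_restrict_iff' T.isOpen_domain.measurableSet]
  filter_upwards [T.ae_mem_interior] with x hx hxΩ
  obtain ⟨K, hK, hxK⟩ := mem_support.1 (domain_subset_support hxΩ)
  exact (hM K hK x (hx K hK hxK)).trans (Finset.single_le_sum hM0 hK)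

theorem memLp_gradient {v : Euc d → ℝ} (hv : v ∈ T.feSpace ℓ) :
    MemLp (gradient v) 2 (volume.restrict T.domain) := by
  have := T.isFiniteMeasure_restrict_domain
  obtain ⟨M, hM⟩ := exists_gradient_bound hv
  exact MemLp.of_bound (measurable_gradient v).aestronglyMeasurable M hM

theorem memLp_feSpace {v : Euc d → ℝ} (hv : v ∈ T.feSpace ℓ) :
    MemLp v 2 (volume.restrict T.domain) := by
  have := T.isFiniteMeasure_restrict_domain
  obtain ⟨M, hM⟩ := isCompact_support.exists_bound_of_continuousOn (continuousOn_support hv)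
  refine MemLp.of_bound (hv.1.aestronglyMeasurable T.isOpen_domain.measurableSet) M ?_
  rw [ae_restrict_iff' T.isOpen_domain.measurableSet]
  exact .of_forall fun x hx => hM x (domain_subset_support hx)

theorem integrableOn_of_memLp {F : Type*} [NormedAddCommGroup F] {f : Euc d → F}
    (hf : MemLp f 2 (volume.restrict T.domain)) : IntegrableOn f T.domain := by
  have := T.isFiniteMeasure_restrict_domain
  exact hf.integrable (by norm_num)

/-- Finite element functions are weakly differentiable. -/
theorem hasWeakGradient_feSpace {v : Euc d → ℝ} (hv : v ∈ T.feSpace ℓ) :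
    HasWeakGradient T.domain v (gradient v) := by
  have hiv := integrableOn_of_memLp (memLp_feSpace hv)
  have hig := integrableOn_of_memLp (memLp_gradient hv)
  refine ⟨hiv.locallyIntegrableOn, hig.locallyIntegrableOn, fun φ hφ hc hs => ?_⟩
  obtain ⟨C, hC⟩ := exists_lipschitzWith_mul hv hφ hc hs
  have hcg := continuous_gradient_of_contDiff hφ
  have hsg := tsupport_gradient_subset φ
  have i1 : IntegrableOn (fun x => v x • gradient φ x) T.domain :=
    integrableOn_smul_test hiv.locallyIntegrableOn hcg
      (hc.of_isClosed_subset (isClosed_tsupport _) hsg) (hsg.trans hs)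
  have i2 : IntegrableOn (fun x => φ x • gradient v x) T.domain :=
    integrableOn_test_smul hig.locallyIntegrableOn hφ.continuous hc hs
  rw [eq_neg_iff_add_eq_zero, ← integral_add i1 i2]
  have key : ∀ e : Euc d,
      inner ℝ e (∫ x in T.domain, v x • gradient φ x + φ x • gradient v x) = 0 := by
    intro e
    -- Integration by parts of the globally Lipschitz product against the constant one gives ∫ ∂_e(v
    -- φ) = 0. This replaces elementwise integration by parts with cancelling face terms.
    have h0 := LipschitzWith.integral_lineDeriv_mul_eq (μ := (volume : Measure (Euc d)))
      (LipschitzWith.const (1 : ℝ)) hC (hc.mul_left (f := v)) (-e)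
    simp only [neg_neg, mul_one] at h0
    rw [← integral_inner (f := fun x => v x • gradient φ x + φ x • gradient v x) (i1.add i2)]
    have h1 : ∫ x, lineDeriv ℝ (fun x => v x * φ x) x e = 0 := by
      rw [← h0]
      refine integral_eq_zero_of_ae (.of_forall fun x => ?_)
      simp only [Pi.zero_apply]
      rw [(hasFDerivAt_const (1 : ℝ) x).hasLineDerivAt (-e) |>.lineDeriv]
      simp
    have hout : ∀ x, x ∉ T.domain → lineDeriv ℝ (fun x => v x * φ x) x e = 0 := by
      intro x hx
      have : (fun x => v x * φ x) =ᶠ[nhds x] fun _ => 0 := by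
        have hx' : x ∉ tsupport φ := fun h => hx (hs h)
        filter_upwards [(isClosed_tsupport φ).isOpen_compl.mem_nhds hx'] with y hy
        rw [image_eq_zero_of_notMem_tsupport hy, mul_zero]
      rw [this.lineDeriv_eq, (hasFDerivAt_const (0 : ℝ) x).hasLineDerivAt e |>.lineDeriv]
      simp
    rw [← h1, ← setIntegral_eq_integral_of_forall_compl_eq_zero hout]
    refine setIntegral_congr_ae T.isOpen_domain.measurableSet ?_
    filter_upwards [T.ae_mem_interior] with x hx hxΩ
    obtain ⟨K, hK, hxK⟩ := mem_support.1 (domain_subset_support hxΩ)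
    obtain ⟨p, hp, hvp⟩ := mem_feSpace_iff.1 hv K hK
    have hgv := hasGradientAt_of_interior hp hvp (hx K hK hxK)
    rw [hgv.gradient]
    have hgφ : HasGradientAt φ (gradient φ x) x :=
      (hφ.differentiable (by simp) x).hasGradientAt
    have := (hgv.hasFDerivAt.mul hgφ.hasFDerivAt).hasLineDerivAt e
    refine Eq.trans ?_ (HasLineDerivAt.lineDeriv this).symm
    simp [inner_add_right, inner_smul_right]
  -- Testing with the vector-valued integral itself shows that it has norm zero.
  have := key (∫ x in T.domain, v x • gradient φ x + φ x • gradient v x)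
  exact inner_self_eq_zero.1 this

end SimplicialMesh

/-! ### Weak gradients of differences. -/

section WeakGradient

variable {d : ℕ} {Ω : Set (Euc d)} {u v : Euc d → ℝ} {g g' : Euc d → Euc d}

theorem HasWeakGradient.sub (hu : HasWeakGradient Ω u g) (hv : HasWeakGradient Ω v g') :
    HasWeakGradient Ω (u - v) (g - g') := by
  refine ⟨hu.1.sub hv.1, hu.2.1.sub hv.2.1, fun φ hφ hc hs => ?_⟩
  have hcg := continuous_gradient_of_contDiff hφ
  have hsg : HasCompactSupport (gradient φ) :=
    hc.of_isClosed_subset (isClosed_tsupport _) (tsupport_gradient_subset φ)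
  have hsg' := (tsupport_gradient_subset φ).trans hs
  simp only [Pi.sub_apply, sub_smul, smul_sub]
  rw [integral_sub (integrableOn_smul_test hu.1 hcg hsg hsg')
    (integrableOn_smul_test hv.1 hcg hsg hsg'),
    integral_sub (integrableOn_test_smul hu.2.1 hφ.continuous hc hs)
    (integrableOn_test_smul hv.2.1 hφ.continuous hc hs), hu.2.2 φ hφ hc hs, hv.2.2 φ hφ hc hs]
  abel

theorem HasWeakGradient.weakGradient (h : HasWeakGradient Ω u g) :
    HasWeakGradient Ω u (weakGradient Ω u) := by
  have h' : ∃ g, HasWeakGradient Ω u g := ⟨g, h⟩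
  rw [_root_.weakGradient, dif_pos h']
  exact h'.choose_spec

theorem MemH1.hasWeakGradient (h : MemH1 Ω u) : HasWeakGradient Ω u (weakGradient Ω u) := by
  obtain ⟨-, g, hg, -⟩ := h
  exact hg.weakGradient

theorem MemH1.memLp_weakGradient (hΩ : IsOpen Ω) (h : MemH1 Ω u) :
    MemLp (weakGradient Ω u) 2 (volume.restrict Ω) := by
  obtain ⟨-, g, hg, hg2⟩ := h
  refine hg2.ae_eq ?_
  rw [Filter.EventuallyEq, ae_restrict_iff' hΩ.measurableSet]
  exact hg.ae_eq hΩ hg.weakGradient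

theorem MemH1.sub (hu : MemH1 Ω u) (hv : MemH1 Ω v) : MemH1 Ω (u - v) := by
  obtain ⟨h1, g, hg, hg2⟩ := hu
  obtain ⟨h1', g', hg', hg2'⟩ := hv
  exact ⟨h1.sub h1', g - g', hg.sub hg', hg2.sub hg2'⟩

namespace SimplicialMesh

variable {T : SimplicialMesh d} {ℓ : ℕ} {K : Finset (Euc d)}

theorem memH1_feSpace (hv : v ∈ T.feSpace ℓ) : MemH1 T.domain v :=
  ⟨memLp_feSpace hv, _, hasWeakGradient_feSpace hv, memLp_gradient hv⟩

/-- The weak gradient of the error of a finite element function on an element. -/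
theorem weakGradient_sub_ae (hu : MemH1 T.domain u) (hv : v ∈ T.feSpace ℓ) (hK : K ∈ T.elements)
    {p : Euc d → ℝ} (hp : IsPolyFun ℓ p) (hvp : EqOn v p (simplexHull K)) :
    ∀ᵐ x, x ∈ simplexHull K →
      weakGradient T.domain (u - v) x = weakGradient T.domain u x - gradient p x := by
  have h1 := hu.hasWeakGradient.sub (hasWeakGradient_feSpace hv)
  filter_upwards [h1.ae_eq T.isOpen_domain h1.weakGradient, T.ae_mem_interior] with x hx hi hxK
  have hxi := hi K hK hxK
  rw [← hx (interior_hull_subset_domain hK hxi), Pi.sub_apply,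
    (hasGradientAt_of_interior hp hvp hxi).gradient]

end SimplicialMesh

end WeakGradient

/-! ## Combinatorics of meshes -/

theorem IsSimplex.eq_of_bary_eq_one {d : ℕ} {K : Finset (Euc d)} (hK : IsSimplex K) {v x : Euc d}
    (hv : v ∈ K) (hx : x ∈ simplexHull K) (h : bary K v x = 1) : x = v := by
  classical
  have h1 := hK.sum_bary x
  rw [← Finset.add_sum_erase K _ hv, h] at h1
  have h2 : ∀ w ∈ K.erase v, bary K w x = 0 :=
    (Finset.sum_eq_zero_iff_of_nonneg fun w _ => hK.bary_nonneg hx w).1 (by linarith)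
  rw [← hK.sum_bary_smul x, ← Finset.add_sum_erase K _ hv, h,
    Finset.sum_eq_zero fun w hw => by rw [h2 w hw, zero_smul]]
  simp

theorem convexHull_finset_exists {d : ℕ} {G : Finset (Euc d)} {x : Euc d}
    (hx : x ∈ simplexHull G) : ∃ c : Euc d → ℝ, (∀ g ∈ G, 0 ≤ c g) ∧ ∑ g ∈ G, c g = 1 ∧
      ∑ g ∈ G, c g • g = x := by
  rw [simplexHull, Finset.convexHull_eq, mem_ofPred_eq] at hx
  obtain ⟨c, h0, hc, rfl⟩ := hx
  refine ⟨c, h0, hc, ?_⟩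
  rw [Finset.centerMass_eq_of_sum_1 _ _ hc]
  simp

namespace SimplicialMesh

variable {d ℓ : ℕ} {T : SimplicialMesh d} {K K' K₁ K₂ F : Finset (Euc d)} {z : Euc d}

open Classical in
theorem inter_hull (hK : K ∈ T.elements) (hK' : K' ∈ T.elements) :
    simplexHull K ∩ simplexHull K' = simplexHull (K ∩ K') := by
  rw [simplexHull, simplexHull, T.conforming K hK K' hK', simplexHull, Finset.coe_inter]

/-- Holds for every point `v`, vertex or not, thanks to the convention that the coordinate is zero
off the vertex set. This makes nodal basis functions single-valued on intersections. -/
theorem bary_eq (hK : K ∈ T.elements) (hK' : K' ∈ T.elements) (hz : z ∈ simplexHull K)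
    (hz' : z ∈ simplexHull K') (v : Euc d) : bary K v z = bary K' v z := by
  refine (T.isSimplex hK).bary_eq_of_mem_common (T.isSimplex hK') ?_ v
  rw [← T.conforming K hK K' hK']
  exact ⟨hz, hz'⟩

theorem exists_common_vertex (hK : K ∈ T.elements) (hK' : K' ∈ T.elements)
    (h : (simplexHull K ∩ simplexHull K').Nonempty) : ∃ v ∈ K, v ∈ K' := by
  rw [simplexHull, simplexHull, T.conforming K hK K' hK', convexHull_nonempty_iff] at h
  obtain ⟨v, hv, hv'⟩ := h
  exact ⟨v, hv, hv'⟩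

theorem mem_interiorFaces (hF : F ∈ T.interiorFaces) : ∃ K ∈ T.elements, F ⊆ K ∧ F.card = d := by
  classical
  rw [interiorFaces, Finset.mem_filter, faces, Finset.mem_biUnion] at hF
  obtain ⟨⟨K, hK, hFK⟩, -⟩ := hF
  rw [Finset.mem_powersetCard] at hFK
  exact ⟨K, hK, hFK.1, hFK.2⟩

/-- The definition of a path gives an equality of point sets only. A vertex `v` of `F` is extreme in
the simplex having `F` as a face: if it is a convex combination of common vertices of `K₁` and `K₂`,
all lying in that simplex, one of them has coordinate one at `v` and thus equals `v`. -/
theorem face_subset (hK₁ : K₁ ∈ T.elements) (hK₂ : K₂ ∈ T.elements) (hF : F ∈ T.interiorFaces)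
    (h : simplexHull K₁ ∩ simplexHull K₂ = simplexHull F) : F ⊆ K₁ ∧ F ⊆ K₂ := by
  classical
  rw [← Finset.subset_inter_iff]
  rw [inter_hull hK₁ hK₂] at h
  obtain ⟨K, hK, hFK, -⟩ := mem_interiorFaces hF
  have hs := T.isSimplex hK
  intro v hv
  by_contra hvG
  have hmem : v ∈ simplexHull (K₁ ∩ K₂) := h ▸ subset_convexHull ℝ _ hv
  obtain ⟨c, hc0, hc1, hcv⟩ := convexHull_finset_exists hmem
  have hG : ∀ g ∈ K₁ ∩ K₂, g ∈ simplexHull K := fun g hg =>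
    convexHull_mono (by exact_mod_cast hFK)
      (show g ∈ simplexHull F from h ▸ subset_convexHull ℝ _ hg)
  have hlt : ∀ g ∈ K₁ ∩ K₂, 0 < 1 - bary K v g := fun g hg => by
    refine sub_pos.2 (lt_of_le_of_ne (hs.bary_le_one (hG g hg) v) fun he => hvG ?_)
    rwa [← hs.eq_of_bary_eq_one (hFK hv) (hG g hg) he]
  have e : ∑ g ∈ K₁ ∩ K₂, c g * (1 - bary K v g) = 0 := by
    simp only [mul_sub, mul_one, Finset.sum_sub_distrib]
    rw [← IsSimplex.map_affine_combination hc1, hcv, hc1, hs.bary_apply_self (hFK hv), sub_self]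
  have h0 := (Finset.sum_eq_zero_iff_of_nonneg fun g hg =>
    mul_nonneg (hc0 g hg) (hlt g hg).le).1 e
  have : ∑ g ∈ K₁ ∩ K₂, c g = 0 := Finset.sum_eq_zero fun g hg =>
    (mul_eq_zero.1 (h0 g hg)).resolve_right (hlt g hg).ne'
  linarith

theorem vertex_mem_nodes (hℓ : 1 ≤ ℓ) (hK : K ∈ T.elements) (hz : z ∈ K) : z ∈ T.nodes ℓ := by
  classical
  have hℓ0 : (ℓ : ℝ) ≠ 0 := by exact_mod_cast (by omega : ℓ ≠ 0)
  refine ⟨K, hK, fun v => if v = z then ℓ else 0, ?_, ?_⟩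
  · rw [Finset.sum_ite_eq' K z, if_pos hz]
  · rw [Finset.sum_eq_single_of_mem z hz fun v _ hv => by simp [hv]]
    simp [hℓ0]

theorem latticePoint_mem_nodes {α : Euc d →₀ ℕ} (hK : K ∈ T.elements)
    (hα : α ∈ latticeIndices ℓ K) : latticePoint ℓ α ∈ T.nodes ℓ :=
  ⟨K, hK, α, (mem_latticeIndices.1 hα).1, latticePoint_eq (mem_latticeIndices.1 hα).2⟩

/-! ### Incidence counts and comparability of touching elements. -/

variable (T) in
open Classical in
/-- The elements containing a point. -/
noncomputable def elementsAt (z : Euc d) : Finset (Finset (Euc d)) :=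
  T.elements.filter fun K => z ∈ simplexHull K

variable (T) in
open Classical in
/-- The elements having `F` as a face. -/
noncomputable def elementsOf (F : Finset (Euc d)) : Finset (Finset (Euc d)) :=
  T.elements.filter fun K => F ⊆ K

variable (T) in
open Classical in
/-- The interior faces of an element. -/
noncomputable def facesOf (K : Finset (Euc d)) : Finset (Finset (Euc d)) :=
  T.interiorFaces.filter fun F => F ⊆ K

variable (T) in
open Classical in
/-- The elements touching an element. -/
noncomputable def neighbors (K : Finset (Euc d)) : Finset (Finset (Euc d)) :=
  T.elements.filter fun K' => (simplexHull K ∩ simplexHull K').Nonempty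

theorem mem_elementsAt : K ∈ T.elementsAt z ↔ K ∈ T.elements ∧ z ∈ simplexHull K := by
  simp [elementsAt]

theorem mem_elementsOf : K ∈ T.elementsOf F ↔ K ∈ T.elements ∧ F ⊆ K := by
  simp [elementsOf]

theorem mem_facesOf : F ∈ T.facesOf K ↔ F ∈ T.interiorFaces ∧ F ⊆ K := by
  simp [facesOf]

theorem mem_neighbors : K' ∈ T.neighbors K ↔
    K' ∈ T.elements ∧ (simplexHull K ∩ simplexHull K').Nonempty := by
  simp [neighbors]

theorem card_elementsAt_le (hz : z ∈ T.nodes ℓ) : (T.elementsAt z).card ≤ T.nBar ℓ := by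
  classical
  refine le_csSup ⟨T.elements.card, ?_⟩ ⟨z, hz, ?_⟩
  · rintro m ⟨y, -, rfl⟩
    rw [← Set.ncard_coe_finset]
    exact Set.ncard_le_ncard (fun K hK => hK.1) T.elements.finite_toSet
  · rw [← Set.ncard_coe_finset]
    congr 1
    ext K
    simp [elementsAt]

theorem card_elementsOf_le (hd : 1 ≤ d) (hℓ : 1 ≤ ℓ) (hF : F ∈ T.interiorFaces) :
    (T.elementsOf F).card ≤ T.nBar ℓ := by
  obtain ⟨K, hK, hFK, hcard⟩ := mem_interiorFaces hF
  obtain ⟨v, hv⟩ : F.Nonempty := by rw [← Finset.card_pos]; omega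
  refine (Finset.card_le_card fun K' hK' => ?_).trans
    (card_elementsAt_le (vertex_mem_nodes hℓ hK (hFK hv)))
  rw [mem_elementsOf] at hK'
  exact mem_elementsAt.2 ⟨hK'.1, subset_convexHull ℝ _ (hK'.2 hv)⟩

/-- By conformity touching elements share a vertex, and the vertices are nodes. -/
theorem card_neighbors_le (hℓ : 1 ≤ ℓ) (hK : K ∈ T.elements) :
    (T.neighbors K).card ≤ (d + 1) * T.nBar ℓ := by
  classical
  have : T.neighbors K ⊆ K.biUnion fun v => T.elementsAt v := by
    intro K' hK'
    rw [mem_neighbors] at hK'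
    obtain ⟨v, hv, hv'⟩ := exists_common_vertex hK hK'.1 hK'.2
    exact Finset.mem_biUnion.2 ⟨v, hv, mem_elementsAt.2 ⟨hK'.1, subset_convexHull ℝ _ hv'⟩⟩
  refine (Finset.card_le_card this).trans ?_
  rw [← T.card_eq K hK]
  exact Finset.card_biUnion_le_card_mul _ _ _ fun v hv =>
    card_elementsAt_le (vertex_mem_nodes hℓ hK hv)

theorem mem_neighbors_comm (hK : K ∈ T.elements) (h : K' ∈ T.neighbors K) :
    K ∈ T.neighbors K' := by
  rw [mem_neighbors] at h ⊢
  exact ⟨hK, by rw [inter_comm]; exact h.2⟩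

theorem mem_neighbors_of_mem (hK' : K' ∈ T.elements) (hz : z ∈ simplexHull K)
    (hz' : z ∈ simplexHull K') : K' ∈ T.neighbors K := mem_neighbors.2 ⟨hK', z, hz, hz'⟩

theorem card_facesOf_le (hK : K ∈ T.elements) : (T.facesOf K).card ≤ d + 1 := by
  classical
  have : T.facesOf K ⊆ K.powersetCard d := fun F hF => by
    rw [mem_facesOf] at hF
    obtain ⟨-, -, -, hc⟩ := mem_interiorFaces hF.1
    exact Finset.mem_powersetCard.2 ⟨hF.2, hc⟩
  refine (Finset.card_le_card this).trans_eq ?_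
  rw [Finset.card_powersetCard, T.card_eq K hK, Nat.choose_succ_self_right]

/-- The volumes of touching elements are comparable. -/
theorem simplexVol_le (hK : K ∈ T.elements) (hK' : K' ∈ T.neighbors K) {μ : ℝ} (hμ : T.mu ≤ μ) :
    simplexVol K ≤ μ ^ 2 * simplexVol K' := by
  rw [mem_neighbors] at hK'
  have hfin : {r : ℝ | ∃ K ∈ T.elements, ∃ K' ∈ T.elements,
      (simplexHull K ∩ simplexHull K').Nonempty ∧
      r = Real.sqrt (simplexVol K) / Real.sqrt (simplexVol K')}.Finite := by
    refine ((T.elements ×ˢ T.elements).finite_toSet.image fun P =>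
      Real.sqrt (simplexVol P.1) / Real.sqrt (simplexVol P.2)).subset ?_
    rintro r ⟨K, hK, K', hK', -, rfl⟩
    exact ⟨(K, K'), by simp [hK, hK'], rfl⟩
  have h := (le_csSup hfin.bddAbove ⟨K, hK, K', hK'.1, hK'.2, rfl⟩).trans hμ
  have hv := (T.isSimplex hK).simplexVol_pos
  have hv' := (T.isSimplex hK'.1).simplexVol_pos
  rw [div_le_iff₀ (Real.sqrt_pos.2 hv')] at h
  calc simplexVol K = Real.sqrt (simplexVol K) ^ 2 := (Real.sq_sqrt hv.le).symm
    _ ≤ (μ * Real.sqrt (simplexVol K')) ^ 2 := by gcongr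
    _ = μ ^ 2 * simplexVol K' := by rw [mul_pow, Real.sq_sqrt hv'.le]

/-- The diameters and inscribed diameters of touching elements are comparable. -/
theorem simplexDiam_le (hd : 1 ≤ d) (hK : K ∈ T.elements) (hK' : K' ∈ T.neighbors K) {σ : ℝ}
    (hσ : T.shape ≤ σ) : simplexDiam K' ≤ σ * inscribedDiam K := by
  rw [mem_neighbors] at hK'
  have hfin : {r : ℝ | ∃ K ∈ T.elements, ∃ K' ∈ T.elements,
      (simplexHull K ∩ simplexHull K').Nonempty ∧
      r = simplexDiam K' / inscribedDiam K}.Finite := by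
    refine ((T.elements ×ˢ T.elements).finite_toSet.image fun P =>
      simplexDiam P.2 / inscribedDiam P.1).subset ?_
    rintro r ⟨K, hK, K', hK', -, rfl⟩
    exact ⟨(K, K'), by simp [hK, hK'], rfl⟩
  have h := (le_csSup hfin.bddAbove ⟨K, hK, K', hK'.1, hK'.2, rfl⟩).trans hσ
  rwa [div_le_iff₀ ((T.isSimplex hK).inscribedDiam_pos hd)] at h

/-- Every element has an interior face. -/
theorem facesOf_nonempty (hℓ : 1 ≤ ℓ) (hT : 2 ≤ T.elements.card) (hΩ : IsConnected T.domain)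
    (hfc : T.FaceConnected ℓ) (hK : K ∈ T.elements) : (T.facesOf K).Nonempty := by
  classical
  -- If nothing touched `K`, then `K` and the union of the other elements would be disjoint closed
  -- sets covering Ω, each meeting it, against connectedness.
  have hex : ∃ K' ∈ T.elements, K' ≠ K ∧ (simplexHull K ∩ simplexHull K').Nonempty := by
    by_contra! hno
    obtain ⟨K', hK', hne⟩ := Finset.exists_mem_ne (by omega : 1 < T.elements.card) K
    have hcl : IsClosed (⋃ K' ∈ T.elements.erase K, simplexHull K') :=
      (T.elements.erase K).finite_toSet.isClosed_biUnion fun K _ =>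
        IsSimplex.isClosed_simplexHull K
    have hdisj : T.domain ∩ (simplexHull K ∩ ⋃ K' ∈ T.elements.erase K, simplexHull K') = ∅ := by
      rw [eq_empty_iff_forall_notMem]
      rintro x ⟨-, hxK, hx⟩
      simp only [mem_iUnion] at hx
      obtain ⟨K'', hK'', hx''⟩ := hx
      rw [Finset.mem_erase] at hK''
      have := hno K'' hK''.2 hK''.1
      exact eq_empty_iff_forall_notMem.1 this x ⟨hxK, hx''⟩
    have hcov : T.domain ⊆ simplexHull K ∪ ⋃ K' ∈ T.elements.erase K, simplexHull K' := by
      intro x hx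
      obtain ⟨K'', hK'', hx''⟩ := mem_support.1 (domain_subset_support hx)
      by_cases h : K'' = K
      · exact Or.inl (h ▸ hx'')
      · exact Or.inr (mem_biUnion (Finset.mem_erase.2 ⟨h, hK''⟩) hx'')
    have hKK' := eq_empty_iff_forall_notMem.1 (hno K' hK' hne)
    rcases isPreconnected_iff_subset_of_disjoint_closed.1 hΩ.isPreconnected _ _
      (IsSimplex.isClosed_simplexHull K) hcl hcov hdisj with h | h
    · obtain ⟨x, hx⟩ := (T.isSimplex hK').interior_nonempty
      exact hKK' x ⟨h (interior_hull_subset_domain hK' hx), interior_subset hx⟩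
    · obtain ⟨x, hx⟩ := (T.isSimplex hK).interior_nonempty
      have hxΩ := interior_hull_subset_domain hK hx
      exact eq_empty_iff_forall_notMem.1 hdisj x ⟨hxΩ, interior_subset hx, h hxΩ⟩
  obtain ⟨K', hK', hne, hint⟩ := hex
  obtain ⟨v, hv, hv'⟩ := exists_common_vertex hK hK' hint
  obtain ⟨n, path, hmem, -, h0, hl, hstep⟩ := hfc v (vertex_mem_nodes hℓ hK hv) K hK K' hK'
    (subset_convexHull ℝ _ hv) (subset_convexHull ℝ _ hv')
  -- A path without steps would force `K' = K`; otherwise its first crossing is an interior face of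
  -- `K`.
  rcases n with _ | n
  · exact absurd (hl.symm.trans h0) hne
  · obtain ⟨F, hF, -, hcap⟩ := hstep 0
    have := (face_subset (hmem _) (hmem _) hF hcap).1
    rw [Fin.castSucc_zero, h0] at this
    exact ⟨F, mem_facesOf.2 ⟨hF, this⟩⟩

/-! ### Localization of the norm -/

/-- Different elements overlap in a null set. -/
theorem aedisjoint (hK : K ∈ T.elements) (hK' : K' ∈ T.elements) (hne : K ≠ K') :
    AEDisjoint volume (simplexHull K) (simplexHull K') := by
  classical
  have : ∃ v ∈ K, v ∉ K' := by
    by_contra! h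
    exact hne (Finset.eq_of_subset_of_card_le h (by rw [T.card_eq K hK, T.card_eq K' hK']))
  obtain ⟨v, hv, hv'⟩ := this
  -- The overlap lies in the boundary of `K`: the coordinate of a vertex not shared with `K'`
  -- vanishes on it.
  refine measure_mono_null (fun x hx => ?_) (IsSimplex.volume_frontier K)
  rw [(IsSimplex.isClosed_simplexHull K).frontier_eq]
  refine ⟨hx.1, fun hxi => ?_⟩
  rw [(T.isSimplex hK).interior_simplexHull] at hxi
  have h1 := hxi v hv
  rw [bary_eq hK hK' hx.1 hx.2, IsSimplex.bary_of_notMem hv'] at h1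
  simp at h1

variable (T) in
/-- The contribution of an element to the square of the reaction-diffusion norm. -/
noncomputable def elemSq (ε : ℝ) (w : Euc d → ℝ) (K : Finset (Euc d)) : ℝ :=
  (∫ x in simplexHull K, w x ^ 2) + ε * ∫ x in simplexHull K, ‖weakGradient T.domain w x‖ ^ 2

theorem integral_biUnion_elements {S : Finset (Finset (Euc d))} (hS : S ⊆ T.elements)
    {f : Euc d → ℝ} (hf : IntegrableOn f T.domain) :
    ∫ x in ⋃ K ∈ S, simplexHull K, f x = ∑ K ∈ S, ∫ x in simplexHull K, f x := by
  have e : (⋃ K ∈ S, simplexHull K) = ⋃ K : S, simplexHull (K : Finset (Euc d)) := by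
    ext x; simp
  have hf' : IntegrableOn f T.support := hf.congr_set_ae T.domain_ae_eq_support.symm
  have hm : ∀ K : S, NullMeasurableSet (simplexHull (K : Finset (Euc d))) volume := fun K =>
    (IsSimplex.measurableSet_simplexHull K.1).nullMeasurableSet
  have hd : Pairwise (Function.onFun (AEDisjoint volume)
      fun K : S => simplexHull (K : Finset (Euc d))) := fun K K' h =>
    aedisjoint (hS K.2) (hS K'.2) fun he => h (Subtype.ext he)
  have hi : IntegrableOn f (⋃ K : S, simplexHull (K : Finset (Euc d))) :=
    hf'.mono_set (iUnion_subset fun K => hull_subset_support (hS K.2))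
  rw [e, integral_iUnion_ae hm hd hi, tsum_fintype]
  exact Finset.sum_coe_sort S fun K => ∫ x in simplexHull K, f x

variable {w : Euc d → ℝ} {ε : ℝ}

theorem integrableOn_sq (hw : MemH1 T.domain w) : IntegrableOn (fun x => w x ^ 2) T.domain :=
  hw.1.integrable_sq

theorem integrableOn_sq_gradient (hw : MemH1 T.domain w) :
    IntegrableOn (fun x => ‖weakGradient T.domain w x‖ ^ 2) T.domain :=
  (hw.memLp_weakGradient T.isOpen_domain).integrable_norm_pow (by norm_num)

theorem _root_.MeasureTheory.IntegrableOn.on_element {F : Type*} [NormedAddCommGroup F]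
    {f : Euc d → F} (hf : IntegrableOn f T.domain) (hK : K ∈ T.elements) :
    IntegrableOn f (simplexHull K) :=
  hf.mono_set_ae (hull_ae_le_domain hK)

theorem elemSq_nonneg (hε : 0 ≤ ε) (w : Euc d → ℝ) (K : Finset (Euc d)) : 0 ≤ T.elemSq ε w K :=
  add_nonneg (integral_nonneg fun _ => sq_nonneg _)
    (mul_nonneg hε (integral_nonneg fun _ => sq_nonneg _))

theorem integral_sq_le_elemSq (hε : 0 ≤ ε) (w : Euc d → ℝ) (K : Finset (Euc d)) :
    ∫ x in simplexHull K, w x ^ 2 ≤ T.elemSq ε w K :=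
  le_add_of_nonneg_right (mul_nonneg hε (integral_nonneg fun _ => sq_nonneg _))

theorem integral_sq_gradient_le_elemSq (w : Euc d → ℝ) (K : Finset (Euc d)) :
    ε * ∫ x in simplexHull K, ‖weakGradient T.domain w x‖ ^ 2 ≤ T.elemSq ε w K :=
  le_add_of_nonneg_left (integral_nonneg fun _ => sq_nonneg _)

theorem rdNorm_sq_biUnion (hε : 0 ≤ ε) (hw : MemH1 T.domain w) {S : Finset (Finset (Euc d))}
    (hS : S ⊆ T.elements) :
    rdNorm T.domain ε (⋃ K ∈ S, simplexHull K) w ^ 2 = ∑ K ∈ S, T.elemSq ε w K := by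
  rw [rdNorm, Real.sq_sqrt (add_nonneg (integral_nonneg fun _ => sq_nonneg _)
    (mul_nonneg hε (integral_nonneg fun _ => sq_nonneg _))),
    integral_biUnion_elements hS (integrableOn_sq hw),
    integral_biUnion_elements hS (integrableOn_sq_gradient hw), Finset.mul_sum,
    ← Finset.sum_add_distrib]
  rfl

theorem rdNorm_sq_domain (hε : 0 ≤ ε) (hw : MemH1 T.domain w) :
    rdNorm T.domain ε T.domain w ^ 2 = ∑ K ∈ T.elements, T.elemSq ε w K := by
  rw [← rdNorm_sq_biUnion hε hw subset_rfl, rdNorm, rdNorm,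
    setIntegral_congr_set T.domain_ae_eq_support, setIntegral_congr_set T.domain_ae_eq_support]
  rfl

theorem pair_eq (F : Finset (Euc d)) : T.pair F = ⋃ K ∈ T.elementsOf F, simplexHull K := by
  ext x
  simp only [pair, mem_iUnion, mem_elementsOf, exists_prop, and_assoc]

theorem rdNorm_sq_pair (hε : 0 ≤ ε) (hw : MemH1 T.domain w) (F : Finset (Euc d)) :
    rdNorm T.domain ε (T.pair F) w ^ 2 = ∑ K ∈ T.elementsOf F, T.elemSq ε w K := by
  rw [pair_eq]
  exact rdNorm_sq_biUnion hε hw (Finset.filter_subset _ _)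

theorem rdNorm_nonneg (Ω : Set (Euc d)) (ε : ℝ) (D : Set (Euc d)) (w : Euc d → ℝ) :
    0 ≤ rdNorm Ω ε D w := Real.sqrt_nonneg _

theorem zero_mem_feSpace : (0 : Euc d → ℝ) ∈ T.feSpace ℓ :=
  mem_feSpace_iff.2 fun _ _ => ⟨_, IsPolyFun.const 0, fun _ _ => rfl⟩

instance : Nonempty (T.feSpace ℓ) := ⟨⟨0, zero_mem_feSpace⟩⟩

theorem bestError_nonneg (D : Set (Euc d)) (u : Euc d → ℝ) : 0 ≤ T.bestError ℓ ε D u :=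
  le_ciInf fun _ => rdNorm_nonneg _ _ _ _

theorem bestError_le (D : Set (Euc d)) (u : Euc d → ℝ) {v : Euc d → ℝ} (hv : v ∈ T.feSpace ℓ) :
    T.bestError ℓ ε D u ≤ rdNorm T.domain ε D (u - v) :=
  ciInf_le (f := fun v : T.feSpace ℓ => rdNorm T.domain ε D (u - (v : Euc d → ℝ)))
    ⟨0, by rintro _ ⟨v, rfl⟩; exact rdNorm_nonneg _ _ _ _⟩ ⟨v, hv⟩

/-- The local best errors are bounded by the global best error. -/
theorem pairError_le (hε : 0 ≤ ε) {u : Euc d → ℝ} (hu : MemH1 T.domain u) :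
    T.pairError ℓ ε u ≤ (d + 1) * T.bestError ℓ ε T.domain u := by
  classical
  rw [bestError, Real.mul_iInf_of_nonneg (by positivity)]
  refine le_ciInf fun v => ?_
  have hw := hu.sub (memH1_feSpace v.2)
  have hd1 : (1 : ℝ) ≤ d + 1 := by linarith [show (0 : ℝ) ≤ d by positivity]
  rw [pairError]
  refine Real.sqrt_le_iff.2 ⟨mul_nonneg (by positivity) (rdNorm_nonneg _ _ _ _), ?_⟩
  calc ∑ F ∈ T.interiorFaces, T.bestError ℓ ε (T.pair F) u ^ 2
      ≤ ∑ F ∈ T.interiorFaces, ∑ K ∈ T.elementsOf F, T.elemSq ε (u - v) K := by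
        refine Finset.sum_le_sum fun F _ => ?_
        rw [← rdNorm_sq_pair hε hw]
        exact pow_le_pow_left₀ (bestError_nonneg _ _) (bestError_le _ _ v.2) 2
    _ = ∑ K ∈ T.elements, ∑ F ∈ T.facesOf K, T.elemSq ε (u - v) K := by
        refine Finset.sum_comm' fun F K => ?_
        rw [mem_elementsOf, mem_facesOf]; tauto
    _ ≤ ∑ K ∈ T.elements, ((d : ℝ) + 1) * T.elemSq ε (u - v) K := by
        refine Finset.sum_le_sum fun K hK => ?_
        rw [Finset.sum_const, nsmul_eq_mul]
        refine mul_le_mul_of_nonneg_right ?_ (elemSq_nonneg hε _ _)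
        exact_mod_cast card_facesOf_le hK
    _ = (d + 1) * rdNorm T.domain ε T.domain (u - v) ^ 2 := by
        rw [← Finset.mul_sum, rdNorm_sq_domain hε hw]
    -- The count gives the factor √(d + 1), which is weakened to d + 1.
    _ ≤ ((d + 1) * rdNorm T.domain ε T.domain (u - v)) ^ 2 := by
        rw [mul_pow]
        refine mul_le_mul_of_nonneg_right ?_ (sq_nonneg _)
        nlinarith

end SimplicialMesh

/-! ## Interpolation of piecewise polynomials -/

theorem Fin.sq_sub_le_mul_sum {m : ℕ} (f : Fin (m + 1) → ℝ) :
    (f (Fin.last m) - f 0) ^ 2 ≤ m * ∑ j : Fin m, (f j.castSucc - f j.succ) ^ 2 := by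
  have h : ∀ (m : ℕ) (f : Fin (m + 1) → ℝ),
      f 0 - f (Fin.last m) = ∑ j : Fin m, (f j.castSucc - f j.succ) := by
    intro m
    induction m with
    | zero => intro f; simp
    | succ m ih =>
      intro f
      rw [Fin.sum_univ_castSucc]
      have := ih fun j => f j.castSucc
      simp only [Fin.castSucc_zero] at this
      simp only [Fin.succ_castSucc, Fin.succ_last]
      rw [← this]; ring
  rw [← neg_sub, neg_sq, h]
  have := sq_sum_le_card_mul_sum_sq (s := (Finset.univ : Finset (Fin m)))
    (f := fun j => f j.castSucc - f j.succ)
  simpa using this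

namespace SimplicialMesh

variable {d ℓ : ℕ} {T : SimplicialMesh d} {K F : Finset (Euc d)} {ε : ℝ}

/-- A piecewise polynomial with prescribed values at the Lagrange nodes. -/
theorem exists_feSpace_interpolant (c : (Euc d →₀ ℕ) → ℝ) :
    ∃ v ∈ T.feSpace ℓ, ∀ K ∈ T.elements,
      EqOn v (fun x => ∑ α ∈ latticeIndices ℓ K, c α * lagrangeFun ℓ K α x) (simplexHull K) := by
  classical
  set A := T.elements.biUnion fun K => latticeIndices ℓ K with hA
  -- The choice of an element containing `x` is harmless: barycentric coordinates agree on
  -- intersections, and the sum runs over the indices of all elements because those not supported on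
  -- the chosen one contribute zero.
  let v : Euc d → ℝ := fun x => if h : ∃ K ∈ T.elements, x ∈ simplexHull K then
    ∑ α ∈ A, c α * lagrangeFun ℓ h.choose α x else 0
  have hv : ∀ K ∈ T.elements,
      EqOn v (fun x => ∑ α ∈ latticeIndices ℓ K, c α * lagrangeFun ℓ K α x) (simplexHull K) := by
    intro K hK x hx
    have h : ∃ K ∈ T.elements, x ∈ simplexHull K := ⟨K, hK, hx⟩
    simp only [v, dif_pos h]
    have hsub : latticeIndices ℓ K ⊆ A := Finset.subset_biUnion_of_mem (latticeIndices ℓ) hK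
    rw [Finset.sum_subset hsub]
    · refine Finset.sum_congr rfl fun α _ => ?_
      congr 1
      refine Finset.prod_congr rfl fun w _ => ?_
      simp only
      rw [bary_eq h.choose_spec.1 hK h.choose_spec.2 hx]
    · intro α hα hαK
      rw [lagrangeFun_eq_zero, mul_zero]
      intro hs
      apply hαK
      obtain ⟨K', hK', hα'⟩ := Finset.mem_biUnion.1 hα
      rw [mem_latticeIndices] at hα' ⊢
      refine ⟨?_, hs⟩
      rw [← hα'.1, ← Finset.sum_subset hs fun w _ hw => Finsupp.notMem_support_iff.1 hw,
        ← Finset.sum_subset hα'.2 fun w _ hw => Finsupp.notMem_support_iff.1 hw]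
  refine ⟨v, mem_feSpace_iff.2 fun K hK => ⟨_, ?_, hv K hK⟩, hv⟩
  exact IsPolyFun.sum fun α hα => (IsSimplex.isPolyFun_lagrangeFun hα).const_mul _

variable (T) in
/-- The squared reaction-diffusion norm on an element of the error of a polynomial. -/
noncomputable def polySq (ε : ℝ) (u q : Euc d → ℝ) (K : Finset (Euc d)) : ℝ :=
  (∫ x in simplexHull K, (u x - q x) ^ 2) +
    ε * ∫ x in simplexHull K, ‖weakGradient T.domain u x - gradient q x‖ ^ 2

theorem elemSq_sub_eq {u v q : Euc d → ℝ} (hu : MemH1 T.domain u) (hv : v ∈ T.feSpace ℓ)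
    (hK : K ∈ T.elements) (hq : IsPolyFun ℓ q) (hvq : EqOn v q (simplexHull K)) :
    T.elemSq ε (u - v) K = T.polySq ε u q K := by
  have hm := IsSimplex.measurableSet_simplexHull K
  rw [elemSq, polySq]
  congr 1
  · exact setIntegral_congr_fun hm fun x hx => by simp [hvq hx]
  · congr 1
    refine setIntegral_congr_ae hm ?_
    filter_upwards [weakGradient_sub_ae hu hv hK hq hvq] with x hx hxK
    rw [hx hxK]

theorem memLp_element {G : Type*} [NormedAddCommGroup G] {f : Euc d → G}
    (hf : MemLp f 2 (volume.restrict T.domain)) (hK : K ∈ T.elements) :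
    MemLp f 2 (volume.restrict (simplexHull K)) :=
  hf.mono_measure (Measure.restrict_mono_ae (hull_ae_le_domain hK))

theorem memLp_of_continuous {G : Type*} [NormedAddCommGroup G] {f : Euc d → G}
    (hf : Continuous f) (K : Finset (Euc d)) : MemLp f 2 (volume.restrict (simplexHull K)) := by
  have : IsFiniteMeasure (volume.restrict (simplexHull K)) :=
    ⟨by rw [Measure.restrict_apply_univ]; exact IsSimplex.volume_simplexHull_lt_top K⟩
  obtain ⟨M, hM⟩ := (IsSimplex.isCompact_simplexHull K).exists_bound_of_continuousOn hf.continuousOn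
  refine MemLp.of_bound
    (hf.continuousOn.aestronglyMeasurable_of_isCompact (IsSimplex.isCompact_simplexHull K)
      (IsSimplex.measurableSet_simplexHull K)) M ?_
  rw [ae_restrict_iff' (IsSimplex.measurableSet_simplexHull K)]
  exact .of_forall hM

theorem sq_add_le_two (a b : ℝ) : (a + b) ^ 2 ≤ 2 * a ^ 2 + 2 * b ^ 2 := by
  nlinarith [sq_nonneg (a - b)]

theorem norm_add_sq_le_two {G : Type*} [SeminormedAddCommGroup G] (a b : G) :
    ‖a + b‖ ^ 2 ≤ 2 * ‖a‖ ^ 2 + 2 * ‖b‖ ^ 2 :=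
  (pow_le_pow_left₀ (norm_nonneg _) (norm_add_le a b) 2).trans (sq_add_le_two _ _)

theorem integral_norm_sq_add_le {G : Type*} [NormedAddCommGroup G] {μ : Measure (Euc d)}
    {f g : Euc d → G} (hf : MemLp f 2 μ) (hg : MemLp g 2 μ) :
    ∫ x, ‖f x + g x‖ ^ 2 ∂μ ≤ 2 * ∫ x, ‖f x‖ ^ 2 ∂μ + 2 * ∫ x, ‖g x‖ ^ 2 ∂μ := by
  have i1 := hf.integrable_norm_pow (p := 2) (by norm_num)
  have i2 := hg.integrable_norm_pow (p := 2) (by norm_num)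
  have i3 := (hf.add hg).integrable_norm_pow (p := 2) (by norm_num)
  rw [← integral_const_mul, ← integral_const_mul, ← integral_add (i1.const_mul 2) (i2.const_mul 2)]
  exact integral_mono i3 ((i1.const_mul 2).add (i2.const_mul 2)) fun x => norm_add_sq_le_two _ _

/-- Perturbing a polynomial changes the squared error in a controlled way. -/
theorem polySq_add_le {u q e : Euc d → ℝ} (hε : 0 ≤ ε) (hu : MemH1 T.domain u)
    (hK : K ∈ T.elements) (hq : IsPolyFun ℓ q) (he : IsPolyFun ℓ e) :
    T.polySq ε u (fun x => q x + e x) K ≤ 2 * T.polySq ε u q K +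
      2 * ((∫ x in simplexHull K, e x ^ 2) + ε * ∫ x in simplexHull K, ‖gradient e x‖ ^ 2) := by
  have h1 := memLp_element hu.1 hK
  have h2 := memLp_element (hu.memLp_weakGradient T.isOpen_domain) hK
  have hg : ∀ x, gradient (fun x => q x + e x) x = gradient q x + gradient e x := fun x =>
    HasGradientAt.gradient (by
      rw [hasGradientAt_iff_hasFDerivAt, map_add]
      exact (hq.hasGradientAt x).hasFDerivAt.add (he.hasGradientAt x).hasFDerivAt)
  have e1 := integral_norm_sq_add_le (h1.sub (memLp_of_continuous hq.continuous K))
    (memLp_of_continuous he.continuous K).neg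
  have e2 := integral_norm_sq_add_le (h2.sub (memLp_of_continuous hq.continuous_gradient K))
    (memLp_of_continuous he.continuous_gradient K).neg
  simp only [Pi.sub_apply, Pi.neg_apply, norm_neg, Real.norm_eq_abs, sq_abs, ← sub_eq_add_neg]
    at e1 e2
  simp only [polySq, hg, ← sub_sub]
  nlinarith [mul_le_mul_of_nonneg_left e2 hε]

/-- The squared reaction-diffusion norm of a combination of Lagrange polynomials. -/
theorem _root_.IsSimplex.lagrange_combination_le (hK : IsSimplex K) (hd : 1 ≤ d) (hℓ : 1 ≤ ℓ)
    (hε : 0 ≤ ε) (J : (Euc d →₀ ℕ) → ℝ) :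
    (∫ x in simplexHull K, (∑ α ∈ latticeIndices ℓ K, J α * lagrangeFun ℓ K α x) ^ 2) +
      ε * ∫ x in simplexHull K,
        ‖gradient (fun x => ∑ α ∈ latticeIndices ℓ K, J α * lagrangeFun ℓ K α x) x‖ ^ 2 ≤
    latticeCard d ℓ * (IsSimplex.lagrangeBound d ℓ ^ 2 +
      (IsSimplex.polyLip d ℓ * IsSimplex.lagrangeBound d ℓ) ^ 2) *
      ∑ α ∈ latticeIndices ℓ K, simplexVol K * (1 + ε / inscribedDiam K ^ 2) * J α ^ 2 := by
  set s := latticeIndices ℓ K with hs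
  set Lb := IsSimplex.lagrangeBound d ℓ
  set Lg := IsSimplex.polyLip d ℓ * Lb with hLg
  set ρ := inscribedDiam K
  have hρ : 0 < ρ := hK.inscribedDiam_pos hd
  set N : ℝ := ((latticeCard d ℓ : ℕ) : ℝ) with hN
  set S := ∑ α ∈ s, J α ^ 2 with hS
  have hS0 : 0 ≤ S := Finset.sum_nonneg fun _ _ => sq_nonneg _
  have hcard : (s.card : ℝ) = N := by rw [hs, hK.card_latticeIndices]
  have hN0 : 0 ≤ N := by positivity
  have hv := hK.simplexVol_pos
  have hm := IsSimplex.measurableSet_simplexHull K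
  have hfin : volume (simplexHull K) ≠ ⊤ := (IsSimplex.volume_simplexHull_lt_top K).ne
  have hφ : ∀ α ∈ s, IsPolyFun ℓ (lagrangeFun ℓ K α) := fun α hα =>
    IsSimplex.isPolyFun_lagrangeFun hα
  have hpoly : IsPolyFun ℓ fun x => ∑ α ∈ s, J α * lagrangeFun ℓ K α x :=
    IsPolyFun.sum fun α hα => (hφ α hα).const_mul _
  have b1 : ∀ x ∈ simplexHull K, (∑ α ∈ s, J α * lagrangeFun ℓ K α x) ^ 2 ≤ N * Lb ^ 2 * S := by
    intro x hx
    refine (sq_sum_le_card_mul_sum_sq).trans ?_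
    rw [hcard, mul_assoc, hS, Finset.mul_sum s _ (Lb ^ 2)]
    refine mul_le_mul_of_nonneg_left (Finset.sum_le_sum fun α hα => ?_) hN0
    rw [mul_pow, mul_comm]
    refine mul_le_mul_of_nonneg_right ?_ (sq_nonneg _)
    rw [← sq_abs]
    exact pow_le_pow_left₀ (abs_nonneg _) (hK.abs_lagrangeFun_le hℓ hα hx) 2
  have hgrad : ∀ x, gradient (fun x => ∑ α ∈ s, J α * lagrangeFun ℓ K α x) x =
      ∑ α ∈ s, J α • gradient (lagrangeFun ℓ K α) x := fun x =>
    HasGradientAt.gradient (by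
      rw [hasGradientAt_iff_hasFDerivAt, map_sum]
      refine HasFDerivAt.fun_sum fun α hα => ?_
      rw [map_smul]
      exact ((hφ α hα).hasGradientAt x).hasFDerivAt.const_mul (J α))
  have b2 : ∀ x ∈ simplexHull K,
      ‖gradient (fun x => ∑ α ∈ s, J α * lagrangeFun ℓ K α x) x‖ ^ 2 ≤
        N * (Lg / ρ) ^ 2 * S := by
    intro x hx
    rw [hgrad]
    refine (pow_le_pow_left₀ (norm_nonneg _) (norm_sum_le _ _) 2).trans
      ((sq_sum_le_card_mul_sum_sq).trans ?_)
    rw [hcard, mul_assoc, hS, Finset.mul_sum s _ ((Lg / ρ) ^ 2)]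
    refine mul_le_mul_of_nonneg_left (Finset.sum_le_sum fun α hα => ?_) hN0
    rw [norm_smul, mul_pow, mul_comm, Real.norm_eq_abs, sq_abs]
    refine mul_le_mul_of_nonneg_right ?_ (sq_nonneg _)
    exact pow_le_pow_left₀ (norm_nonneg _) (hK.norm_gradient_lagrangeFun_le hd hℓ hα hx) 2
  have c1 : ∫ x in simplexHull K, (∑ α ∈ s, J α * lagrangeFun ℓ K α x) ^ 2 ≤
      simplexVol K * (N * Lb ^ 2 * S) := by
    refine (setIntegral_mono_on ((hpoly.continuous.pow 2).continuousOn.integrableOn_compact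
      (IsSimplex.isCompact_simplexHull K)) (integrableOn_const hfin) hm b1).trans_eq ?_
    rw [setIntegral_const, smul_eq_mul]; rfl
  have c2 : ∫ x in simplexHull K,
        ‖gradient (fun x => ∑ α ∈ s, J α * lagrangeFun ℓ K α x) x‖ ^ 2 ≤
      simplexVol K * (N * (Lg / ρ) ^ 2 * S) := by
    refine (setIntegral_mono_on
      ((hpoly.continuous_gradient.norm.pow 2).continuousOn.integrableOn_compact
      (IsSimplex.isCompact_simplexHull K)) (integrableOn_const hfin) hm b2).trans_eq ?_
    rw [setIntegral_const, smul_eq_mul]; rfl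
  rw [← Finset.mul_sum, ← hS]
  have hpos : 0 ≤ simplexVol K * N * S := by positivity
  have hx : 0 ≤ ε / ρ ^ 2 := by positivity
  calc _ ≤ simplexVol K * (N * Lb ^ 2 * S) + ε * (simplexVol K * (N * (Lg / ρ) ^ 2 * S)) := by
        gcongr
    _ = simplexVol K * N * S * (Lb ^ 2 + Lg ^ 2 * (ε / ρ ^ 2)) := by field_simp
    _ ≤ simplexVol K * N * S * ((Lb ^ 2 + Lg ^ 2) * (1 + ε / ρ ^ 2)) := by
        refine mul_le_mul_of_nonneg_left ?_ hpos
        nlinarith [sq_nonneg Lb, sq_nonneg Lg]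
    _ = _ := by ring

/-! ### Summation over patches and along paths of elements. -/

variable (T) in
/-- The sum of the squared errors on the pairs associated with the interior faces of an element. -/
noncomputable def patchSq (ε : ℝ) (u : Euc d → ℝ) (P : Finset (Euc d) → Euc d → ℝ)
    (K : Finset (Euc d)) : ℝ :=
  ∑ F ∈ T.facesOf K, rdNorm T.domain ε (T.pair F) (u - P F) ^ 2

theorem patchSq_nonneg (u : Euc d → ℝ) (P : Finset (Euc d) → Euc d → ℝ) (K : Finset (Euc d)) :
    0 ≤ T.patchSq ε u P K := Finset.sum_nonneg fun _ _ => sq_nonneg _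

/-- The elements with a given face all contain a vertex of it, so there are at most n̄ of them. -/
theorem sum_patchSq_le (hd : 1 ≤ d) (hℓ : 1 ≤ ℓ) {n : ℕ} (hn : T.nBar ℓ ≤ n) (u : Euc d → ℝ)
    (P : Finset (Euc d) → Euc d → ℝ) :
    ∑ K ∈ T.elements, T.patchSq ε u P K ≤
      n * ∑ F ∈ T.interiorFaces, rdNorm T.domain ε (T.pair F) (u - P F) ^ 2 := by
  simp only [patchSq]
  rw [Finset.sum_comm' (t' := T.interiorFaces) (s' := fun F => T.elementsOf F) fun K F => by
    rw [mem_elementsOf, mem_facesOf]; tauto, Finset.mul_sum]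
  refine Finset.sum_le_sum fun F hF => ?_
  rw [Finset.sum_const, nsmul_eq_mul]
  refine mul_le_mul_of_nonneg_right ?_ (sq_nonneg _)
  exact_mod_cast (card_elementsOf_le hd hℓ hF).trans hn

/-- Touching is symmetric, so after exchanging the sums each `X K` is counted once per neighbor of
`K`. -/
theorem sum_neighbors_le (hℓ : 1 ≤ ℓ) {n : ℕ} (hn : T.nBar ℓ ≤ n) {X : Finset (Euc d) → ℝ}
    (hX : ∀ K, 0 ≤ X K) :
    ∑ K ∈ T.elements, ∑ K' ∈ T.neighbors K, X K' ≤ ((d + 1) * n : ℕ) * ∑ K ∈ T.elements, X K := by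
  rw [Finset.sum_comm' (t' := T.elements) (s' := fun K => T.neighbors K) fun K K' => by
    constructor
    · exact fun h => ⟨mem_neighbors_comm h.1 h.2, (mem_neighbors.1 h.2).1⟩
    · exact fun h => ⟨(mem_neighbors.1 h.1).1, mem_neighbors_comm h.2 h.1⟩, Finset.mul_sum]
  refine Finset.sum_le_sum fun K hK => ?_
  rw [Finset.sum_const, nsmul_eq_mul]
  refine mul_le_mul_of_nonneg_right ?_ (hX K)
  exact_mod_cast (card_neighbors_le hℓ hK).trans (Nat.mul_le_mul_left _ hn)

/-- Along a path of elements around a node, jumps across faces add up. -/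
theorem sq_node_sub_le (hfc : T.FaceConnected ℓ) {n : ℕ} (hn : T.nBar ℓ ≤ n)
    {Q : Finset (Euc d) → Euc d → ℝ} {X : Finset (Euc d) → ℝ} (hX : ∀ K, 0 ≤ X K) {W : ℝ}
    (hW : 0 ≤ W) {z : Euc d} (hz : z ∈ T.nodes ℓ) (hK : K ∈ T.elements) (hzK : z ∈ simplexHull K)
    (hjump : ∀ K₁ ∈ T.elements, ∀ K₂ ∈ T.elements, ∀ F ∈ T.interiorFaces, K₁ ≠ K₂ → F ⊆ K₁ →
      F ⊆ K₂ → z ∈ simplexHull F → W * (Q K₁ z - Q K₂ z) ^ 2 ≤ X K₁ + X K₂)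
    {K' : Finset (Euc d)} (hK' : K' ∈ T.elements) (hzK' : z ∈ simplexHull K') :
    W * (Q K' z - Q K z) ^ 2 ≤ 2 * n * ∑ K'' ∈ T.neighbors K, X K'' := by
  classical
  obtain ⟨m, path, hmem, hinj, h0, hl, hstep⟩ := hfc z hz K hK K' hK' hzK hzK'
  set S := ∑ K'' ∈ T.neighbors K, X K'' with hS
  have hS0 : 0 ≤ S := Finset.sum_nonneg fun _ _ => hX _
  have hzpath : ∀ j, z ∈ simplexHull (path j) := by
    intro j
    rcases Fin.eq_castSucc_or_eq_last j with ⟨i, rfl⟩ | rfl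
    · obtain ⟨F, hF, hzF, hcap⟩ := hstep i
      exact (hcap.symm.subset hzF).1
    · rw [hl]; exact hzK'
  -- The path visits m + 1 different elements, all containing `z`.
  have hmn : (m : ℝ) ≤ n := by
    have : Finset.univ.image path ⊆ T.elementsAt z := by
      intro K'' h
      obtain ⟨j, -, rfl⟩ := Finset.mem_image.1 h
      exact mem_elementsAt.2 ⟨hmem j, hzpath j⟩
    have h2 := (Finset.card_le_card this).trans ((card_elementsAt_le hz).trans hn)
    rw [Finset.card_image_of_injective _ hinj, Finset.card_univ, Fintype.card_fin] at h2
    exact_mod_cast (by omega : m ≤ n)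
  -- Injectivity of the path prevents repeated terms, so either endpoint family is dominated by the
  -- sum over the neighbors of `K`.
  have hsub : ∀ g : Fin m → Fin (m + 1), Function.Injective g →
      ∑ j, X (path (g j)) ≤ S := by
    intro g hg
    rw [← Finset.sum_image (f := X) (g := fun j => path (g j))
      fun i _ j _ h => hg (hinj h)]
    refine Finset.sum_le_sum_of_subset_of_nonneg (fun K'' h => ?_) fun _ _ _ => hX _
    obtain ⟨j, -, rfl⟩ := Finset.mem_image.1 h
    exact mem_neighbors_of_mem (hmem _) hzK (hzpath _)
  have htel := Fin.sq_sub_le_mul_sum fun j => Q (path j) z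
  simp only [h0, hl] at htel
  calc W * (Q K' z - Q K z) ^ 2
      ≤ W * (m * ∑ j : Fin m, (Q (path j.castSucc) z - Q (path j.succ) z) ^ 2) := by gcongr
    _ = m * ∑ j : Fin m, W * (Q (path j.castSucc) z - Q (path j.succ) z) ^ 2 := by
        rw [← Finset.mul_sum]; ring
    _ ≤ m * ∑ j : Fin m, (X (path j.castSucc) + X (path j.succ)) := by
        gcongr with j
        obtain ⟨F, hF, hzF, hcap⟩ := hstep j
        obtain ⟨hF1, hF2⟩ := face_subset (hmem _) (hmem _) hF hcap
        exact hjump _ (hmem _) _ (hmem _) F hF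
          (fun h => (Fin.castSucc_lt_succ (i := j)).ne (hinj h)) hF1 hF2 hzF
    _ ≤ n * (2 * S) := by
        rw [Finset.sum_add_distrib]
        have a1 := hsub _ (Fin.castSucc_injective m)
        have a2 := hsub _ (Fin.succ_injective m)
        have a3 : 0 ≤ ∑ j : Fin m, X (path j.castSucc) := Finset.sum_nonneg fun _ _ => hX _
        have a4 : 0 ≤ ∑ j : Fin m, X (path j.succ) := Finset.sum_nonneg fun _ _ => hX _
        exact mul_le_mul hmn (by linarith) (by linarith) (by positivity)
    _ = 2 * n * S := by ring

/-- The constant in the localization estimate. -/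
noncomputable def localizationConst (d ℓ n : ℕ) (A B : ℝ) : ℝ :=
  (2 * A + 2 * (latticeCard d ℓ * (IsSimplex.lagrangeBound d ℓ ^ 2 +
    (IsSimplex.polyLip d ℓ * IsSimplex.lagrangeBound d ℓ) ^ 2) *
      (latticeCard d ℓ * (2 * n * B))) * ((d + 1) * n : ℕ)) * n

/-- The common core of both regimes. `P` are arbitrary approximations on pairs and `Q` elementwise
polynomials made from them; `hA` measures the quality of `Q`, `hB` its jumps. The weight in `hB` is,
up to a constant, a bound for the squared norm of a Lagrange polynomial on `K`, so that averaging
`Q` into a continuous function costs only the jumps. -/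
theorem bestError_sq_le (hd : 1 ≤ d) (hℓ : 1 ≤ ℓ) (hfc : T.FaceConnected ℓ) {n : ℕ}
    (hn : T.nBar ℓ ≤ n) (hε : 0 ≤ ε) {u : Euc d → ℝ} (hu : MemH1 T.domain u)
    (P : Finset (Euc d) → Euc d → ℝ) {Q : Finset (Euc d) → Euc d → ℝ}
    (hQ : ∀ K ∈ T.elements, IsPolyFun ℓ (Q K)) {A B : ℝ} (hA0 : 0 ≤ A) (hB0 : 0 ≤ B)
    (hA : ∀ K ∈ T.elements, T.polySq ε u (Q K) K ≤ A * T.patchSq ε u P K)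
    (hB : ∀ K ∈ T.elements, ∀ K₁ ∈ T.elements, ∀ K₂ ∈ T.elements, ∀ F ∈ T.interiorFaces, K₁ ≠ K₂ →
      F ⊆ K₁ → F ⊆ K₂ → ∀ z ∈ simplexHull F, z ∈ simplexHull K →
      simplexVol K * (1 + ε / inscribedDiam K ^ 2) * (Q K₁ z - Q K₂ z) ^ 2 ≤
        B * (T.patchSq ε u P K₁ + T.patchSq ε u P K₂)) :
    T.bestError ℓ ε T.domain u ^ 2 ≤ localizationConst d ℓ n A B *
      ∑ F ∈ T.interiorFaces, rdNorm T.domain ε (T.pair F) (u - P F) ^ 2 := by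
  classical
  -- One home element is chosen per index, independently of `K`, so the nodal values define a
  -- continuous function. The empty set is a dummy for indices that belong to no element.
  have hex : ∀ α : Euc d →₀ ℕ, ∃ K', (∃ K ∈ T.elements, α ∈ latticeIndices ℓ K) →
      K' ∈ T.elements ∧ α ∈ latticeIndices ℓ K' := by
    intro α
    by_cases h : ∃ K ∈ T.elements, α ∈ latticeIndices ℓ K
    · exact ⟨h.choose, fun _ => h.choose_spec⟩
    · exact ⟨∅, fun h' => absurd h' h⟩
  choose home hhome using hex
  set c : (Euc d →₀ ℕ) → ℝ := fun α => Q (home α) (latticePoint ℓ α) with hc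
  obtain ⟨v, hv, hvK⟩ := exists_feSpace_interpolant (T := T) (ℓ := ℓ) c
  set N : ℝ := ((latticeCard d ℓ : ℕ) : ℝ) with hN
  set D := N * (IsSimplex.lagrangeBound d ℓ ^ 2 +
    (IsSimplex.polyLip d ℓ * IsSimplex.lagrangeBound d ℓ) ^ 2) with hD
  have hD0 : 0 ≤ D := by positivity
  have hX : ∀ K, 0 ≤ T.patchSq ε u P K := fun K => patchSq_nonneg u P K
  have helem : ∀ K ∈ T.elements, T.elemSq ε (u - v) K ≤ 2 * A * T.patchSq ε u P K +
      2 * (D * (N * (2 * n * B))) * ∑ K' ∈ T.neighbors K, T.patchSq ε u P K' := by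
    intro K hK
    have hs := T.isSimplex hK
    -- By Lagrange interpolation, v - Q_K is on `K` the combination with these nodal differences as
    -- coefficients.
    set J : (Euc d →₀ ℕ) → ℝ := fun α => c α - Q K (latticePoint ℓ α) with hJ
    have hepoly : IsPolyFun ℓ fun x => ∑ α ∈ latticeIndices ℓ K, J α * lagrangeFun ℓ K α x :=
      IsPolyFun.sum fun α hα => (IsSimplex.isPolyFun_lagrangeFun hα).const_mul _
    have hvq : EqOn v (fun x => Q K x + ∑ α ∈ latticeIndices ℓ K, J α * lagrangeFun ℓ K α x)
        (simplexHull K) := by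
      intro x hx
      rw [hvK K hK hx]
      simp only
      rw [hs.eq_sum_lagrangeFun hℓ (hQ K hK) x, ← Finset.sum_add_distrib]
      refine Finset.sum_congr rfl fun α _ => ?_
      rw [hJ]; ring
    rw [elemSq_sub_eq hu hv hK ((hQ K hK).add hepoly) hvq]
    refine (polySq_add_le hε hu hK (hQ K hK) hepoly).trans ?_
    have h1 := hs.lagrange_combination_le hd hℓ hε J
    have h2 : ∀ α ∈ latticeIndices ℓ K,
        simplexVol K * (1 + ε / inscribedDiam K ^ 2) * J α ^ 2 ≤
          2 * n * B * ∑ K' ∈ T.neighbors K, T.patchSq ε u P K' := by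
      intro α hα
      have hh := hhome α ⟨K, hK, hα⟩
      have hW : 0 ≤ simplexVol K * (1 + ε / inscribedDiam K ^ 2) := by
        have := hs.simplexVol_pos
        positivity
      have hzK := IsSimplex.latticePoint_mem hℓ hα
      have := sq_node_sub_le hfc hn (Q := Q) (X := fun K => B * T.patchSq ε u P K)
        (fun K => mul_nonneg hB0 (hX K)) hW (latticePoint_mem_nodes hK hα) hK hzK
        (fun K₁ h₁ K₂ h₂ F hF hne hF1 hF2 hz => by
          rw [← mul_add]; exact hB K hK K₁ h₁ K₂ h₂ F hF hne hF1 hF2 _ hz hzK) hh.1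
        (IsSimplex.latticePoint_mem hℓ hh.2)
      rw [← Finset.mul_sum] at this
      rw [hJ, hc]
      simp only
      linarith
    have h3 := Finset.sum_le_card_nsmul _ _ _ h2
    rw [hs.card_latticeIndices, nsmul_eq_mul] at h3
    have h4 := hA K hK
    have h5 := mul_le_mul_of_nonneg_left h3 hD0
    linarith
  have hw := hu.sub (memH1_feSpace hv)
  calc T.bestError ℓ ε T.domain u ^ 2 ≤ rdNorm T.domain ε T.domain (u - v) ^ 2 :=
        pow_le_pow_left₀ (bestError_nonneg _ _) (bestError_le _ _ hv) 2
    _ = ∑ K ∈ T.elements, T.elemSq ε (u - v) K := rdNorm_sq_domain hε hw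
    _ ≤ ∑ K ∈ T.elements, (2 * A * T.patchSq ε u P K +
          2 * (D * (N * (2 * n * B))) * ∑ K' ∈ T.neighbors K, T.patchSq ε u P K') :=
        Finset.sum_le_sum helem
    _ = 2 * A * ∑ K ∈ T.elements, T.patchSq ε u P K + 2 * (D * (N * (2 * n * B))) *
          ∑ K ∈ T.elements, ∑ K' ∈ T.neighbors K, T.patchSq ε u P K' := by
        rw [Finset.sum_add_distrib, Finset.mul_sum, Finset.mul_sum]
    _ ≤ 2 * A * ∑ K ∈ T.elements, T.patchSq ε u P K + 2 * (D * (N * (2 * n * B))) *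
          (((d + 1) * n : ℕ) * ∑ K ∈ T.elements, T.patchSq ε u P K) := by
        gcongr
        exact sum_neighbors_le hℓ hn hX
    _ = (2 * A + 2 * (D * (N * (2 * n * B))) * ((d + 1) * n : ℕ)) *
          ∑ K ∈ T.elements, T.patchSq ε u P K := by ring
    _ ≤ (2 * A + 2 * (D * (N * (2 * n * B))) * ((d + 1) * n : ℕ)) *
          (n * ∑ F ∈ T.interiorFaces, rdNorm T.domain ε (T.pair F) (u - P F) ^ 2) := by
        gcongr
        exact sum_patchSq_le hd hℓ hn u P
    _ = _ := by rw [localizationConst, ← mul_assoc]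

/-- From arbitrary approximations on pairs to the best ones. -/
theorem bestError_le_of_forall {u : Euc d → ℝ} {C : ℝ} (hC : 0 ≤ C)
    (h : ∀ P : Finset (Euc d) → Euc d → ℝ, (∀ F, P F ∈ T.feSpace ℓ) →
      T.bestError ℓ ε T.domain u ^ 2 ≤ C *
        ∑ F ∈ T.interiorFaces, rdNorm T.domain ε (T.pair F) (u - P F) ^ 2) :
    T.bestError ℓ ε T.domain u ≤ Real.sqrt C * T.pairError ℓ ε u := by
  rw [pairError, ← Real.sqrt_mul hC]
  refine Real.le_sqrt_of_sq_le ?_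
  -- The infima on the pairs need not be attained, so approximations within δ are used and δ tends
  -- to zero.
  have hδ : ∀ δ : ℝ, 0 < δ → T.bestError ℓ ε T.domain u ^ 2 ≤ C *
      ∑ F ∈ T.interiorFaces, (T.bestError ℓ ε (T.pair F) u + δ) ^ 2 := by
    intro δ hδ
    have : ∀ F : Finset (Euc d), ∃ v ∈ T.feSpace ℓ,
        rdNorm T.domain ε (T.pair F) (u - v) < T.bestError ℓ ε (T.pair F) u + δ := by
      intro F
      obtain ⟨v, hv⟩ := exists_lt_of_ciInf_lt
        (show (⨅ v : T.feSpace ℓ, rdNorm T.domain ε (T.pair F) (u - (v : Euc d → ℝ))) <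
          T.bestError ℓ ε (T.pair F) u + δ from lt_add_of_pos_right _ hδ)
      exact ⟨v, v.2, hv⟩
    choose P hP hlt using this
    refine (h P hP).trans ?_
    gcongr with F hF
    · exact rdNorm_nonneg _ _ _ _
    · exact (hlt F).le
  have hlim : Filter.Tendsto (fun δ : ℝ => C * ∑ F ∈ T.interiorFaces,
      (T.bestError ℓ ε (T.pair F) u + δ) ^ 2) (nhdsWithin 0 (Ioi 0))
      (nhds (C * ∑ F ∈ T.interiorFaces, (T.bestError ℓ ε (T.pair F) u + 0) ^ 2)) := by
    have : Continuous fun δ : ℝ => C * ∑ F ∈ T.interiorFaces,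
      (T.bestError ℓ ε (T.pair F) u + δ) ^ 2 := by fun_prop
    exact (this.tendsto 0).mono_left nhdsWithin_le_nhds
  simp only [add_zero] at hlim
  exact ge_of_tendsto hlim (eventually_nhdsWithin_of_forall hδ)

end SimplicialMesh

/-! ## Jumps of local approximations -/

namespace SimplicialMesh

variable {d ℓ : ℕ} {T : SimplicialMesh d} {K K₁ K₂ F : Finset (Euc d)} {ε : ℝ} {u : Euc d → ℝ}
  {P : Finset (Euc d) → Euc d → ℝ}

open Classical in
/-- A polynomial of degree at most `ℓ` agreeing with `v` on `K`. -/
noncomputable def piece (ℓ : ℕ) (v : Euc d → ℝ) (K : Finset (Euc d)) : Euc d → ℝ :=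
  if h : ∃ p, IsPolyFun ℓ p ∧ EqOn v p (simplexHull K) then h.choose else 0

theorem piece_spec {v : Euc d → ℝ} (hv : v ∈ T.feSpace ℓ) (hK : K ∈ T.elements) :
    IsPolyFun ℓ (piece ℓ v K) ∧ EqOn v (piece ℓ v K) (simplexHull K) := by
  have h := mem_feSpace_iff.1 hv K hK
  rw [piece, dif_pos h]
  exact h.choose_spec

theorem elemSq_eq_polySq_piece {v : Euc d → ℝ} (hu : MemH1 T.domain u) (hv : v ∈ T.feSpace ℓ)
    (hK : K ∈ T.elements) : T.elemSq ε (u - v) K = T.polySq ε u (piece ℓ v K) K :=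
  elemSq_sub_eq hu hv hK (piece_spec hv hK).1 (piece_spec hv hK).2

theorem sum_elemSq_le_patchSq (hε : 0 ≤ ε) (hu : MemH1 T.domain u)
    (hP : ∀ F, P F ∈ T.feSpace ℓ) (hF : F ∈ T.facesOf K) :
    ∑ K' ∈ T.elementsOf F, T.elemSq ε (u - P F) K' ≤ T.patchSq ε u P K := by
  rw [← rdNorm_sq_pair hε (hu.sub (memH1_feSpace (hP F)))]
  exact Finset.single_le_sum
    (f := fun F => rdNorm T.domain ε (T.pair F) (u - P F) ^ 2) (fun _ _ => sq_nonneg _) hF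

theorem elemSq_le_patchSq (hε : 0 ≤ ε) (hu : MemH1 T.domain u) (hP : ∀ F, P F ∈ T.feSpace ℓ)
    (hK : K ∈ T.elements) (hF : F ∈ T.facesOf K) :
    T.elemSq ε (u - P F) K ≤ T.patchSq ε u P K :=
  (Finset.single_le_sum (fun K' _ => elemSq_nonneg hε (u - P F) K')
    (mem_elementsOf.2 ⟨hK, (mem_facesOf.1 hF).2⟩)).trans (sum_elemSq_le_patchSq hε hu hP hF)

theorem polySq_piece_le_patchSq (hε : 0 ≤ ε) (hu : MemH1 T.domain u)
    (hP : ∀ F, P F ∈ T.feSpace ℓ) (hK : K ∈ T.elements) (hF : F ∈ T.facesOf K) :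
    T.polySq ε u (piece ℓ (P F) K) K ≤ T.patchSq ε u P K := by
  rw [← elemSq_eq_polySq_piece hu (hP F) hK]
  exact elemSq_le_patchSq hε hu hP hK hF

theorem integral_sq_le_polySq (hε : 0 ≤ ε) (u q : Euc d → ℝ) (K : Finset (Euc d)) :
    ∫ x in simplexHull K, (u x - q x) ^ 2 ≤ T.polySq ε u q K :=
  le_add_of_nonneg_right (mul_nonneg hε (integral_nonneg fun _ => sq_nonneg _))

theorem integral_sq_gradient_le_polySq (u q : Euc d → ℝ) (K : Finset (Euc d)) :
    ε * ∫ x in simplexHull K, ‖weakGradient T.domain u x - gradient q x‖ ^ 2 ≤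
      T.polySq ε u q K :=
  le_add_of_nonneg_left (integral_nonneg fun _ => sq_nonneg _)

/-- The distance of two polynomials at a point in terms of their errors. -/
theorem sq_poly_sub_le_polySq (hℓ : 1 ≤ ℓ) (hε : 0 ≤ ε) (hu : MemH1 T.domain u)
    (hK : K ∈ T.elements) {p q : Euc d → ℝ} (hp : IsPolyFun ℓ p) (hq : IsPolyFun ℓ q) {z : Euc d}
    (hz : z ∈ simplexHull K) :
    simplexVol K * (p z - q z) ^ 2 ≤ IsSimplex.invConst d ℓ *
      (2 * T.polySq ε u p K + 2 * T.polySq ε u q K) := by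
  have hs := T.isSimplex hK
  have hv := hs.simplexVol_pos
  have h1 := hs.sq_poly_le hℓ (hp.sub hq) hz
  have h2 := memLp_element hu.1 hK
  have h3 := integral_norm_sq_add_le (h2.sub (memLp_of_continuous hq.continuous K))
    (h2.sub (memLp_of_continuous hp.continuous K)).neg
  simp only [Pi.sub_apply, Pi.neg_apply, Real.norm_eq_abs, sq_abs, neg_sub,
    sub_add_sub_cancel', fun x => sub_sq_comm (p x) (u x)] at h3
  have h4 := integral_sq_le_polySq (T := T) hε u p K
  have h5 := integral_sq_le_polySq (T := T) hε u q K
  have hc := IsSimplex.invConst_pos d ℓ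
  rw [div_mul_eq_mul_div, le_div_iff₀ hv, mul_comm] at h1
  refine h1.trans (mul_le_mul_of_nonneg_left ?_ hc.le)
  linarith

/-- The jump between the approximations on adjacent elements in terms of the errors. -/
theorem sq_jump_le (hℓ : 1 ≤ ℓ) (hε : 0 ≤ ε) (hu : MemH1 T.domain u)
    (hP : ∀ F, P F ∈ T.feSpace ℓ) {Q : Finset (Euc d) → Euc d → ℝ}
    (hQ : ∀ K ∈ T.elements, IsPolyFun ℓ (Q K)) {A : ℝ}
    (hA : ∀ K ∈ T.elements, T.polySq ε u (Q K) K ≤ A * T.patchSq ε u P K)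
    (hK₁ : K₁ ∈ T.elements) (hK₂ : K₂ ∈ T.elements) (hF : F ∈ T.interiorFaces) (hF₁ : F ⊆ K₁)
    (hF₂ : F ⊆ K₂) {z : Euc d} (hz : z ∈ simplexHull F) {V : ℝ} (hV : 0 ≤ V)
    (hV₁ : V ≤ simplexVol K₁) (hV₂ : V ≤ simplexVol K₂) :
    V * (Q K₁ z - Q K₂ z) ^ 2 ≤
      4 * (A + 1) * IsSimplex.invConst d ℓ * (T.patchSq ε u P K₁ + T.patchSq ε u P K₂) := by
  -- `P F z` is the same number seen from both elements, so it can be inserted between the two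
  -- values. On each side two polynomials on one element are compared, both close to `u` there.
  have key : ∀ K ∈ T.elements, F ⊆ K → V ≤ simplexVol K → V * (Q K z - P F z) ^ 2 ≤
      2 * (A + 1) * IsSimplex.invConst d ℓ * T.patchSq ε u P K := by
    intro K hK hFK hVK
    have hzK : z ∈ simplexHull K := convexHull_mono (by exact_mod_cast hFK) hz
    obtain ⟨h1, h2⟩ := piece_spec (hP F) hK
    rw [h2 hzK]
    have h3 := sq_poly_sub_le_polySq hℓ hε hu hK (hQ K hK) h1 hzK
    have h4 := polySq_piece_le_patchSq hε hu hP hK (mem_facesOf.2 ⟨hF, hFK⟩)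
    have h5 := hA K hK
    have hc := IsSimplex.invConst_pos d ℓ
    calc _ ≤ simplexVol K * (Q K z - piece ℓ (P F) K z) ^ 2 := by gcongr
      _ ≤ _ := h3
      _ ≤ IsSimplex.invConst d ℓ * (2 * (A * T.patchSq ε u P K) + 2 * T.patchSq ε u P K) := by
          gcongr
      _ = _ := by ring
  have h1 := key K₁ hK₁ hF₁ hV₁
  have h2 := key K₂ hK₂ hF₂ hV₂
  calc V * (Q K₁ z - Q K₂ z) ^ 2 = V * ((Q K₁ z - P F z) + -(Q K₂ z - P F z)) ^ 2 := by ring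
    _ ≤ V * (2 * (Q K₁ z - P F z) ^ 2 + 2 * (-(Q K₂ z - P F z)) ^ 2) := by
        gcongr; exact sq_add_le_two _ _
    _ = 2 * (V * (Q K₁ z - P F z) ^ 2) + 2 * (V * (Q K₂ z - P F z) ^ 2) := by ring
    _ ≤ _ := by linarith

theorem mu_sq_pos (hK : K ∈ T.elements) {μ : ℝ} (hμ : T.mu ≤ μ) : 0 < μ ^ 2 := by
  have hv := (T.isSimplex hK).simplexVol_pos
  obtain ⟨x, hx⟩ := (T.isSimplex hK).interior_nonempty
  have hx := interior_subset hx
  have := simplexVol_le hK (mem_neighbors_of_mem hK hx hx) hμ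
  nlinarith [sq_nonneg μ]

/-- If `ε` is small relative to the size of the elements, the localization constant does not depend
on the shape parameter. -/
theorem exists_localization_of_small (hd : 1 ≤ d) (hℓ : 1 ≤ ℓ) (n : ℕ) (μ κ : ℝ) :
    ∃ C : ℝ, 0 < C ∧ ∀ T : SimplicialMesh d, 2 ≤ T.elements.card → IsConnected T.domain →
      T.FaceConnected ℓ → T.nBar ℓ ≤ n → T.mu ≤ μ → ∀ ε : ℝ, 0 < ε →
      (∀ K ∈ T.elements, ε ≤ κ * inscribedDiam K ^ 2) → ∀ u, MemH1 T.domain u →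
      T.bestError ℓ ε T.domain u ≤ C * T.pairError ℓ ε u := by
  set B : ℝ := (1 + |κ|) * μ ^ 2 * (4 * (1 + 1) * IsSimplex.invConst d ℓ) with hB
  have hinv := IsSimplex.invConst_pos d ℓ
  have hB0 : 0 ≤ B := by positivity
  -- The summand one only makes the constant positive.
  refine ⟨Real.sqrt (localizationConst d ℓ n 1 B) + 1, by positivity, ?_⟩
  intro T hT hΩ hfc hn hμ ε hε hκ u hu
  have hface : ∀ K, ∃ F, K ∈ T.elements → F ∈ T.facesOf K := by
    intro K
    by_cases hK : K ∈ T.elements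
    · obtain ⟨F, hF⟩ := facesOf_nonempty hℓ hT hΩ hfc hK
      exact ⟨F, fun _ => hF⟩
    · exact ⟨∅, fun h => absurd h hK⟩
  choose f hf using hface
  have hC0 : 0 ≤ localizationConst d ℓ n 1 B := by unfold localizationConst; positivity
  refine (bestError_le_of_forall hC0 fun P hP => ?_).trans
    (mul_le_mul_of_nonneg_right (by linarith) (Real.sqrt_nonneg _))
  -- `A = 1`, since Q_K is the restriction of one of the pair approximations, with no correction.
  have hA : ∀ K ∈ T.elements, T.polySq ε u (piece ℓ (P (f K)) K) K ≤ 1 * T.patchSq ε u P K :=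
    fun K hK => by
      rw [one_mul]; exact polySq_piece_le_patchSq hε.le hu hP hK (hf K hK)
  refine bestError_sq_le hd hℓ hfc hn hε.le hu P (Q := fun K => piece ℓ (P (f K)) K)
    (fun K hK => (piece_spec (hP _) hK).1) zero_le_one hB0 hA ?_
  intro K hK K₁ hK₁ K₂ hK₂ F hF _ hF₁ hF₂ z hz hzK
  have hv := (T.isSimplex hK).simplexVol_pos
  have hρ := (T.isSimplex hK).inscribedDiam_pos hd
  have hμ0 := mu_sq_pos hK hμ
  have hn₁ := mem_neighbors_of_mem hK₁ hzK
    (convexHull_mono (by exact_mod_cast hF₁) hz : z ∈ simplexHull K₁)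
  have hn₂ := mem_neighbors_of_mem hK₂ hzK
    (convexHull_mono (by exact_mod_cast hF₂) hz : z ∈ simplexHull K₂)
  have hj := sq_jump_le hℓ hε.le hu hP (Q := fun K => piece ℓ (P (f K)) K)
    (fun K hK => (piece_spec (hP _) hK).1) hA hK₁ hK₂ hF hF₁ hF₂ hz
    -- This volume lies below those of `K₁` and `K₂`, since both touch `K` at `z`.
    (V := simplexVol K / μ ^ 2) (by positivity)
    ((div_le_iff₀' hμ0).2 (simplexVol_le hK hn₁ hμ))
    ((div_le_iff₀' hμ0).2 (simplexVol_le hK hn₂ hμ))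
  -- Smallness of ε enters only here: the gradient part of the weight is absorbed into the L² part,
  -- so no Poincaré argument and no shape parameter are needed.
  have h1 : 1 + ε / inscribedDiam K ^ 2 ≤ 1 + |κ| := by
    gcongr
    rw [div_le_iff₀ (by positivity)]
    exact (hκ K hK).trans (mul_le_mul_of_nonneg_right (le_abs_self κ) (sq_nonneg _))
  set D := (piece ℓ (P (f K₁)) K₁ z - piece ℓ (P (f K₂)) K₂ z) ^ 2 with hD
  have hD0 : 0 ≤ D := sq_nonneg _
  calc simplexVol K * (1 + ε / inscribedDiam K ^ 2) * D
      ≤ simplexVol K * (1 + |κ|) * D := by gcongr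
    _ = (1 + |κ|) * μ ^ 2 * (simplexVol K / μ ^ 2 * D) := by
        have : μ ≠ 0 := fun h => by simp [h] at hμ0
        field_simp
    _ ≤ (1 + |κ|) * μ ^ 2 * (4 * (1 + 1) * IsSimplex.invConst d ℓ *
          (T.patchSq ε u P K₁ + T.patchSq ε u P K₂)) := by gcongr
    _ = _ := by rw [hB]; ring

end SimplicialMesh

/-! ## Averages of Sobolev functions -/

theorem sq_setIntegral_le {X : Type*} [MeasurableSpace X] {μ : Measure X} {B : Set X}
    (hB : μ B ≠ ⊤) {f : X → ℝ} (hf : MemLp f 2 (μ.restrict B)) :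
    (∫ x in B, f x ∂μ) ^ 2 ≤ μ.real B * ∫ x in B, f x ^ 2 ∂μ := by
  have : IsFiniteMeasure (μ.restrict B) :=
    ⟨by rw [Measure.restrict_apply_univ]; exact hB.lt_top⟩
  have i1 : IntegrableOn f B μ := hf.integrable (by norm_num)
  have i2 : IntegrableOn (fun x => f x ^ 2) B μ := hf.integrable_sq
  set V := μ.real B with hV
  set m := ∫ x in B, f x ∂μ with hm
  rcases eq_or_lt_of_le (measureReal_nonneg : 0 ≤ μ.real B) with h0 | hpos
  · have : μ B = 0 := by
      rcases (ENNReal.toReal_eq_zero_iff _).1 h0.symm with h | h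
      · exact h
      · exact absurd h hB
    rw [hm, setIntegral_measure_zero _ this, hV, ← h0]; simp
  -- The Cauchy–Schwarz inequality as nonnegativity of a variance, multiplied by `V` to avoid
  -- dividing by the measure.
  · have h : 0 ≤ ∫ x in B, (V * f x - m) ^ 2 ∂μ := integral_nonneg fun _ => sq_nonneg _
    have e : ∫ x in B, (V * f x - m) ^ 2 ∂μ = V ^ 2 * ∫ x in B, f x ^ 2 ∂μ - V * m ^ 2 := by
      have : ∀ x, (V * f x - m) ^ 2 = V ^ 2 * f x ^ 2 - 2 * V * m * f x + m ^ 2 := fun x => by ring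
      simp only [this]
      have iA : IntegrableOn (fun x => V ^ 2 * f x ^ 2 - 2 * V * m * f x) B μ :=
        (i2.const_mul _).sub (i1.const_mul _)
      rw [integral_add iA (integrable_const _),
        integral_sub (i2.const_mul _) (i1.const_mul _), integral_const_mul, integral_const_mul,
        setIntegral_const, ← hm, ← hV, smul_eq_mul]
      ring
    rw [e] at h
    have hpos : 0 < V := hpos
    nlinarith

section Averages

variable {d : ℕ}

/-- A smooth bump function of integral one, supported in the closed unit ball. -/
noncomputable def unitBump (d : ℕ) : Euc d → ℝ :=
  (⟨1 / 2, 1, by norm_num, by norm_num⟩ : ContDiffBump (0 : Euc d)).normed volume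

theorem unitBump_nonneg (x : Euc d) : 0 ≤ unitBump d x := ContDiffBump.nonneg_normed _ x

theorem contDiff_unitBump : ContDiff ℝ ∞ (unitBump d) := ContDiffBump.contDiff_normed _

theorem integral_unitBump : ∫ x, unitBump d x = 1 := ContDiffBump.integral_normed _

theorem tsupport_unitBump : tsupport (unitBump d) = Metric.closedBall 0 1 :=
  ContDiffBump.tsupport_normed_eq _

theorem hasCompactSupport_unitBump : HasCompactSupport (unitBump d) :=
  ContDiffBump.hasCompactSupport_normed _

theorem unitBump_eq_zero {x : Euc d} (hx : 1 < ‖x‖) : unitBump d x = 0 := by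
  refine image_eq_zero_of_notMem_tsupport ?_
  rw [tsupport_unitBump, mem_closedBall_zero_iff]
  exact not_le.2 hx

theorem fderiv_unitBump_eq_zero {x : Euc d} (hx : 1 < ‖x‖) : fderiv ℝ (unitBump d) x = 0 := by
  refine image_eq_zero_of_notMem_tsupport fun h => ?_
  have := tsupport_fderiv_subset ℝ h
  rw [tsupport_unitBump, mem_closedBall_zero_iff] at this
  exact not_le.2 hx this

theorem exists_unitBump_bound (d : ℕ) : ∃ M : ℝ, 0 ≤ M ∧ (∀ x, |unitBump d x| ≤ M) ∧
    ∀ x, ‖fderiv ℝ (unitBump d) x‖ ≤ M := by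
  obtain ⟨M₁, h₁⟩ := hasCompactSupport_unitBump.exists_bound_of_continuous
    (contDiff_unitBump (d := d)).continuous
  obtain ⟨M₂, h₂⟩ := (hasCompactSupport_unitBump.fderiv ℝ).exists_bound_of_continuous
    ((contDiff_unitBump (d := d)).continuous_fderiv (by simp))
  exact ⟨max M₁ M₂, (norm_nonneg _).trans ((h₁ 0).trans (le_max_left _ _)),
    fun x => (h₁ x).trans (le_max_left _ _), fun x => (h₂ x).trans (le_max_right _ _)⟩

/-- The bump function of integral one on the ball of radius `r` around `x`. -/
noncomputable def ballBump (x : Euc d) (r : ℝ) (y : Euc d) : ℝ :=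
  (r ^ d)⁻¹ * unitBump d (r⁻¹ • (y - x))

theorem ballBump_nonneg {r : ℝ} (hr : 0 < r) (x y : Euc d) : 0 ≤ ballBump x r y :=
  mul_nonneg (by positivity) (unitBump_nonneg _)

theorem contDiff_ballBump (x : Euc d) (r : ℝ) : ContDiff ℝ ∞ (ballBump x r) :=
  contDiff_const.mul (contDiff_unitBump.comp (by fun_prop))

theorem one_lt_norm_of_notMem {r : ℝ} (hr : 0 < r) {x y : Euc d}
    (h : y ∉ Metric.closedBall x r) : 1 < ‖r⁻¹ • (y - x)‖ := by
  rw [Metric.mem_closedBall, not_le, dist_eq_norm] at h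
  rw [norm_smul, norm_inv, Real.norm_eq_abs, abs_of_pos hr, ← div_eq_inv_mul, lt_div_iff₀ hr]
  linarith

theorem ballBump_eq_zero {r : ℝ} (hr : 0 < r) {x y : Euc d} (h : y ∉ Metric.closedBall x r) :
    ballBump x r y = 0 := by
  rw [ballBump, unitBump_eq_zero (one_lt_norm_of_notMem hr h), mul_zero]

theorem tsupport_ballBump_subset {r : ℝ} (hr : 0 < r) (x : Euc d) :
    tsupport (ballBump x r) ⊆ Metric.closedBall x r :=
  closure_minimal (fun y hy => by
    by_contra h
    exact hy (ballBump_eq_zero hr h)) Metric.isClosed_closedBall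

theorem hasCompactSupport_ballBump {r : ℝ} (hr : 0 < r) (x : Euc d) :
    HasCompactSupport (ballBump x r) :=
  (isCompact_closedBall x r).of_isClosed_subset (isClosed_tsupport _) (tsupport_ballBump_subset hr x)

theorem integral_ballBump {r : ℝ} (hr : 0 < r) (x : Euc d) : ∫ y, ballBump x r y = 1 := by
  simp only [ballBump]
  rw [integral_const_mul, integral_sub_right_eq_self fun y => unitBump d (r⁻¹ • y),
    Measure.integral_comp_inv_smul, integral_unitBump, finrank_euclideanSpace_fin,
    abs_of_pos (by positivity), smul_eq_mul, mul_one, inv_mul_cancel₀ (by positivity)]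

theorem fderiv_ballBump (x y : Euc d) (r : ℝ) (e : Euc d) :
    fderiv ℝ (ballBump x r) y e =
      (r ^ d)⁻¹ * (r⁻¹ * fderiv ℝ (unitBump d) (r⁻¹ • (y - x)) e) := by
  have h1 : HasFDerivAt (fun y : Euc d => r⁻¹ • (y - x)) (r⁻¹ • ContinuousLinearMap.id ℝ (Euc d)) y :=
    ((hasFDerivAt_id y).sub_const x).const_smul r⁻¹
  have h2 := (contDiff_unitBump (d := d)).differentiable (by simp) (r⁻¹ • (y - x))
  have h3 := (h2.hasFDerivAt.comp y h1).const_mul (r ^ d)⁻¹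
  have h4 := HasFDerivAt.fderiv h3
  change fderiv ℝ (ballBump x r) y = _ at h4
  rw [h4]
  simp

/-- The weak gradient tested with a component of an affine vector field times a test function. -/
theorem HasWeakGradient.integral_affine_field {Ω : Set (Euc d)} {w : Euc d → ℝ}
    {g : Euc d → Euc d} (h : HasWeakGradient Ω w g) {b : Euc d → ℝ} (hb : ContDiff ℝ ∞ b)
    (hc : HasCompactSupport b) (hs : tsupport b ⊆ Ω) (a x : Euc d) (c : ℝ) :
    ∫ y in Ω, w y * (fderiv ℝ b y (a + c • (y - x)) + d * c * b y) =
      - ∫ y in Ω, b y * inner ℝ (a + c • (y - x)) (g y) := by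
  set V : Euc d → Euc d := fun y => a + c • (y - x) with hV
  have hVs : ∀ i, ContDiff ℝ ∞ fun y => V y i := fun i => by
    have : ContDiff ℝ ∞ V := by fun_prop
    exact (EuclideanSpace.proj i : Euc d →L[ℝ] ℝ).contDiff.comp this
  -- The scalar test function b V_i is used in the i-th component only. Summing over i produces the
  -- divergence of b V, which is V·∇b + d c b for the affine field V.
  have hφ : ∀ i, ContDiff ℝ ∞ fun y => b y * V y i := fun i => hb.mul (hVs i)
  have hcs : ∀ i, HasCompactSupport fun y => b y * V y i := fun i => hc.mul_right
  have hts : ∀ i, tsupport (fun y => b y * V y i) ⊆ Ω := fun i =>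
    (closure_mono (Function.support_mul_subset_left _ _)).trans hs
  have hgrad : ∀ i y, gradient (fun y => b y * V y i) y i =
      fderiv ℝ b y (EuclideanSpace.single i 1) * V y i + b y * c := by
    intro i y
    have e1 : gradient (fun y => b y * V y i) y i =
        fderiv ℝ (fun y => b y * V y i) y (EuclideanSpace.single i 1) := by
      rw [← inner_gradient_left, EuclideanSpace.inner_single_right]; simp
    have hVd : HasFDerivAt (fun y => V y i) (c • (EuclideanSpace.proj i : Euc d →L[ℝ] ℝ)) y := by
      have : HasFDerivAt V (c • ContinuousLinearMap.id ℝ (Euc d)) y :=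
        (((hasFDerivAt_id y).sub_const x).const_smul c).const_add a
      have := (EuclideanSpace.proj i : Euc d →L[ℝ] ℝ).hasFDerivAt.comp y this
      refine this.congr_fderiv ?_
      ext e; simp
    have := (hb.differentiable (by simp) y).hasFDerivAt.mul hVd
    rw [e1]
    have e2 := HasFDerivAt.fderiv this
    change fderiv ℝ (fun y => b y * V y i) y = _ at e2
    rw [e2]
    simp; ring
  have i1 : ∀ i, IntegrableOn (fun y => w y • gradient (fun y => b y * V y i) y) Ω := fun i =>
    integrableOn_smul_test h.1 (continuous_gradient_of_contDiff (hφ i))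
      ((hcs i).of_isClosed_subset (isClosed_tsupport _) (tsupport_gradient_subset _))
      ((tsupport_gradient_subset _).trans (hts i))
  have i2 : ∀ i, IntegrableOn (fun y => (b y * V y i) • g y) Ω := fun i =>
    integrableOn_test_smul h.2.1 (hφ i).continuous (hcs i) (hts i)
  have key : ∀ i, ∫ y in Ω, w y * gradient (fun y => b y * V y i) y i =
      - ∫ y in Ω, (b y * V y i) * g y i := by
    intro i
    have := congrArg (EuclideanSpace.proj i : Euc d →L[ℝ] ℝ)
      (h.2.2 _ (hφ i) (hcs i) (hts i))
    rw [map_neg, ← ContinuousLinearMap.integral_comp_comm _ (i1 i),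
      ← ContinuousLinearMap.integral_comp_comm _ (i2 i)] at this
    simpa using this
  have hsum := Finset.sum_congr (rfl : (Finset.univ : Finset (Fin d)) = Finset.univ)
    fun i _ => key i
  rw [← integral_finsetSum _ fun i _ => by
      simpa using (EuclideanSpace.proj i : Euc d →L[ℝ] ℝ).integrable_comp (i1 i),
    Finset.sum_neg_distrib, ← integral_finsetSum _ fun i _ => by
      simpa using (EuclideanSpace.proj i : Euc d →L[ℝ] ℝ).integrable_comp (i2 i)] at hsum
  have eL : ∀ y, w y * (fderiv ℝ b y (a + c • (y - x)) + d * c * b y) =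
      ∑ i, w y * gradient (fun y => b y * V y i) y i := by
    intro y
    simp only [hgrad]
    rw [← Finset.mul_sum, Finset.sum_add_distrib, Finset.sum_const, Finset.card_univ,
      Fintype.card_fin, nsmul_eq_mul]
    have h1 : V y = ∑ i, V y i • EuclideanSpace.single i (1 : ℝ) := by
      ext j; simp [Finset.sum_apply, Pi.single_apply]
    have h2 : fderiv ℝ b y (V y) = ∑ i, fderiv ℝ b y (EuclideanSpace.single i 1) * V y i := by
      conv_lhs => rw [h1, map_sum]
      simp [mul_comm]
    rw [← h2]
    ring
  have eR : ∀ y, b y * inner ℝ (a + c • (y - x)) (g y) = ∑ i, b y * V y i * g y i := by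
    intro y
    rw [show a + c • (y - x) = V y from rfl, PiLp.inner_apply, Finset.mul_sum]
    refine Finset.sum_congr rfl fun i _ => ?_
    simp; ring
  simp only [eL, eR]
  exact hsum

end Averages

/-! ### Means over moving balls. -/

section AverageBounds

variable {d : ℕ}

theorem volume_real_closedBall (x : Euc d) {r : ℝ} (hr : 0 < r) :
    volume.real (Metric.closedBall x r) = r ^ d * volume.real (Metric.closedBall (0 : Euc d) 1) := by
  rw [measureReal_def, Measure.addHaar_closedBall' _ _ hr.le, ENNReal.toReal_mul,
    ENNReal.toReal_ofReal (by positivity), finrank_euclideanSpace_fin]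
  rfl

theorem sq_integral_ball_le {Ω U : Set (Euc d)} (hUΩ : U ⊆ Ω) {x : Euc d} {r : ℝ} (hr : 0 < r)
    (hU : Metric.closedBall x r ⊆ U) {f : Euc d → ℝ} {F : Type*} [NormedAddCommGroup F]
    {G : Euc d → F} (hf : AEStronglyMeasurable f (volume.restrict Ω))
    (hG : MemLp G 2 (volume.restrict Ω)) (hf0 : ∀ y, y ∉ Metric.closedBall x r → f y = 0) {β : ℝ}
    (hβ : ∀ y, |f y| ≤ β * ‖G y‖) :
    (∫ y in Ω, f y) ^ 2 ≤
      β ^ 2 * (r ^ d * volume.real (Metric.closedBall (0 : Euc d) 1)) * ∫ y in U, ‖G y‖ ^ 2 := by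
  set S := Metric.closedBall x r with hS
  have hSΩ := hU.trans hUΩ
  have hGS : MemLp G 2 (volume.restrict S) := hG.mono_measure (Measure.restrict_mono hSΩ le_rfl)
  have hfS : MemLp f 2 (volume.restrict S) :=
    hGS.of_le_mul (c := β) (hf.mono_measure (Measure.restrict_mono hSΩ le_rfl))
      (.of_forall fun y => by rw [Real.norm_eq_abs]; exact hβ y)
  have hGU : IntegrableOn (fun y => ‖G y‖ ^ 2) U :=
    (hG.mono_measure (Measure.restrict_mono hUΩ le_rfl)).integrable_norm_pow (by norm_num)
  have e : ∫ y in Ω, f y = ∫ y in S, f y := by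
    rw [setIntegral_eq_integral_of_forall_compl_eq_zero fun y hy => hf0 y fun h => hy (hSΩ h),
      setIntegral_eq_integral_of_forall_compl_eq_zero hf0]
  rw [e]
  refine (sq_setIntegral_le Metric.isBounded_closedBall.measure_lt_top.ne hfS).trans ?_
  rw [← volume_real_closedBall x hr, mul_comm (β ^ 2), mul_assoc]
  refine mul_le_mul_of_nonneg_left ?_ measureReal_nonneg
  calc ∫ y in S, f y ^ 2 ≤ ∫ y in S, β ^ 2 * ‖G y‖ ^ 2 := by
        refine integral_mono hfS.integrable_sq ((hGU.mono_set hU).const_mul _) fun y => ?_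
        simp only
        rw [← mul_pow, ← sq_abs]
        exact pow_le_pow_left₀ (abs_nonneg _) (hβ y) 2
    _ = β ^ 2 * ∫ y in S, ‖G y‖ ^ 2 := integral_const_mul _ _
    _ ≤ β ^ 2 * ∫ y in U, ‖G y‖ ^ 2 := by
        refine mul_le_mul_of_nonneg_left ?_ (sq_nonneg _)
        exact setIntegral_mono_set hGU (.of_forall fun _ => sq_nonneg _) (.of_forall hU)

/-- The derivative of a bump function with respect to a parameter moving its ball. -/
theorem hasDerivAt_ballBump (x₀ a y : Euc d) (r₀ c s : ℝ) (hr : r₀ + s * c ≠ 0) :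
    HasDerivAt (fun s : ℝ => ballBump (x₀ + s • a) (r₀ + s * c) y)
      (-(fderiv ℝ (ballBump (x₀ + s • a) (r₀ + s * c)) y
          (a + (c / (r₀ + s * c)) • (y - (x₀ + s • a))) +
        d * (c / (r₀ + s * c)) * ballBump (x₀ + s • a) (r₀ + s * c) y)) s := by
  have hrd : HasDerivAt (fun s : ℝ => r₀ + s * c) c s := by
    simpa using ((hasDerivAt_id s).mul_const c).const_add r₀
  have hxd : HasDerivAt (fun s : ℝ => y - (x₀ + s • a)) (-a) s := by
    simpa using (((hasDerivAt_id s).smul_const a).const_add x₀).const_sub y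
  have h1 := (hrd.fun_pow d).fun_inv (pow_ne_zero d hr)
  have h2 := (hrd.fun_inv hr).fun_smul hxd
  have h3 := ((contDiff_unitBump (d := d)).differentiable (by simp)
    ((r₀ + s * c)⁻¹ • (y - (x₀ + s • a)))).hasFDerivAt.comp_hasDerivAt s h2
  have h4 := h1.fun_mul h3
  -- The derivative has the form -div(b V) with the velocity field V(y) = a + (c/r)(y - x): a
  -- continuity equation for the mass transported with the ball. This is the expression that the
  -- weak gradient can be tested with.
  refine h4.congr_deriv ?_
  rw [fderiv_ballBump, ballBump]
  simp only [Function.comp_apply]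
  generalize r₀ + s * c = r at *
  have hp : (d : ℝ) * r ^ (d - 1) = d * r ^ d * r⁻¹ := by
    rcases Nat.eq_zero_or_pos d with h | h
    · simp [h]
    · rw [mul_assoc, ← pow_sub_one_mul (by omega : d ≠ 0) r, mul_assoc, mul_inv_cancel₀ hr, mul_one]
  simp only [map_add, map_smul, map_neg, smul_eq_mul, hp]
  field_simp
  ring

/-- The bound depends on the radius only through its lower bound `q`, so it dominates uniformly in
the parameter when differentiating under the integral. -/
theorem abs_deriv_ballBump_le {M : ℝ} (hM : ∀ x, |unitBump d x| ≤ M)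
    (hM' : ∀ x, ‖fderiv ℝ (unitBump d) x‖ ≤ M) (x a y : Euc d) {r q c : ℝ} (hq : 0 < q)
    (hqr : q ≤ r) :
    |fderiv ℝ (ballBump x r) y (a + (c / r) • (y - x)) + d * (c / r) * ballBump x r y| ≤
      (q ^ d)⁻¹ * q⁻¹ * (M * (‖a‖ + |c|) + d * |c| * M) := by
  have hr : 0 < r := hq.trans_le hqr
  have hM0 : 0 ≤ M := (abs_nonneg _).trans (hM 0)
  have hqd : (r ^ d)⁻¹ * r⁻¹ ≤ (q ^ d)⁻¹ * q⁻¹ := by gcongr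
  rw [fderiv_ballBump, ballBump]
  set ζ := r⁻¹ • (y - x) with hζ
  have hV : a + (c / r) • (y - x) = a + c • ζ := by rw [hζ, smul_smul, div_eq_mul_inv]
  rw [hV]
  have e : (r ^ d)⁻¹ * (r⁻¹ * fderiv ℝ (unitBump d) ζ (a + c • ζ)) +
      d * (c / r) * ((r ^ d)⁻¹ * unitBump d ζ) =
      (r ^ d)⁻¹ * r⁻¹ * (fderiv ℝ (unitBump d) ζ (a + c • ζ) + d * c * unitBump d ζ) := by
    rw [div_eq_mul_inv]; ring
  rw [e, abs_mul, abs_of_pos (by positivity)]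
  refine mul_le_mul hqd ?_ (abs_nonneg _) (by positivity)
  rcases lt_or_ge 1 ‖ζ‖ with h | h
  · rw [fderiv_unitBump_eq_zero h, unitBump_eq_zero h]
    simp; positivity
  · refine (abs_add_le _ _).trans (add_le_add ?_ ?_)
    · refine (ContinuousLinearMap.le_opNorm _ _).trans (mul_le_mul (hM' ζ) ?_ (norm_nonneg _) hM0)
      refine (norm_add_le _ _).trans (add_le_add_right ?_ _)
      rw [norm_smul, Real.norm_eq_abs]
      exact mul_le_of_le_one_right (abs_nonneg _) h
    · rw [abs_mul, abs_mul, Nat.abs_cast]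
      exact mul_le_mul_of_nonneg_left (hM ζ) (by positivity)

theorem abs_ballBump_le {M : ℝ} (hM : ∀ x, |unitBump d x| ≤ M) (x y : Euc d) {r : ℝ} (hr : 0 < r) :
    |ballBump x r y| ≤ (r ^ d)⁻¹ * M := by
  rw [ballBump, abs_mul, abs_of_pos (by positivity)]
  exact mul_le_mul_of_nonneg_left (hM _) (by positivity)

/-- A point of the intermediate ball with relative position ξ is the convex combination of the
points with the same relative position in the two end balls. -/
theorem closedBall_interpolate_subset {U : Set (Euc d)} (hU : Convex ℝ U) {x₀ x₁ : Euc d}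
    {r₀ r₁ s : ℝ} (hr₀ : 0 < r₀) (hr₁ : 0 < r₁) (h₀ : Metric.closedBall x₀ r₀ ⊆ U)
    (h₁ : Metric.closedBall x₁ r₁ ⊆ U) (hs : s ∈ Icc (0 : ℝ) 1) :
    Metric.closedBall (x₀ + s • (x₁ - x₀)) (r₀ + s * (r₁ - r₀)) ⊆ U := by
  intro y hy
  have hr : 0 < r₀ + s * (r₁ - r₀) := by
    rcases le_total r₀ r₁ with h | h
    · have := mul_nonneg hs.1 (sub_nonneg.2 h); linarith
    · have := mul_le_mul_of_nonneg_right hs.2 (sub_nonneg.2 h); linarith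
  set r := r₀ + s * (r₁ - r₀) with hrdef
  set ξ := r⁻¹ • (y - (x₀ + s • (x₁ - x₀))) with hξ
  have hξ1 : ‖ξ‖ ≤ 1 := by
    rw [hξ, norm_smul, norm_inv, Real.norm_eq_abs, abs_of_pos hr, ← div_eq_inv_mul,
      div_le_one hr, ← dist_eq_norm]
    exact hy
  have hb : ∀ (x : Euc d) (ρ : ℝ), 0 < ρ → x + ρ • ξ ∈ Metric.closedBall x ρ := by
    intro x ρ hρ
    rw [Metric.mem_closedBall, dist_eq_norm, add_sub_cancel_left, norm_smul, Real.norm_eq_abs,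
      abs_of_pos hρ]
    exact mul_le_of_le_one_right hρ.le hξ1
  have h := hU (h₀ (hb x₀ r₀ hr₀)) (h₁ (hb x₁ r₁ hr₁)) (sub_nonneg.2 hs.2) hs.1 (by ring)
  have e : (1 - s) • (x₀ + r₀ • ξ) + s • (x₁ + r₁ • ξ) = (x₀ + s • (x₁ - x₀)) + r • ξ := by
    rw [hrdef]; module
  rw [e, hξ, smul_inv_smul₀ hr.ne', add_sub_cancel] at h
  exact h

variable (d) in
/-- Averages over balls are bounded in terms of `L²`-norms, and averages over two balls in a convex
set differ by at most a multiple of the `L²`-norm of the gradient. -/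
theorem exists_average_bound : ∃ C : ℝ, 0 < C ∧
    (∀ (D : Set (Euc d)) (x : Euc d) (r : ℝ) (w : Euc d → ℝ), 0 < r → Metric.closedBall x r ⊆ D →
      MemLp w 2 (volume.restrict D) →
      (∫ y in D, ballBump x r y * w y) ^ 2 ≤ C * (r ^ d)⁻¹ * ∫ y in D, w y ^ 2) ∧
    ∀ (Ω U : Set (Euc d)) (w : Euc d → ℝ) (g : Euc d → Euc d) (x₀ x₁ : Euc d) (r r₀ r₁ : ℝ),
      volume Ω ≠ ⊤ → MemLp w 2 (volume.restrict Ω) → MemLp g 2 (volume.restrict Ω) →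
      HasWeakGradient Ω w g → U ⊆ Ω → Convex ℝ U → 0 < r → r ≤ r₀ → r ≤ r₁ →
      Metric.closedBall x₀ r₀ ⊆ U → Metric.closedBall x₁ r₁ ⊆ U →
      ((∫ y in Ω, ballBump x₁ r₁ y * w y) - ∫ y in Ω, ballBump x₀ r₀ y * w y) ^ 2 ≤
        C * (‖x₁ - x₀‖ + |r₁ - r₀|) ^ 2 * (r ^ d)⁻¹ * ∫ y in U, ‖g y‖ ^ 2 := by
  obtain ⟨M, hM0, hM, hM'⟩ := exists_unitBump_bound d
  set vol₁ := volume.real (Metric.closedBall (0 : Euc d) 1) with hvol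
  have hvol0 : 0 ≤ vol₁ := measureReal_nonneg
  refine ⟨M ^ 2 * vol₁ + 1, by positivity, ?_, ?_⟩
  · intro D x r w hr hD hw
    have h := sq_integral_ball_le (f := fun y => ballBump x r y * w y) subset_rfl hr hD
      ((contDiff_ballBump x r).continuous.aestronglyMeasurable.mul hw.1) hw
      (fun y hy => by rw [ballBump_eq_zero hr hy, zero_mul]) (β := (r ^ d)⁻¹ * M) fun y => by
        rw [abs_mul]
        exact mul_le_mul_of_nonneg_right (abs_ballBump_le hM x y hr) (abs_nonneg _)
    simp only [Real.norm_eq_abs, sq_abs] at h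
    refine h.trans (mul_le_mul_of_nonneg_right ?_ (integral_nonneg fun _ => sq_nonneg _))
    have hrd : 0 < r ^ d := by positivity
    calc ((r ^ d)⁻¹ * M) ^ 2 * (r ^ d * vol₁) = M ^ 2 * vol₁ * (r ^ d)⁻¹ := by field_simp
      _ ≤ _ := by gcongr; linarith
  · intro Ω U w g x₀ x₁ r r₀ r₁ hΩ hw hg hwg hUΩ hU hr hr₀ hr₁ hB₀ hB₁
    have : IsFiniteMeasure (volume.restrict Ω) :=
      ⟨by rw [Measure.restrict_apply_univ]; exact hΩ.lt_top⟩
    have hwi : Integrable w (volume.restrict Ω) := hw.integrable (by norm_num)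
    set a := x₁ - x₀ with ha
    set c := r₁ - r₀ with hc
    set b : ℝ → Euc d → ℝ := fun s => ballBump (x₀ + s • a) (r₀ + s * c) with hb
    set b' : ℝ → Euc d → ℝ := fun s y => -(fderiv ℝ (b s) y
      (a + (c / (r₀ + s * c)) • (y - (x₀ + s • a))) + d * (c / (r₀ + s * c)) * b s y) with hb'
    have hrs : ∀ s ∈ Icc (0 : ℝ) 1, r ≤ r₀ + s * c := by
      intro s hs
      nlinarith [hs.1, hs.2]
    have hbc : ∀ s, Continuous (b s) := fun s => (contDiff_ballBump _ _).continuous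
    have hbw : ∀ s, AEStronglyMeasurable (fun y => b s y * w y) (volume.restrict Ω) := fun s =>
      (hbc s).aestronglyMeasurable.mul hw.1
    have hb'c : ∀ s, Continuous (b' s) := fun s => by
      have h1 : Continuous fun y => fderiv ℝ (b s) y
          (a + (c / (r₀ + s * c)) • (y - (x₀ + s • a))) :=
        ((contDiff_ballBump _ _).continuous_fderiv (by simp)).clm_apply (by fun_prop)
      exact (h1.add (continuous_const.mul (hbc s))).neg
    have hder : ∀ s ∈ Icc (0 : ℝ) 1, HasDerivAt (fun s => ∫ y in Ω, b s y * w y)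
        (∫ y in Ω, b' s y * w y) s := by
      intro s hs
      -- Differentiation needs an open set of parameters, so radii slightly below `r` are admitted
      -- and the dominating function is built with r / 2.
      have hopen : IsOpen {t : ℝ | r / 2 < r₀ + t * c} :=
        isOpen_lt continuous_const (by fun_prop)
      have hmem : s ∈ {t : ℝ | r / 2 < r₀ + t * c} := by
        have := hrs s hs
        change r / 2 < _
        linarith
      have hp : 0 < r₀ + s * c := hr.trans_le (hrs s hs)
      refine (hasDerivAt_integral_of_dominated_loc_of_deriv_le (F := fun s y => b s y * w y)
        (F' := fun s y => b' s y * w y) (hopen.mem_nhds hmem)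
        (.of_forall hbw) ?_ ((hb'c s).aestronglyMeasurable.mul hw.1)
        (bound := fun y => ((r / 2) ^ d)⁻¹ * (r / 2)⁻¹ * (M * (‖a‖ + |c|) + d * |c| * M) * ‖w y‖)
        (.of_forall fun y t ht => ?_) (hwi.norm.const_mul _) (.of_forall fun y t ht => ?_)).2
      · exact Integrable.bdd_mul hwi (hbc s).aestronglyMeasurable
          (.of_forall fun y => by rw [Real.norm_eq_abs]; exact abs_ballBump_le hM _ _ hp)
      · rw [norm_mul, hb']
        refine mul_le_mul_of_nonneg_right ?_ (norm_nonneg _)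
        rw [norm_neg, Real.norm_eq_abs]
        exact abs_deriv_ballBump_le hM hM' _ _ _ (by positivity) (le_of_lt ht)
      · have ht : r / 2 < r₀ + t * c := ht
        exact (hasDerivAt_ballBump x₀ a y r₀ c t (by linarith)).mul_const (w y)
    set I := ∫ y in U, ‖g y‖ ^ 2 with hI
    have hI0 : 0 ≤ I := integral_nonneg fun _ => sq_nonneg _
    set N := ‖a‖ + |c| with hN
    have hN0 : 0 ≤ N := by positivity
    have hbound : ∀ s ∈ Icc (0 : ℝ) 1,
        ‖∫ y in Ω, b' s y * w y‖ ≤ Real.sqrt (M ^ 2 * vol₁ * N ^ 2 * (r ^ d)⁻¹ * I) := by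
      intro s hs
      have hrr := hrs s hs
      have hp : 0 < r₀ + s * c := hr.trans_le hrr
      set xs := x₀ + s • a with hxs
      set rs := r₀ + s * c with hrs'
      have hball : Metric.closedBall xs rs ⊆ U :=
        closedBall_interpolate_subset hU (hr.trans_le hr₀) (hr.trans_le hr₁) hB₀ hB₁ hs
      have hweak := hwg.integral_affine_field (contDiff_ballBump xs rs)
        (hasCompactSupport_ballBump hp xs)
        ((tsupport_ballBump_subset hp xs).trans (hball.trans hUΩ)) a xs (c / rs)
      -- The continuity equation combined with the definition of the weak gradient: the rate of
      -- change of the mean is the mean of velocity times gradient. On the ball the velocity is at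
      -- most ‖a‖ + |c|.
      have e : ∫ y in Ω, b' s y * w y =
          ∫ y in Ω, ballBump xs rs y * inner ℝ (a + (c / rs) • (y - xs)) (g y) := by
        rw [← neg_neg (∫ y in Ω, ballBump xs rs y * _), ← hweak, ← integral_neg]
        refine integral_congr_ae (.of_forall fun y => ?_)
        simp only [hb', hb]; ring
      rw [e, Real.norm_eq_abs]
      refine Real.abs_le_sqrt ?_
      refine (sq_integral_ball_le hUΩ hp hball ?_ hg (fun y hy => by
        rw [ballBump_eq_zero hp hy, zero_mul]) (β := (rs ^ d)⁻¹ * M * N) fun y => ?_).trans ?_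
      · refine (contDiff_ballBump xs rs).continuous.aestronglyMeasurable.mul
          (AEStronglyMeasurable.inner ?_ hg.1)
        exact Continuous.aestronglyMeasurable (by fun_prop)
      · by_cases hy : y ∈ Metric.closedBall xs rs
        · rw [abs_mul, mul_assoc _ N]
          refine mul_le_mul (abs_ballBump_le hM xs y hp) ((abs_real_inner_le_norm _ _).trans
            (mul_le_mul_of_nonneg_right ?_ (norm_nonneg _))) (abs_nonneg _) (by positivity)
          refine (norm_add_le _ _).trans (add_le_add_right ?_ _)
          rw [norm_smul, Real.norm_eq_abs, abs_div, abs_of_pos hp, div_mul_eq_mul_div,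
            div_le_iff₀ hp]
          refine mul_le_mul_of_nonneg_left ?_ (abs_nonneg _)
          rw [← dist_eq_norm]; exact hy
        · rw [ballBump_eq_zero hp hy, zero_mul, abs_zero]; positivity
      · refine mul_le_mul_of_nonneg_right ?_ hI0
        have hrd : 0 < rs ^ d := by positivity
        calc ((rs ^ d)⁻¹ * M * N) ^ 2 * (rs ^ d * vol₁) = M ^ 2 * vol₁ * N ^ 2 * (rs ^ d)⁻¹ := by
              field_simp
          _ ≤ _ := by gcongr
    have hmv := (convex_Icc (0 : ℝ) 1).norm_image_sub_le_of_norm_hasDerivWithin_le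
      (fun s hs => (hder s hs).hasDerivWithinAt) hbound
      (left_mem_Icc.2 zero_le_one) (right_mem_Icc.2 zero_le_one)
    simp only [hb, one_smul, one_mul, zero_smul, zero_mul, add_zero, sub_zero, norm_one,
      mul_one] at hmv
    rw [ha, hc, add_sub_cancel, add_sub_cancel, Real.norm_eq_abs] at hmv
    have h2 := pow_le_pow_left₀ (abs_nonneg _) hmv 2
    rw [sq_abs, Real.sq_sqrt (by positivity)] at h2
    refine h2.trans ?_
    have hrd : 0 < r ^ d := by positivity
    refine mul_le_mul_of_nonneg_right (mul_le_mul_of_nonneg_right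
      (mul_le_mul_of_nonneg_right (by linarith) (sq_nonneg _)) (by positivity)) hI0

end AverageBounds

/-! ## Means on adjacent elements -/

namespace IsSimplex

variable {d : ℕ} {K : Finset (Euc d)}

open Classical in
/-- The center of a ball in the simplex `K` whose size is comparable to that of the largest one. -/
noncomputable def inCenter (K : Finset (Euc d)) : Euc d :=
  if h : ∃ x, Metric.closedBall x (inscribedDiam K / 4) ⊆ simplexHull K then h.choose else 0

theorem ball_inCenter_subset (hK : IsSimplex K) (hd : 1 ≤ d) :
    Metric.closedBall (inCenter K) (inscribedDiam K / 4) ⊆ simplexHull K := by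
  have h := hK.exists_inscribed hd
  rw [inCenter, dif_pos h]
  exact h.choose_spec

theorem ball_inCenter_subset_interior (hK : IsSimplex K) (hd : 1 ≤ d) :
    Metric.closedBall (inCenter K) (inscribedDiam K / 8) ⊆ interior (simplexHull K) := by
  have hρ := hK.inscribedDiam_pos hd
  refine (Metric.closedBall_subset_ball (by linarith)).trans
    (interior_maximal (Metric.ball_subset_closedBall.trans (hK.ball_inCenter_subset hd))
      Metric.isOpen_ball)

theorem inCenter_mem (hK : IsSimplex K) (hd : 1 ≤ d) : inCenter K ∈ simplexHull K :=
  hK.ball_inCenter_subset hd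
    (Metric.mem_closedBall_self (by have := hK.inscribedDiam_pos hd; linarith))

theorem homothetic_ball_subset_interior {b x : Euc d} (hb : b ∈ simplexHull K) {r t : ℝ}
    (hx : Metric.closedBall x r ⊆ interior (simplexHull K)) (ht : 0 < t) (ht1 : t ≤ 1) :
    Metric.closedBall (b + t • (x - b)) (t * r) ⊆ interior (simplexHull K) := by
  intro y hy
  have hy' : x + t⁻¹ • (y - (b + t • (x - b))) ∈ Metric.closedBall x r := by
    rw [Metric.mem_closedBall, dist_eq_norm, add_sub_cancel_left, norm_smul, norm_inv,
      Real.norm_eq_abs, abs_of_pos ht, ← div_eq_inv_mul, div_le_iff₀ ht, ← dist_eq_norm, mul_comm]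
    exact hy
  have h := (convex_simplexHull K).combo_closure_interior_mem_interior (subset_closure hb)
    (hx hy') (sub_nonneg.2 ht1) ht (by ring)
  convert h using 1
  rw [smul_add, smul_inv_smul₀ ht.ne']
  module

end IsSimplex

/-! ### Geometry of two elements sharing a face, and comparison of their means. -/

namespace SimplicialMesh

variable {d ℓ : ℕ} {T : SimplicialMesh d} {K K₁ K₂ F : Finset (Euc d)} {ε : ℝ}

theorem exists_opposite_vertex (hK : K ∈ T.elements) (hF : F ∈ T.interiorFaces) (hFK : F ⊆ K) :
    ∃ a, a ∈ K ∧ a ∉ F ∧ ∀ v ∈ K, v ≠ a → v ∈ F := by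
  classical
  obtain ⟨-, -, -, hc⟩ := mem_interiorFaces hF
  have h1 : (K \ F).card = 1 := by
    rw [Finset.card_sdiff_of_subset hFK, hc, T.card_eq K hK]; omega
  obtain ⟨a, ha⟩ := Finset.card_eq_one.1 h1
  have haK : a ∈ K \ F := by rw [ha]; exact Finset.mem_singleton_self a
  rw [Finset.mem_sdiff] at haK
  refine ⟨a, haK.1, haK.2, fun v hv hva => ?_⟩
  by_contra hvF
  have : v ∈ K \ F := Finset.mem_sdiff.2 ⟨hv, hvF⟩
  rw [ha, Finset.mem_singleton] at this
  exact hva this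

/-- A ball around a point of an interior face is contained in the union of the two elements
sharing the face. -/
theorem exists_face_ball (hd : 1 ≤ d) (hK₁ : K₁ ∈ T.elements) (hK₂ : K₂ ∈ T.elements)
    (hF : F ∈ T.interiorFaces) (hne : K₁ ≠ K₂) (hF₁ : F ⊆ K₁) (hF₂ : F ⊆ K₂) :
    ∃ b ∈ simplexHull F, ∀ R : ℝ, R ≤ inscribedDiam K₁ / d → R ≤ inscribedDiam K₂ / d →
      Metric.ball b R ⊆ simplexHull K₁ ∪ simplexHull K₂ := by
  classical
  obtain ⟨-, -, -, hc⟩ := mem_interiorFaces hF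
  have hs₁ := T.isSimplex hK₁
  have hs₂ := T.isSimplex hK₂
  obtain ⟨a₁, ha₁, haF₁, hv₁⟩ := exists_opposite_vertex hK₁ hF hF₁
  obtain ⟨a₂, ha₂, haF₂, hv₂⟩ := exists_opposite_vertex hK₂ hF hF₂
  have hd0 : (0 : ℝ) < d := by exact_mod_cast hd
  have hcap : K₁ ∩ K₂ = F := by
    refine Finset.Subset.antisymm (fun v hv => ?_) (Finset.subset_inter hF₁ hF₂)
    rw [Finset.mem_inter] at hv
    by_contra hvF
    have e₁ : v = a₁ := by by_contra h; exact hvF (hv₁ v hv.1 h)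
    have e₂ : v = a₂ := by by_contra h; exact hvF (hv₂ v hv.2 h)
    apply hne
    have hin : ∀ w ∈ K₁, w ∈ K₂ := fun w hw => by
      by_cases h : w = a₁
      · rw [h, ← e₁]; exact hv.2
      · exact hF₂ (hv₁ w hw h)
    exact Finset.eq_of_subset_of_card_le hin (by rw [hs₁.card_eq, hs₂.card_eq])
  -- The barycenter of the face: all coordinates belonging to vertices of `F` equal 1/d there.
  set b : Euc d := ∑ v ∈ F, (1 / d : ℝ) • v with hb
  have hsum : ∑ v ∈ F, (1 / d : ℝ) = 1 := by
    rw [Finset.sum_const, hc, nsmul_eq_mul]; field_simp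
  have hbF : b ∈ simplexHull F :=
    (convex_convexHull ℝ _).sum_mem (fun _ _ => by positivity) hsum
      fun v hv => subset_convexHull ℝ _ hv
  have hbary : ∀ K ∈ T.elements, F ⊆ K → ∀ v ∈ F, bary K v b = 1 / d := by
    intro K hK hFK v hv
    rw [hb, IsSimplex.map_affine_combination hsum, Finset.sum_eq_single v]
    · rw [IsSimplex.bary_apply_self (T.isSimplex hK) (hFK hv), mul_one]
    · intro w hw hwv
      rw [IsSimplex.bary_apply_ne (T.isSimplex hK) (hFK hw) hwv.symm, mul_zero]
    · exact fun h => absurd hv h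
  have hb₁ : b ∈ simplexHull K₁ := convexHull_mono (by exact_mod_cast hF₁) hbF
  have hb₂ : b ∈ simplexHull K₂ := convexHull_mono (by exact_mod_cast hF₂) hbF
  set c := bary K₂ a₂ a₁ with hcdef
  -- Both opposite coordinates vanish at the vertices of `F`, hence they are proportional.
  have hlin : ∀ x, bary K₂ a₂ x = bary K₁ a₁ x * c := by
    intro x
    rw [hs₁.affine_eq_sum (bary K₂ a₂) x, Finset.sum_eq_single a₁]
    · intro v hv hva
      have hvF := hv₁ v hv hva
      rw [IsSimplex.bary_apply_ne hs₂ (hF₂ hvF) (fun h => haF₂ (by rwa [h])), mul_zero]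
    · exact fun h => absurd ha₁ h
  -- Within distance ρ_K / d of `b` the coordinates of the face vertices change by at most 1/d and
  -- stay nonnegative; only the coordinate of the opposite vertex decides membership.
  have hmem : ∀ K ∈ T.elements, F ⊆ K → ∀ a, (∀ v ∈ K, v ≠ a → v ∈ F) → ∀ y,
      dist y b ≤ inscribedDiam K / d → 0 ≤ bary K a y → y ∈ simplexHull K := by
    intro K hK hFK a hv y hy hay
    have hs := T.isSimplex hK
    have hρ := hs.inscribedDiam_pos hd
    rw [hs.mem_simplexHull_iff]
    intro v hvK
    by_cases h : v = a
    · rwa [h]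
    have hvF := hv v hvK h
    have h1 := hs.abs_bary_sub_le hd v y b
    rw [hbary K hK hFK v hvF] at h1
    have h2 : dist y b / inscribedDiam K ≤ 1 / d := by
      rw [div_le_iff₀ hρ, one_div_mul_eq_div]; exact hy
    have h3 := (abs_le.1 (h1.trans h2)).1
    linarith
  -- Otherwise both elements would lie on the same side of `F`: a point slightly moved from `b`
  -- towards `a₁` would be in both, hence in `F` by conformity, although its coordinate at `a₁` is
  -- positive.
  have hc0 : c < 0 := by
    by_contra hcn
    rw [not_lt] at hcn
    have hρ := hs₂.inscribedDiam_pos hd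
    set t := min 1 (inscribedDiam K₂ / (d * (dist a₁ b + 1))) with ht
    have ht0 : 0 < t := lt_min one_pos (by positivity)
    set y := AffineMap.lineMap b a₁ t with hy
    have hdist : dist y b ≤ inscribedDiam K₂ / d := by
      rw [hy, dist_lineMap_left, Real.norm_eq_abs, abs_of_pos ht0, dist_comm]
      have h1 : t ≤ inscribedDiam K₂ / (d * (dist a₁ b + 1)) := min_le_right _ _
      calc t * dist a₁ b ≤ inscribedDiam K₂ / (d * (dist a₁ b + 1)) * (dist a₁ b + 1) := by
            gcongr; linarith
        _ = inscribedDiam K₂ / d := by field_simp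
    have hb1 : bary K₁ a₁ b = 0 := by
      have := ((hs₁.mem_hull_of_subset hF₁).1 hbF).2 a₁ ha₁ haF₁
      exact this
    have hy1 : bary K₁ a₁ y = t := by
      rw [hy, AffineMap.apply_lineMap, hb1, IsSimplex.bary_apply_self hs₁ ha₁]
      simp [AffineMap.lineMap_apply]
    have hyK₁ : y ∈ simplexHull K₁ :=
      (IsSimplex.convex_simplexHull K₁).lineMap_mem hb₁ (subset_convexHull ℝ _ ha₁)
        ⟨ht0.le, min_le_left _ _⟩
    have hyK₂ : y ∈ simplexHull K₂ :=
      hmem K₂ hK₂ hF₂ a₂ hv₂ y hdist (by rw [hlin, hy1]; positivity)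
    have hyF : y ∈ simplexHull F := by
      rw [← hcap, ← inter_hull hK₁ hK₂]; exact ⟨hyK₁, hyK₂⟩
    have := ((hs₁.mem_hull_of_subset hF₁).1 hyF).2 a₁ ha₁ haF₁
    rw [hy1] at this
    exact ht0.ne' this
  refine ⟨b, hbF, fun R hR₁ hR₂ y hy => ?_⟩
  rw [Metric.mem_ball] at hy
  rcases le_or_gt 0 (bary K₁ a₁ y) with h | h
  · exact Or.inl (hmem K₁ hK₁ hF₁ a₁ hv₁ y (hy.le.trans hR₁) h)
  · refine Or.inr (hmem K₂ hK₂ hF₂ a₂ hv₂ y (hy.le.trans hR₂) ?_)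
    rw [hlin]
    exact (mul_pos_of_neg_of_neg h hc0).le

variable (T) in
/-- A weighted mean of `w` over a ball contained in the element `K`. -/
noncomputable def elemMean (w : Euc d → ℝ) (K : Finset (Euc d)) : ℝ :=
  ∫ y in T.domain, ballBump (IsSimplex.inCenter K) (inscribedDiam K / 8) y * w y

/-- The form over Ω suits the weak gradient, the form over `K` the local estimates. They agree
because the ball of radius ρ_K / 8 lies in the interior of `K`. -/
theorem elemMean_eq (hd : 1 ≤ d) (hK : K ∈ T.elements) (w : Euc d → ℝ) :
    T.elemMean w K =
      ∫ y in simplexHull K, ballBump (IsSimplex.inCenter K) (inscribedDiam K / 8) y * w y := by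
  have hs := T.isSimplex hK
  have hρ := hs.inscribedDiam_pos hd
  have hsub := hs.ball_inCenter_subset_interior hd
  have h0 : ∀ y, y ∉ interior (simplexHull K) →
      ballBump (IsSimplex.inCenter K) (inscribedDiam K / 8) y * w y = 0 := fun y hy => by
    rw [ballBump_eq_zero (by positivity) fun h => hy (hsub h), zero_mul]
  rw [elemMean, setIntegral_eq_integral_of_forall_compl_eq_zero fun y hy => h0 y fun h =>
      hy (interior_hull_subset_domain hK h),
    setIntegral_eq_integral_of_forall_compl_eq_zero fun y hy => h0 y fun h =>
      hy (interior_subset h)]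

theorem sq_add_sub_le_three (a b c : ℝ) :
    (a + b - c) ^ 2 ≤ 3 * a ^ 2 + 3 * b ^ 2 + 3 * c ^ 2 := by
  nlinarith [sq_nonneg (a - b), sq_nonneg (a + c), sq_nonneg (b + c)]

variable (d) in
set_option maxHeartbeats 800000 in
/-- Means over adjacent elements differ by at most a multiple of the norm of the gradient. -/
theorem exists_elemMean_sub_bound (hd : 1 ≤ d) : ∃ C : ℝ, 0 < C ∧ ∀ (T : SimplicialMesh d)
    (K₁ K₂ F : Finset (Euc d)) (w : Euc d → ℝ) (ρ h : ℝ), K₁ ∈ T.elements → K₂ ∈ T.elements →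
    F ∈ T.interiorFaces → K₁ ≠ K₂ → F ⊆ K₁ → F ⊆ K₂ → MemH1 T.domain w → 0 < ρ →
    ρ ≤ inscribedDiam K₁ → ρ ≤ inscribedDiam K₂ → simplexDiam K₁ ≤ h → simplexDiam K₂ ≤ h →
    (T.elemMean w K₁ - T.elemMean w K₂) ^ 2 ≤ C * h ^ 2 * ((ρ ^ 2 / (16 * d * h)) ^ d)⁻¹ *
      ((∫ x in simplexHull K₁, ‖weakGradient T.domain w x‖ ^ 2) +
        ∫ x in simplexHull K₂, ‖weakGradient T.domain w x‖ ^ 2) := by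
  obtain ⟨C, hC, -, hC2⟩ := exists_average_bound d
  refine ⟨54 * C, by positivity, ?_⟩
  intro T K₁ K₂ F w ρ h hK₁ hK₂ hF hne hF₁ hF₂ hw hρ hρ₁ hρ₂ hh₁ hh₂
  obtain ⟨b, hbF, hball⟩ := exists_face_ball hd hK₁ hK₂ hF hne hF₁ hF₂
  have hd0 : (0 : ℝ) < d := by exact_mod_cast hd
  have hd1 : (1 : ℝ) ≤ d := by exact_mod_cast hd
  have hb₁ : b ∈ simplexHull K₁ := convexHull_mono (by exact_mod_cast hF₁) hbF
  have hb₂ : b ∈ simplexHull K₂ := convexHull_mono (by exact_mod_cast hF₂) hbF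
  have hρh : ρ ≤ h := hρ₁.trans (((T.isSimplex hK₁).inscribedDiam_le_diam hd).trans hh₁)
  have hh : 0 < h := hρ.trans_le hρh
  set G := weakGradient T.domain w with hG
  have hGm : MemLp G 2 (volume.restrict T.domain) := hw.memLp_weakGradient T.isOpen_domain
  have hGi : IntegrableOn (fun x => ‖G x‖ ^ 2) T.domain := integrableOn_sq_gradient hw
  -- The inner balls are contracted towards `b` by this factor. They then lie within 9/16 · ρ/d of
  -- `b`, inside the convex ball around `b` contained in the union of both elements; `r` below is a
  -- lower bound for all radii involved.
  set t := ρ / (2 * d * h) with ht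
  have ht0 : 0 < t := by positivity
  have ht1 : t ≤ 1 := by
    rw [ht, div_le_one (by positivity)]
    nlinarith
  set r := ρ ^ 2 / (16 * d * h) with hr
  have hrt : r = t * (ρ / 8) := by rw [hr, ht]; field_simp; norm_num
  have hr0 : 0 < r := by positivity
  set I₁ := ∫ x in simplexHull K₁, ‖G x‖ ^ 2 with hI₁
  set I₂ := ∫ x in simplexHull K₂, ‖G x‖ ^ 2 with hI₂
  have hI₁0 : 0 ≤ I₁ := integral_nonneg fun _ => sq_nonneg _
  have hI₂0 : 0 ≤ I₂ := integral_nonneg fun _ => sq_nonneg _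
  set x : Finset (Euc d) → Euc d := fun K => b + t • (IsSimplex.inCenter K - b) with hx
  set J : Finset (Euc d) → ℝ := fun K =>
    ∫ y in T.domain, ballBump (x K) (t * (inscribedDiam K / 8)) y * w y with hJ
  have hdist : ∀ K ∈ T.elements, b ∈ simplexHull K → simplexDiam K ≤ h →
      ‖IsSimplex.inCenter K - b‖ ≤ h := fun K hK hb hKh => by
    rw [← dist_eq_norm]
    exact (IsSimplex.dist_le_diam ((T.isSimplex hK).inCenter_mem hd) hb).trans hKh
  have hin : ∀ K ∈ T.elements, b ∈ simplexHull K →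
      Metric.closedBall (x K) (t * (inscribedDiam K / 8)) ⊆ interior (simplexHull K) :=
    fun K hK hb => IsSimplex.homothetic_ball_subset_interior hb
      ((T.isSimplex hK).ball_inCenter_subset_interior hd) ht0 ht1
  -- First kind of motion: contraction of the averaging ball towards the face inside the convex set
  -- `K`.
  have hstep : ∀ K ∈ T.elements, b ∈ simplexHull K → ρ ≤ inscribedDiam K → simplexDiam K ≤ h →
      (T.elemMean w K - J K) ^ 2 ≤
        C * (3 * h) ^ 2 * (r ^ d)⁻¹ * ∫ y in simplexHull K, ‖G y‖ ^ 2 := by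
    intro K hK hb hρK hKh
    have hs := T.isSimplex hK
    have hρK' : inscribedDiam K ≤ h := (hs.inscribedDiam_le_diam hd).trans hKh
    have key := hC2 T.domain (interior (simplexHull K)) w G (x K) (IsSimplex.inCenter K) r
      (t * (inscribedDiam K / 8)) (inscribedDiam K / 8) T.volume_domain_lt_top.ne hw.1 hGm
      hw.hasWeakGradient (interior_hull_subset_domain hK)
      (IsSimplex.convex_simplexHull K).interior hr0 (by rw [hrt]; gcongr)
      (by rw [hrt]; nlinarith) (hin K hK hb) (hs.ball_inCenter_subset_interior hd)
    refine key.trans ?_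
    have e1 : ‖IsSimplex.inCenter K - x K‖ ≤ h := by
      have : IsSimplex.inCenter K - x K = (1 - t) • (IsSimplex.inCenter K - b) := by
        rw [hx]; module
      rw [this, norm_smul, Real.norm_eq_abs, abs_of_nonneg (by linarith)]
      have := hdist K hK hb hKh
      nlinarith [norm_nonneg (IsSimplex.inCenter K - b)]
    have e2 : |inscribedDiam K / 8 - t * (inscribedDiam K / 8)| ≤ h := by
      rw [abs_of_nonneg (by nlinarith)]
      nlinarith
    have e3 : ∫ y in interior (simplexHull K), ‖G y‖ ^ 2 ≤ ∫ y in simplexHull K, ‖G y‖ ^ 2 :=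
      setIntegral_mono_set (hGi.on_element hK) (.of_forall fun _ => sq_nonneg _)
        (.of_forall interior_subset)
    have e4 : ‖IsSimplex.inCenter K - x K‖ + |inscribedDiam K / 8 - t * (inscribedDiam K / 8)| ≤
        3 * h := by linarith
    have e5 : 0 ≤ ∫ y in interior (simplexHull K), ‖G y‖ ^ 2 :=
      integral_nonneg fun _ => sq_nonneg _
    gcongr
  have hU : Metric.ball b (ρ / d) ⊆ simplexHull K₁ ∪ simplexHull K₂ :=
    hball _ (by gcongr) (by gcongr)
  have hUΩ : Metric.ball b (ρ / d) ⊆ T.domain :=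
    interior_maximal (hU.trans (union_subset (T.hull_subset_support hK₁)
      (T.hull_subset_support hK₂))) Metric.isOpen_ball
  have hinU : ∀ K ∈ T.elements, b ∈ simplexHull K → simplexDiam K ≤ h →
      Metric.closedBall (x K) (t * (inscribedDiam K / 8)) ⊆ Metric.ball b (ρ / d) := by
    intro K hK hb hKh y hy
    rw [Metric.mem_ball]
    have h1 : dist (x K) b ≤ t * h := by
      rw [dist_eq_norm, hx, add_sub_cancel_left, norm_smul, Real.norm_eq_abs, abs_of_pos ht0]
      exact mul_le_mul_of_nonneg_left (hdist K hK hb hKh) ht0.le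
    have h2 : t * (inscribedDiam K / 8) ≤ t * (h / 8) := by
      have := ((T.isSimplex hK).inscribedDiam_le_diam hd).trans hKh
      gcongr
    have h3 : t * h + t * (h / 8) < ρ / d := by
      have : t * h + t * (h / 8) = 9 / 16 * (ρ / d) := by rw [ht]; field_simp; norm_num
      have : 0 < ρ / d := by positivity
      linarith
    have h4 := dist_triangle y (x K) b
    have h5 := Metric.mem_closedBall.1 hy
    linarith
  -- Second kind of motion: passage between the two contracted balls inside the ball around `b`. The
  -- union of the two elements need not be convex, which is why this detour is made.
  have hmid : (J K₁ - J K₂) ^ 2 ≤ C * (3 * h) ^ 2 * (r ^ d)⁻¹ * (I₁ + I₂) := by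
    have key := hC2 T.domain (Metric.ball b (ρ / d)) w G (x K₂) (x K₁) r
      (t * (inscribedDiam K₂ / 8)) (t * (inscribedDiam K₁ / 8)) T.volume_domain_lt_top.ne hw.1 hGm
      hw.hasWeakGradient hUΩ (convex_ball _ _) hr0 (by rw [hrt]; gcongr) (by rw [hrt]; gcongr)
      (hinU K₂ hK₂ hb₂ hh₂) (hinU K₁ hK₁ hb₁ hh₁)
    refine key.trans ?_
    have e1 : ‖x K₁ - x K₂‖ ≤ 2 * h := by
      have : x K₁ - x K₂ = t • (IsSimplex.inCenter K₁ - b) - t • (IsSimplex.inCenter K₂ - b) := by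
        rw [hx]; module
      rw [this]
      refine (norm_sub_le _ _).trans ?_
      rw [norm_smul, norm_smul, Real.norm_eq_abs, abs_of_pos ht0]
      have h1 := hdist K₁ hK₁ hb₁ hh₁
      have h2 := hdist K₂ hK₂ hb₂ hh₂
      nlinarith [norm_nonneg (IsSimplex.inCenter K₁ - b), norm_nonneg (IsSimplex.inCenter K₂ - b)]
    have e2 : |t * (inscribedDiam K₁ / 8) - t * (inscribedDiam K₂ / 8)| ≤ h := by
      have h1 := ((T.isSimplex hK₁).inscribedDiam_le_diam hd).trans hh₁
      have h2 := ((T.isSimplex hK₂).inscribedDiam_le_diam hd).trans hh₂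
      rw [← mul_sub, abs_mul, abs_of_pos ht0]
      have : |inscribedDiam K₁ / 8 - inscribedDiam K₂ / 8| ≤ h := by
        rw [abs_le]; constructor <;> linarith
      nlinarith [abs_nonneg (inscribedDiam K₁ / 8 - inscribedDiam K₂ / 8)]
    have e3 : ∫ y in Metric.ball b (ρ / d), ‖G y‖ ^ 2 ≤ I₁ + I₂ := by
      have i1 := hGi.on_element hK₁
      have i2 := hGi.on_element hK₂
      refine (setIntegral_mono_set (i1.union i2) (.of_forall fun _ => sq_nonneg _)
        (.of_forall hU)).trans_eq ?_
      exact setIntegral_union₀ (aedisjoint hK₁ hK₂ hne)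
        (IsSimplex.measurableSet_simplexHull K₂).nullMeasurableSet i1 i2
    have e4 : ‖x K₁ - x K₂‖ + |t * (inscribedDiam K₁ / 8) - t * (inscribedDiam K₂ / 8)| ≤
        3 * h := by linarith
    have e5 : 0 ≤ ∫ y in Metric.ball b (ρ / d), ‖G y‖ ^ 2 := integral_nonneg fun _ => sq_nonneg _
    gcongr
  have s1 := hstep K₁ hK₁ hb₁ hρ₁ hh₁
  have s2 := hstep K₂ hK₂ hb₂ hρ₂ hh₂
  have hH : 0 ≤ C * (3 * h) ^ 2 * (r ^ d)⁻¹ := by positivity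
  set H := C * (3 * h) ^ 2 * (r ^ d)⁻¹ with hHdef
  calc (T.elemMean w K₁ - T.elemMean w K₂) ^ 2
      ≤ 3 * (T.elemMean w K₁ - J K₁) ^ 2 + 3 * (J K₁ - J K₂) ^ 2 +
          3 * (T.elemMean w K₂ - J K₂) ^ 2 := by
        have := sq_add_sub_le_three (T.elemMean w K₁ - J K₁) (J K₁ - J K₂) (T.elemMean w K₂ - J K₂)
        convert this using 2; ring
    _ ≤ 6 * H * (I₁ + I₂) := by linarith
    _ = _ := by rw [hHdef]; ring

end SimplicialMesh

/-! ## Localization on shape-regular meshes -/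

namespace SimplicialMesh

variable {d ℓ : ℕ} {T : SimplicialMesh d} {K F F' : Finset (Euc d)} {ε : ℝ} {u : Euc d → ℝ}
  {P : Finset (Euc d) → Euc d → ℝ}

theorem integrableOn_bump_mul {w : Euc d → ℝ} (hw : MemLp w 2 (volume.restrict (simplexHull K)))
    (x : Euc d) (r : ℝ) : IntegrableOn (fun y => ballBump x r y * w y) (simplexHull K) :=
  (memLp_of_continuous (contDiff_ballBump x r).continuous K).integrable_mul hw

/-- The function `u` cancels, leaving a mean of polynomials; so corrected approximations can be
compared by estimates for polynomials alone. -/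
theorem elemMean_sub_elemMean (hd : 1 ≤ d) (hu : MemH1 T.domain u) (hK : K ∈ T.elements)
    {v v' : Euc d → ℝ} (hv : v ∈ T.feSpace ℓ) (hv' : v' ∈ T.feSpace ℓ) :
    T.elemMean (u - v') K - T.elemMean (u - v) K =
      ∫ y in simplexHull K, ballBump (IsSimplex.inCenter K) (inscribedDiam K / 8) y *
        (piece ℓ v K y - piece ℓ v' K y) := by
  rw [elemMean_eq hd hK, elemMean_eq hd hK, ← integral_sub
    (integrableOn_bump_mul (memLp_element (hu.sub (memH1_feSpace hv')).1 hK) _ _)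
    (integrableOn_bump_mul (memLp_element (hu.sub (memH1_feSpace hv)).1 hK) _ _)]
  refine setIntegral_congr_fun (IsSimplex.measurableSet_simplexHull K) fun y hy => ?_
  simp only [Pi.sub_apply]
  rw [(piece_spec hv hK).2 hy, (piece_spec hv' hK).2 hy]
  ring

theorem integral_bump_element (hd : 1 ≤ d) (hK : K ∈ T.elements) :
    ∫ y in simplexHull K, ballBump (IsSimplex.inCenter K) (inscribedDiam K / 8) y = 1 := by
  have hs := T.isSimplex hK
  have hρ := hs.inscribedDiam_pos hd
  rw [setIntegral_eq_integral_of_forall_compl_eq_zero, integral_ballBump (by positivity)]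
  exact fun y hy => ballBump_eq_zero (by positivity) fun h =>
    hy (interior_subset (hs.ball_inCenter_subset_interior hd h))

/-- Two local approximations that are corrected to have the same mean are close to each other. -/
theorem sq_corrected_sub_le (hd : 1 ≤ d) (hℓ : 1 ≤ ℓ) (hε : 0 ≤ ε) (hu : MemH1 T.domain u)
    (hP : ∀ F, P F ∈ T.feSpace ℓ) (hK : K ∈ T.elements) (hF : F ∈ T.facesOf K)
    (hF' : F' ∈ T.facesOf K) {z : Euc d} (hz : z ∈ simplexHull K) :
    ε * simplexVol K * (piece ℓ (P F') K z + T.elemMean (u - P F') K -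
        (piece ℓ (P F) K z + T.elemMean (u - P F) K)) ^ 2 ≤
      4 * simplexDiam K ^ 2 * IsSimplex.invConst d ℓ * T.patchSq ε u P K := by
  have hs := T.isSimplex hK
  have hv := hs.simplexVol_pos
  have hρ := hs.inscribedDiam_pos hd
  set p := piece ℓ (P F) K with hp
  set p' := piece ℓ (P F') K with hp'
  have hpp : IsPolyFun ℓ p := (piece_spec (hP F) hK).1
  have hpp' : IsPolyFun ℓ p' := (piece_spec (hP F') hK).1
  set c := T.elemMean (u - P F') K - T.elemMean (u - P F) K with hc
  set η := ballBump (IsSimplex.inCenter K) (inscribedDiam K / 8) with hη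
  have hηc : Continuous η := (contDiff_ballBump _ _).continuous
  set q : Euc d → ℝ := fun y => p' y - p y + c with hq
  have hqp : IsPolyFun ℓ q := (hpp'.sub hpp).add (IsPolyFun.const c)
  have hη1 : ∫ y in simplexHull K, η y = 1 := integral_bump_element hd hK
  have hηi : IntegrableOn η (simplexHull K) :=
    hηc.continuousOn.integrableOn_compact (IsSimplex.isCompact_simplexHull K)
  -- After correction both polynomials have the same weighted mean as `u`. This cancellation is the
  -- purpose of the constants and opens the way to the Poincaré inequality.
  have h0 : ∫ y in simplexHull K, η y * q y = 0 := by
    have e : ∀ y, η y * q y = c * η y - η y * (p y - p' y) := fun y => by rw [hq]; ring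
    simp only [e]
    rw [integral_sub (hηi.const_mul c), integral_const_mul, hη1, mul_one,
      ← elemMean_sub_elemMean hd hu hK (hP F) (hP F'), sub_self]
    exact ((hηc.mul (hpp.continuous.sub hpp'.continuous)).continuousOn.integrableOn_compact
      (IsSimplex.isCompact_simplexHull K))
  have hg : ∀ y, gradient q y = gradient p' y - gradient p y := fun y =>
    HasGradientAt.gradient (by
      rw [hasGradientAt_iff_hasFDerivAt, map_sub]
      exact ((hpp'.hasGradientAt y).hasFDerivAt.sub (hpp.hasGradientAt y).hasFDerivAt).add_const c)
  have key := hs.sq_poly_le_gradient hℓ hqp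
    (fun y _ => ballBump_nonneg (by positivity : 0 < inscribedDiam K / 8) _ y) hηi hη1 h0 hz
  have h1 := memLp_element (hu.memLp_weakGradient T.isOpen_domain) hK
  have h2 := integral_norm_sq_add_le (h1.sub (memLp_of_continuous hpp.continuous_gradient K))
    (h1.sub (memLp_of_continuous hpp'.continuous_gradient K)).neg
  simp only [Pi.sub_apply, Pi.neg_apply, neg_sub, sub_add_sub_cancel',
    fun x => norm_sub_rev (gradient p' x) (weakGradient T.domain u x)] at h2
  have h3 := integral_sq_gradient_le_polySq (T := T) (ε := ε) u p K
  have h4 := integral_sq_gradient_le_polySq (T := T) (ε := ε) u p' K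
  have h5 := polySq_piece_le_patchSq hε hu hP hK hF
  have h6 := polySq_piece_le_patchSq hε hu hP hK hF'
  have hgi : ε * ∫ y in simplexHull K, ‖gradient q y‖ ^ 2 ≤ 4 * T.patchSq ε u P K := by
    simp only [hg]
    have := mul_le_mul_of_nonneg_left h2 hε
    linarith
  have hi := IsSimplex.invConst_pos d ℓ
  have e : p' z + T.elemMean (u - P F') K - (p z + T.elemMean (u - P F) K) = q z := by
    rw [hq, hc]; ring
  rw [e]
  calc ε * simplexVol K * q z ^ 2 ≤ ε * simplexVol K * (simplexDiam K ^ 2 *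
        (IsSimplex.invConst d ℓ / simplexVol K) *
          ∫ y in simplexHull K, ‖gradient q y‖ ^ 2) := by gcongr
    _ = simplexDiam K ^ 2 * IsSimplex.invConst d ℓ *
          (ε * ∫ y in simplexHull K, ‖gradient q y‖ ^ 2) := by field_simp
    _ ≤ simplexDiam K ^ 2 * IsSimplex.invConst d ℓ * (4 * T.patchSq ε u P K) := by gcongr
    _ = _ := by ring

theorem polySq_add_const_le (hε : 0 ≤ ε) (hu : MemH1 T.domain u) (hK : K ∈ T.elements)
    {q : Euc d → ℝ} (hq : IsPolyFun ℓ q) (c : ℝ) :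
    T.polySq ε u (fun x => q x + c) K ≤ 2 * T.polySq ε u q K + 2 * (simplexVol K * c ^ 2) := by
  refine (polySq_add_le hε hu hK hq (IsPolyFun.const c)).trans_eq ?_
  have : ∀ x : Euc d, gradient (fun _ : Euc d => c) x = 0 := fun x => by
    rw [← norm_eq_zero, IsSimplex.norm_gradient]; simp
  simp only [this]
  rw [setIntegral_const]
  simp [simplexVol]

theorem simplexVol_mul_inv_pow_le (hd : 1 ≤ d) (hK : K ∈ T.elements) {s r : ℝ} (hr : 0 < r)
    (hs : simplexDiam K ≤ s * r) :
    simplexVol K * (r ^ d)⁻¹ ≤ s ^ d * volume.real (Metric.closedBall (0 : Euc d) 1) := by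
  have h1 := (T.isSimplex hK).simplexVol_le hd
  have h2 : simplexDiam K ^ d ≤ (s * r) ^ d := pow_le_pow_left₀ Metric.diam_nonneg hs d
  have h3 : (0 : ℝ) ≤ volume.real (Metric.closedBall (0 : Euc d) 1) := measureReal_nonneg
  rw [← div_eq_mul_inv, div_le_iff₀ (by positivity)]
  calc _ ≤ _ := h1
    _ ≤ (s * r) ^ d * volume.real (Metric.closedBall (0 : Euc d) 1) := by gcongr
    _ = _ := by rw [mul_pow]; ring

/-- The L² part of the weighted jump is treated as for small ε. The gradient part gains a factor of
order ρ_K², which cancels the division by ρ_K² in the weight; comparability of the diameters around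
`z` makes this uniform. -/
theorem exists_localization_of_shape (hd : 1 ≤ d) (hℓ : 1 ≤ ℓ) (n : ℕ) (μ σ : ℝ) :
    ∃ C : ℝ, 0 < C ∧ ∀ T : SimplicialMesh d, 2 ≤ T.elements.card → IsConnected T.domain →
      T.FaceConnected ℓ → T.nBar ℓ ≤ n → T.mu ≤ μ → T.shape ≤ σ → ∀ ε : ℝ, 0 < ε →
      ∀ u, MemH1 T.domain u → T.bestError ℓ ε T.domain u ≤ C * T.pairError ℓ ε u := by
  obtain ⟨C₁, hC₁, havg, -⟩ := exists_average_bound d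
  obtain ⟨C₂, hC₂, hmean⟩ := exists_elemMean_sub_bound d hd
  have hd0 : (0 : ℝ) < d := by exact_mod_cast hd
  -- The maximum with one makes the shape bound positive whatever `σ` is.
  set s := max σ 1 with hs
  have hs1 : 1 ≤ s := le_max_right _ _
  have hs0 : 0 < s := one_pos.trans_le hs1
  set I := IsSimplex.invConst d ℓ with hI
  have hI0 : 0 < I := IsSimplex.invConst_pos d ℓ
  set V₁ := volume.real (Metric.closedBall (0 : Euc d) 1) with hV₁
  have hV₁0 : 0 ≤ V₁ := measureReal_nonneg
  set A : ℝ := 2 + 2 * (C₁ * ((8 * s) ^ d * V₁)) with hA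
  have hA0 : 0 ≤ A := by positivity
  -- The first summand bounds the L² part of the jump; the second its ε-part, composed of two
  -- corrected differences and one difference of means, each with a factor three from squaring a
  -- three-term sum.
  set B : ℝ := μ ^ 2 * (4 * (A + 1) * I) +
    s ^ 2 * (12 * (μ ^ 2 * I) + 3 * (C₂ * ((16 * d * s ^ 4) ^ d * V₁))) with hB
  have hB0 : 0 ≤ B := by positivity
  refine ⟨Real.sqrt (localizationConst d ℓ n A B) + 1, by positivity, ?_⟩
  intro T hT hΩ hfc hn hμ hσ ε hε u hu
  have hσ' : T.shape ≤ s := hσ.trans (le_max_left _ _)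
  have hface : ∀ K, ∃ F, K ∈ T.elements → F ∈ T.facesOf K := by
    intro K
    by_cases hK : K ∈ T.elements
    · obtain ⟨F, hF⟩ := facesOf_nonempty hℓ hT hΩ hfc hK
      exact ⟨F, fun _ => hF⟩
    · exact ⟨∅, fun h => absurd h hK⟩
  choose f hf using hface
  have hC0 : 0 ≤ localizationConst d ℓ n A B := by unfold localizationConst; positivity
  refine (bestError_le_of_forall hC0 fun P hP => ?_).trans
    (mul_le_mul_of_nonneg_right (by linarith) (Real.sqrt_nonneg _))
  -- The added constant gives Q_K the same weighted mean as `u` on `K`.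
  set Q : Finset (Euc d) → Euc d → ℝ := fun K x =>
    piece ℓ (P (f K)) K x + T.elemMean (u - P (f K)) K with hQ
  have hw : ∀ F, MemH1 T.domain (u - P F) := fun F => hu.sub (memH1_feSpace (hP F))
  have hQp : ∀ K ∈ T.elements, IsPolyFun ℓ (Q K) := fun K hK =>
    (piece_spec (hP _) hK).1.add (IsPolyFun.const _)
  have hAK : ∀ K ∈ T.elements, T.polySq ε u (Q K) K ≤ A * T.patchSq ε u P K := by
    intro K hK
    have hsK := T.isSimplex hK
    have hρ := hsK.inscribedDiam_pos hd
    have hv := hsK.simplexVol_pos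
    refine (polySq_add_const_le hε.le hu hK (piece_spec (hP _) hK).1 _).trans ?_
    have h1 := polySq_piece_le_patchSq hε.le hu hP hK (hf K hK)
    have h2 := havg (simplexHull K) (IsSimplex.inCenter K) (inscribedDiam K / 8) (u - P (f K))
      (by positivity) ((hsK.ball_inCenter_subset_interior hd).trans interior_subset)
      (memLp_element (hw _).1 hK)
    rw [← elemMean_eq hd hK] at h2
    have h3 := (integral_sq_le_elemSq (T := T) hε.le (u - P (f K)) K).trans
      (elemSq_le_patchSq hε.le hu hP hK (hf K hK))
    have hself : K ∈ T.neighbors K :=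
      mem_neighbors_of_mem hK (hsK.inCenter_mem hd) (hsK.inCenter_mem hd)
    have h4 := simplexVol_mul_inv_pow_le (s := 8 * s) hd hK
      (by positivity : 0 < inscribedDiam K / 8)
      (by have := simplexDiam_le hd hK hself hσ'; linarith)
    have hS := patchSq_nonneg (T := T) (ε := ε) u P K
    have h5 : simplexVol K * T.elemMean (u - P (f K)) K ^ 2 ≤
        C₁ * ((8 * s) ^ d * V₁) * T.patchSq ε u P K := by
      calc _ ≤ simplexVol K * (C₁ * ((inscribedDiam K / 8) ^ d)⁻¹ * T.patchSq ε u P K) := by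
            refine mul_le_mul_of_nonneg_left (h2.trans ?_) hv.le
            gcongr
        _ = C₁ * (simplexVol K * ((inscribedDiam K / 8) ^ d)⁻¹) * T.patchSq ε u P K := by ring
        _ ≤ _ := by gcongr
    rw [hA]
    linarith
  refine bestError_sq_le hd hℓ hfc hn hε.le hu P hQp hA0 hB0 hAK ?_
  intro K hK K₁ hK₁ K₂ hK₂ F hF hne hF₁ hF₂ z hz hzK
  have hz₁ : z ∈ simplexHull K₁ := convexHull_mono (by exact_mod_cast hF₁) hz
  have hz₂ : z ∈ simplexHull K₂ := convexHull_mono (by exact_mod_cast hF₂) hz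
  have hρ := (T.isSimplex hK).inscribedDiam_pos hd
  have hv := (T.isSimplex hK).simplexVol_pos
  have hμ0 := mu_sq_pos hK hμ
  set ρ := inscribedDiam K with hρdef
  set W := simplexVol K with hW
  set S := T.patchSq ε u P K₁ + T.patchSq ε u P K₂ with hS
  have hS₁ := patchSq_nonneg (T := T) (ε := ε) u P K₁
  have hS₂ := patchSq_nonneg (T := T) (ε := ε) u P K₂
  have hn₁ := mem_neighbors_of_mem hK₁ hzK hz₁
  have hn₂ := mem_neighbors_of_mem hK₂ hzK hz₂
  have hj := sq_jump_le hℓ hε.le hu hP hQp hAK hK₁ hK₂ hF hF₁ hF₂ hz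
    (V := W / μ ^ 2) (by positivity)
    ((div_le_iff₀' hμ0).2 (simplexVol_le hK hn₁ hμ))
    ((div_le_iff₀' hμ0).2 (simplexVol_le hK hn₂ hμ))
  have hdiam : ∀ K' ∈ T.elements, z ∈ simplexHull K' →
      simplexDiam K' ≤ s * ρ ∧ ρ / s ≤ inscribedDiam K' := fun K' hK' hz' => by
    refine ⟨simplexDiam_le hd hK (mem_neighbors_of_mem hK' hzK hz') hσ', ?_⟩
    rw [div_le_iff₀' hs0]
    exact ((T.isSimplex hK).inscribedDiam_le_diam hd).trans
      (simplexDiam_le hd hK' (mem_neighbors_of_mem hK hz' hzK) hσ')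
  obtain ⟨hh₁, hρ₁⟩ := hdiam K₁ hK₁ hz₁
  obtain ⟨hh₂, hρ₂⟩ := hdiam K₂ hK₂ hz₂
  have hm := hmean T K₁ K₂ F (u - P F) (ρ / s) (s * ρ) hK₁ hK₂ hF hne hF₁ hF₂ (hw F)
    (by positivity) hρ₁ hρ₂ hh₁ hh₂
  set r := (ρ / s) ^ 2 / (16 * d * (s * ρ)) with hr
  have hr0 : 0 < r := by positivity
  have hWr : W * (r ^ d)⁻¹ ≤ (16 * d * s ^ 4) ^ d * V₁ := by
    refine simplexVol_mul_inv_pow_le hd hK hr0 ?_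
    -- Here r = ρ / (16 d s³), so the factor 16 d s⁴ recovers the bound sρ for the diameter of `K`.
    have : 16 * d * s ^ 4 * r = s * ρ := by rw [hr]; field_simp
    rw [this]
    exact (hdiam K hK hzK).1
  have hcorr : ∀ K' ∈ T.elements, F ⊆ K' → z ∈ simplexHull K' → simplexDiam K' ≤ s * ρ →
      W ≤ μ ^ 2 * simplexVol K' →
      ε * W * (Q K' z - (P F z + T.elemMean (u - P F) K')) ^ 2 ≤
        4 * (s * ρ) ^ 2 * (μ ^ 2 * I) * T.patchSq ε u P K' := by
    intro K' hK' hFK' hz' hh' hW'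
    have h := sq_corrected_sub_le hd hℓ hε.le hu hP hK' (mem_facesOf.2 ⟨hF, hFK'⟩)
      (hf K' hK') hz'
    rw [(piece_spec (hP F) hK').2 hz']
    have hS' := patchSq_nonneg (T := T) (ε := ε) u P K'
    have hh0 : 0 ≤ simplexDiam K' := Metric.diam_nonneg
    set X := (Q K' z - (piece ℓ (P F) K' z + T.elemMean (u - P F) K')) ^ 2 with hX
    have hX0 : 0 ≤ X := sq_nonneg _
    calc ε * W * X ≤ ε * (μ ^ 2 * simplexVol K') * X := by gcongr
      _ = μ ^ 2 * (ε * simplexVol K' * X) := by ring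
      _ ≤ μ ^ 2 * (4 * simplexDiam K' ^ 2 * I * T.patchSq ε u P K') := by gcongr
      _ ≤ μ ^ 2 * (4 * (s * ρ) ^ 2 * I * T.patchSq ε u P K') := by gcongr
      _ = _ := by ring
  have hc₁ := hcorr K₁ hK₁ hF₁ hz₁ hh₁ (simplexVol_le hK hn₁ hμ)
  have hc₂ := hcorr K₂ hK₂ hF₂ hz₂ hh₂ (simplexVol_le hK hn₂ hμ)
  have hm' : ε * W * (T.elemMean (u - P F) K₁ - T.elemMean (u - P F) K₂) ^ 2 ≤
      (s * ρ) ^ 2 * (C₂ * ((16 * d * s ^ 4) ^ d * V₁)) * S := by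
    have g₁ := (integral_sq_gradient_le_elemSq (T := T) (ε := ε) (u - P F) K₁).trans
      (elemSq_le_patchSq hε.le hu hP hK₁ (mem_facesOf.2 ⟨hF, hF₁⟩))
    have g₂ := (integral_sq_gradient_le_elemSq (T := T) (ε := ε) (u - P F) K₂).trans
      (elemSq_le_patchSq hε.le hu hP hK₂ (mem_facesOf.2 ⟨hF, hF₂⟩))
    set G₁ := ∫ x in simplexHull K₁, ‖weakGradient T.domain (u - P F) x‖ ^ 2
    set G₂ := ∫ x in simplexHull K₂, ‖weakGradient T.domain (u - P F) x‖ ^ 2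
    calc _ ≤ ε * W * (C₂ * (s * ρ) ^ 2 * (r ^ d)⁻¹ * (G₁ + G₂)) := by gcongr
      _ = (s * ρ) ^ 2 * (C₂ * (W * (r ^ d)⁻¹)) * (ε * G₁ + ε * G₂) := by ring
      _ ≤ (s * ρ) ^ 2 * (C₂ * (W * (r ^ d)⁻¹)) * S := by
          gcongr
          exact add_le_add g₁ g₂
      _ ≤ _ := by gcongr
  set D := (Q K₁ z - Q K₂ z) ^ 2 with hD
  have hD0 : 0 ≤ D := sq_nonneg _
  -- The jump is split by inserting P_F plus its mean correction on either side: two differences on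
  -- single elements and the difference of the means of `u - P F`.
  have hgrad : ε * W * D ≤ (s * ρ) ^ 2 *
      (12 * (μ ^ 2 * I) + 3 * (C₂ * ((16 * d * s ^ 4) ^ d * V₁))) * S := by
    have h3 := sq_add_sub_le_three (Q K₁ z - (P F z + T.elemMean (u - P F) K₁))
      (T.elemMean (u - P F) K₁ - T.elemMean (u - P F) K₂)
      (Q K₂ z - (P F z + T.elemMean (u - P F) K₂))
    have e : Q K₁ z - (P F z + T.elemMean (u - P F) K₁) +
        (T.elemMean (u - P F) K₁ - T.elemMean (u - P F) K₂) -
        (Q K₂ z - (P F z + T.elemMean (u - P F) K₂)) = Q K₁ z - Q K₂ z := by ring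
    rw [e] at h3
    have h4 := mul_le_mul_of_nonneg_left h3 (by positivity : 0 ≤ ε * W)
    rw [hS] at hm' ⊢
    linarith
  have hflat : W * D ≤ μ ^ 2 * (4 * (A + 1) * I) * S := by
    have := mul_le_mul_of_nonneg_left hj hμ0.le
    rw [← mul_assoc, mul_div_cancel₀ _ hμ0.ne'] at this
    rw [mul_assoc]; exact this
  have hscaled : ε / ρ ^ 2 * (W * D) ≤
      s ^ 2 * (12 * (μ ^ 2 * I) + 3 * (C₂ * ((16 * d * s ^ 4) ^ d * V₁))) * S := by
    rw [div_mul_eq_mul_div, div_le_iff₀ (by positivity), ← mul_assoc]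
    refine hgrad.trans_eq (by ring)
  calc W * (1 + ε / ρ ^ 2) * D = W * D + ε / ρ ^ 2 * (W * D) := by ring
    _ ≤ B * S := by rw [hB]; linarith

end SimplicialMesh

theorem theorem5p2 (d ℓ : ℕ) (hd : 1 ≤ d) (hℓ : 1 ≤ ℓ) :
    -- `C` bounded in terms of `ℓ`, `d`, `n̄`, `μ_T` and the shape parameter
    (∀ (n : ℕ) (μ σ : ℝ), ∃ C : ℝ, 0 < C ∧
      ∀ T : SimplicialMesh d, 2 ≤ T.elements.card → IsConnected T.domain → T.FaceConnected ℓ →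
        T.nBar ℓ ≤ n → T.mu ≤ μ → T.shape ≤ σ →
        ∀ ε : ℝ, 0 < ε → ∀ u : EuclideanSpace ℝ (Fin d) → ℝ, MemH1 T.domain u →
          T.bestError ℓ ε T.domain u ≤ C * T.pairError ℓ ε u ∧
          C * T.pairError ℓ ε u ≤ C * (d + 1) * T.bestError ℓ ε T.domain u) ∧
    -- no dependence on the shape parameter if `ε ≤ κ min_K ρ_K²`
    (∀ (n : ℕ) (μ κ : ℝ), ∃ C : ℝ, 0 < C ∧
      ∀ T : SimplicialMesh d, 2 ≤ T.elements.card → IsConnected T.domain → T.FaceConnected ℓ →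
        T.nBar ℓ ≤ n → T.mu ≤ μ →
        ∀ ε : ℝ, 0 < ε → (∀ K ∈ T.elements, ε ≤ κ * inscribedDiam K ^ 2) →
        ∀ u : EuclideanSpace ℝ (Fin d) → ℝ, MemH1 T.domain u →
          T.bestError ℓ ε T.domain u ≤ C * T.pairError ℓ ε u ∧
          C * T.pairError ℓ ε u ≤ C * (d + 1) * T.bestError ℓ ε T.domain u) := by
  have hchain : ∀ (T : SimplicialMesh d) (C ε : ℝ) (u : EuclideanSpace ℝ (Fin d) → ℝ), 0 < C →
      0 < ε → MemH1 T.domain u →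
      C * T.pairError ℓ ε u ≤ C * (d + 1) * T.bestError ℓ ε T.domain u := by
    intro T C ε u hC hε hu
    rw [mul_assoc]
    exact mul_le_mul_of_nonneg_left (SimplicialMesh.pairError_le hε.le hu) hC.le
  refine ⟨fun n μ σ => ?_, fun n μ κ => ?_⟩
  · obtain ⟨C, hC, h⟩ := SimplicialMesh.exists_localization_of_shape hd hℓ n μ σ
    exact ⟨C, hC, fun T hT hΩ hfc hn hμ hσ ε hε u hu =>
      ⟨h T hT hΩ hfc hn hμ hσ ε hε u hu, hchain T C ε u hC hε hu⟩⟩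
  · obtain ⟨C, hC, h⟩ := SimplicialMesh.exists_localization_of_small hd hℓ n μ κ
    exact ⟨C, hC, fun T hT hΩ hfc hn hμ ε hε hκ u hu =>
      ⟨h T hT hΩ hfc hn hμ ε hε hκ u hu, hchain T C ε u hC hε hu⟩⟩
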